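/- Let $\Bbbk$ be a commutative ring and let $\mathcal C$ be a spherical fusion category over $\Bbbk$. That is: $\mathcal C$ is a $\Bbbk$-linear autonomous (rigid) monoidal category with finite direct sums and $\Bbbk$-bilinear tensor product, with left duals ${}^\vee X$ (evaluation $\mathrm{ev}_X:{}^\vee X\otimes X\to\mathbb 1$, coevaluation $\mathrm{coev}_X:\mathbb 1\to X\otimes{}^\vee X$), together with a finite family $(V_i)_{i\in I}$ of objects such that $\mathrm{Hom}(V_i,V_j)=\delta_{i,j}\Bbbk$, every object is a finite direct sum of objects of the family, and $\mathbb 1\cong V_0$ for some $0\in I$; and $\mathcal C$ is endowed with a monoidal natural isomorphism $\phi_X:X\to{}^{\vee\vee}X$ such that the left and right traces of every endomorphism coincide. Write $\dim(X)=\mathrm{ev}_X(\mathrm{id}_{{}^\vee X}\otimes\phi_X^{-1})\,\mathrm{coev}_{{}^\vee X}\in\mathrm{End}(\mathbb 1)$. Canonical isomorphisms of monoidal categories and of duals are suppressed below. Let $\mathcal Z(\mathcal C)$ be the Drinfeld center: its objects are pairs $(M,\sigma)$ with $\sigma_Y:M\otimes Y\to Y\otimes M$ a half-braiding, and its braiding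 is $\tau_{(M,\sigma),(N,\gamma)}=\sigma_N$. Put $$C=\bigoplus_{i,j\in I}{}^\vee V_i\otimes{}^\vee V_j\otimes{}^{\vee\vee}V_i\otimes V_j .$$ For $(M,\sigma)$ in $\mathcal Z(\mathcal C)$ choose morphisms $p_a:M\to V_{s(a)}$, $q_a:V_{s(a)}\to M$ ($1\le a\le n$) with $p_aq_b=\delta_{a,b}\,\mathrm{id}$ and $\sum_a q_ap_a=\mathrm{id}_M$, let $r_i=(\mathrm{ev}_{V_i}\otimes\mathrm{id}_M)(\mathrm{id}_{{}^\vee V_i}\otimes\sigma_{V_i}):{}^\vee V_i\otimes M\otimes V_i\to M$, and let $$I_{(M,\sigma)}=\sum_{i\in I}\sum_{a}{}^\vee\bigl(r_i(\mathrm{id}_{{}^\vee V_i}\otimes q_a\otimes\mathrm{id}_{V_i})\bigr)\otimes p_a:\ {}^\vee M\otimes M\to C,$$ where the $(i,a)$-term takes values in the summand of $C$ indexed by $(i,s(a))$ (via ${}^\vee({}^\vee V_i\otimes V_{s(a)}\otimes V_i)\cong{}^\vee V_i\otimes{}^\vee V_{s(a)}\otimes{}^{\vee\vee}V_i$). Theorem.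 There is a half-braiding on $C$ for which all the $I_{(M,\sigma)}$ (which do not depend on the choice of the $p_a,q_a$) are morphisms of $\mathcal Z(\mathcal C)$ and form a universal dinatural transformation, so that $C$ is the coend $\int^{(M,\sigma)\in\mathcal Z(\mathcal C)}{}^\vee(M,\sigma)\otimes(M,\sigma)$ of $\mathcal Z(\mathcal C)$. This coend is a Hopf algebra $(C,m_C,u_C,\Delta_C,\varepsilon_C,S_C)$ in the braided category $\mathcal Z(\mathcal C)$ with its canonical structure: for the coactions $\delta_X=(\mathrm{id}_X\otimes I_X)(\mathrm{coev}_X\otimes\mathrm{id}_X):X\to X\otimes C$, $X\in\mathcal Z(\mathcal C)$, $$(\mathrm{id}_X\otimes\Delta_C)\delta_X=(\delta_X\otimes\mathrm{id}_C)\delta_X,\quad(\mathrm{id}_X\otimes\varepsilon_C)\delta_X=\mathrm{id}_X,\quad(\mathrm{id}_{X\otimes Y}\otimes m_C)(\mathrm{id}_X\otimes\tau_{C,Y}\otimes\mathrm{id}_C)(\delta_X\otimes\delta_Y)=\delta_{X\otimes Y},\quad u_C=\delta_{\mathbb 1}.$$ Moreover the morphism $$\Lambda=\sum_{j\in I}\dim(V_j)\,(\mathrm{id}_{{}^\vee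 V_j}\otimes\phi_{V_j}^{-1})\,\mathrm{coev}_{{}^\vee V_j}:\ \mathbb 1\to C,$$ whose $j$-th term takes values in ${}^\vee V_j\otimes V_j\cong{}^\vee V_0\otimes{}^\vee V_j\otimes{}^{\vee\vee}V_0\otimes V_j$, the summand of index $(0,j)$ (the isomorphism being induced by $\mathbb 1\cong V_0$), is a morphism of $\mathcal Z(\mathcal C)$ and an $S_C$-invariant two-sided integral of $C$: $$S_C\Lambda=\Lambda,\qquad m_C(\Lambda\otimes\mathrm{id}_C)=\Lambda\,\varepsilon_C=m_C(\mathrm{id}_C\otimes\Lambda).$$ -/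

import Mathlib

open CategoryTheory MonoidalCategory Limits

universe w v u

namespace SphericalFusion

noncomputable section
variable {C : Type u} [Category.{v} C] [MonoidalCategory C]

theorem halfBraiding_unit {M : C} (b : HalfBraiding M) :
    (b.β (𝟙_ C)).hom = (ρ_ M).hom ≫ (λ_ M).inv := by
  have n := b.naturality (λ_ (𝟙_ C)).hom
  rw [b.monoidal] at n
  have e1 : (𝟙_ C) ◁ (b.β (𝟙_ C)).hom = (λ_ _).hom ≫ (b.β (𝟙_ C)).hom ≫ (λ_ _).inv := by simp
  have e2 : (b.β (𝟙_ C)).hom ▷ 𝟙_ C = (ρ_ _).hom ≫ (b.β (𝟙_ C)).hom ≫ (ρ_ _).inv := by simp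
  rw [e1, e2] at n
  have n' : M ◁ (λ_ (𝟙_ C)).hom ≫ (b.β (𝟙_ C)).hom =
      ((α_ _ _ _).inv ≫ (ρ_ _).hom ≫ (b.β (𝟙_ C)).hom ≫ (λ_ M).hom ≫ (ρ_ M).inv)
        ≫ (b.β (𝟙_ C)).hom := by
    rw [n]; monoidal
  have n'' := (cancel_mono (b.β (𝟙_ C)).hom).1 n'
  calc (b.β (𝟙_ C)).hom = (ρ_ _).inv ≫ (α_ _ _ _).hom ≫
      ((α_ _ _ _).inv ≫ (ρ_ _).hom ≫ (b.β (𝟙_ C)).hom ≫ (λ_ M).hom ≫ (ρ_ M).inv)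
        ≫ (ρ_ _).hom ≫ (λ_ _).inv := by simp
    _ = _ := by rw [← n'']; monoidal

theorem halfBraiding_inv_eq {M : C} (b : HalfBraiding M) (W Y : C) [ExactPairing W Y] :
    (b.β Y).inv = 𝟙 _ ⊗≫ (Y ⊗ M) ◁ η_ W Y ⊗≫ Y ◁ (b.β W).hom ▷ Y ⊗≫
      ε_ W Y ▷ (M ⊗ Y) ⊗≫ 𝟙 _ := by
  rw [← cancel_epi (b.β Y).hom, Iso.hom_inv_id]
  symm
  have n := b.naturality (ε_ W Y)
  rw [halfBraiding_unit, b.monoidal] at n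
  calc
    _ = 𝟙 _ ⊗≫ ((b.β Y).hom ▷ 𝟙_ C ≫ (Y ⊗ M) ◁ η_ W Y) ⊗≫ Y ◁ (b.β W).hom ▷ Y ⊗≫
      ε_ W Y ▷ (M ⊗ Y) ⊗≫ 𝟙 _ := by monoidal
    _ = 𝟙 _ ⊗≫ M ◁ Y ◁ η_ W Y ⊗≫ (((α_ _ _ _).inv ≫ (b.β Y).hom ▷ W ≫ (α_ _ _ _).hom ≫
          Y ◁ (b.β W).hom ≫ (α_ _ _ _).inv) ≫ ε_ W Y ▷ M) ▷ Y ⊗≫ 𝟙 _ := by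
      rw [← whisker_exchange]; monoidal
    _ = 𝟙 _ ⊗≫ M ◁ (Y ◁ η_ W Y ⊗≫ ε_ W Y ▷ Y) ⊗≫ 𝟙 _ := by
      rw [← n]; monoidal
    _ = _ := by
      rw [ExactPairing.coevaluation_evaluation'']; monoidal


/-- The half-braiding on a dual of an object with half-braiding `b`: the composite
`M' ⊗ Y ⟶ M' ⊗ Y ⊗ M ⊗ M' ⟶ M' ⊗ M ⊗ Y ⊗ M' ⟶ Y ⊗ M'`, whose middle map is the inverse of `b`. -/
def dualHalfBraidingHom {M : C} (b : HalfBraiding M) (M' : C) [ExactPairing M M'] (Y : C) :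
    M' ⊗ Y ⟶ Y ⊗ M' :=
  𝟙 _ ⊗≫ (M' ⊗ Y) ◁ η_ M M' ⊗≫ M' ◁ (b.β Y).inv ▷ M' ⊗≫ ε_ M M' ▷ (Y ⊗ M') ⊗≫ 𝟙 _

theorem coev_dualHalfBraidingHom {M : C} (b : HalfBraiding M) (M' : C) [ExactPairing M M']
    (Y : C) : 𝟙 _ ⊗≫ η_ M M' ▷ Y ⊗≫ M ◁ dualHalfBraidingHom b M' Y ⊗≫ 𝟙 _ =
      𝟙 (𝟙_ C ⊗ Y) ⊗≫ Y ◁ η_ M M' ⊗≫ (b.β Y).inv ▷ M' ⊗≫ 𝟙 (M ⊗ Y ⊗ M') := by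
  dsimp only [dualHalfBraidingHom]
  calc
    _ = 𝟙 _ ⊗≫ (η_ M M' ▷ (Y ⊗ 𝟙_ C) ≫ (M ⊗ M') ◁ (Y ◁ η_ M M' ⊗≫ (b.β Y).inv ▷ M')) ⊗≫
        M ◁ ε_ M M' ▷ (Y ⊗ M') ⊗≫ 𝟙 _ := by monoidal
    _ = 𝟙 _ ⊗≫ Y ◁ η_ M M' ⊗≫ (b.β Y).inv ▷ M' ⊗≫
        (η_ M M' ▷ M ⊗≫ M ◁ ε_ M M') ▷ (Y ⊗ M') ⊗≫ 𝟙 _ := by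
      rw [← whisker_exchange]; monoidal
    _ = _ := by rw [ExactPairing.evaluation_coevaluation'']; monoidal

theorem dualHalfBraidingHom_ev {M : C} (b : HalfBraiding M) (M' : C) [ExactPairing M M']
    (Y : C) : 𝟙 _ ⊗≫ dualHalfBraidingHom b M' Y ▷ M ⊗≫ Y ◁ ε_ M M' ⊗≫ 𝟙 _ =
      𝟙 (M' ⊗ Y ⊗ M) ⊗≫ M' ◁ (b.β Y).inv ⊗≫ ε_ M M' ▷ Y ⊗≫ 𝟙 (Y ⊗ 𝟙_ C) := by
  dsimp only [dualHalfBraidingHom]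
  calc
    _ = 𝟙 _ ⊗≫ (M' ⊗ Y) ◁ η_ M M' ▷ M ⊗≫ ((M' ◁ (b.β Y).inv ⊗≫ ε_ M M' ▷ Y) ▷ (M' ⊗ M) ≫
        (𝟙_ C ⊗ Y) ◁ ε_ M M') ⊗≫ 𝟙 _ := by monoidal
    _ = 𝟙 _ ⊗≫ (M' ⊗ Y) ◁ (η_ M M' ▷ M ⊗≫ M ◁ ε_ M M') ⊗≫
        M' ◁ (b.β Y).inv ⊗≫ ε_ M M' ▷ Y ⊗≫ 𝟙 _ := by
      rw [← whisker_exchange]; monoidal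
    _ = _ := by rw [ExactPairing.evaluation_coevaluation'']; monoidal

theorem coev_central {M : C} (b : HalfBraiding M) (M' : C) [ExactPairing M M'] (U : C) :
    η_ M M' ▷ U ≫ (α_ _ _ _).hom ≫ M ◁ dualHalfBraidingHom b M' U ≫ (α_ _ _ _).inv ≫
      (b.β U).hom ▷ M' ≫ (α_ _ _ _).hom = ((λ_ U).hom ≫ (ρ_ U).inv) ≫ U ◁ η_ M M' := by
  calc
    _ = (𝟙 (𝟙_ C ⊗ U) ⊗≫ η_ M M' ▷ U ⊗≫ M ◁ dualHalfBraidingHom b M' U ⊗≫ 𝟙 (M ⊗ U ⊗ M')) ⊗≫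
        (b.β U).hom ▷ M' ⊗≫ 𝟙 _ := by monoidal
    _ = 𝟙 _ ⊗≫ U ◁ η_ M M' ⊗≫ ((b.β U).inv ≫ (b.β U).hom) ▷ M' ⊗≫ 𝟙 _ := by
        rw [coev_dualHalfBraidingHom]; monoidal
    _ = _ := by rw [Iso.inv_hom_id]; monoidal

theorem ev_central {M : C} (b : HalfBraiding M) (M' : C) [ExactPairing M M'] (U : C) :
    ε_ M M' ▷ U ≫ (λ_ U).hom ≫ (ρ_ U).inv = ((α_ _ _ _).hom ≫ M' ◁ (b.β U).hom ≫
      (α_ _ _ _).inv ≫ dualHalfBraidingHom b M' U ▷ M ≫ (α_ _ _ _).hom) ≫ U ◁ ε_ M M' := by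
  symm
  calc
    _ = 𝟙 _ ⊗≫ M' ◁ (b.β U).hom ⊗≫ (𝟙 (M' ⊗ U ⊗ M) ⊗≫ dualHalfBraidingHom b M' U ▷ M ⊗≫
        U ◁ ε_ M M' ⊗≫ 𝟙 (U ⊗ 𝟙_ C)) := by monoidal
    _ = 𝟙 _ ⊗≫ M' ◁ ((b.β U).hom ≫ (b.β U).inv) ⊗≫ ε_ M M' ▷ U ⊗≫ 𝟙 _ := by
        rw [dualHalfBraidingHom_ev]; monoidal
    _ = _ := by rw [Iso.hom_inv_id]; monoidal

/-- The transpose of the half-braiding at a dual `W` of `Y`. -/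
def mateIso {M : C} (b : HalfBraiding M) (M' : C) [ExactPairing M M'] (W Y : C) [ExactPairing W Y] :
    M' ⊗ Y ≅ Y ⊗ M' where
  hom := @rightAdjointMate C _ _ (M ⊗ W) (W ⊗ M) ⟨Y ⊗ M'⟩ ⟨M' ⊗ Y⟩ (b.β W).hom
  inv := @rightAdjointMate C _ _ (W ⊗ M) (M ⊗ W) ⟨M' ⊗ Y⟩ ⟨Y ⊗ M'⟩ (b.β W).inv
  hom_inv_id := by
    rw [← @comp_rightAdjointMate, Iso.inv_hom_id, @rightAdjointMate_id]; rfl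
  inv_hom_id := by
    rw [← @comp_rightAdjointMate, Iso.hom_inv_id, @rightAdjointMate_id]; rfl

theorem mateIso_hom {M : C} (b : HalfBraiding M) (M' : C) [ExactPairing M M'] (W Y : C)
    [ExactPairing W Y] : (mateIso b M' W Y).hom = dualHalfBraidingHom b M' Y := by
  rw [dualHalfBraidingHom, halfBraiding_inv_eq b W Y]
  dsimp only [mateIso, rightAdjointMate]
  rw [@ExactPairing.tensor_coevaluation, @ExactPairing.tensor_evaluation]
  calc
    _ = 𝟙 _ ⊗≫ (M' ⊗ Y) ◁ η_ M M' ⊗≫ (M' ⊗ Y ⊗ M) ◁ η_ W Y ▷ M' ⊗≫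
        M' ◁ Y ◁ (b.β W).hom ▷ (Y ⊗ M') ⊗≫ M' ◁ ε_ W Y ▷ (M ⊗ Y ⊗ M') ⊗≫
        ε_ M M' ▷ (Y ⊗ M') ⊗≫ 𝟙 _ := by monoidal
    _ = _ := by monoidal

/-- The dual half-braiding. -/
def dualHalfBraiding {M : C} (b : HalfBraiding M) (M' : C) [ExactPairing M M']
    [LeftRigidCategory C] : HalfBraiding M' where
  β Y :=
    { hom := dualHalfBraidingHom b M' Y
      inv := (mateIso b M' (ᘁY : C) Y).inv
      hom_inv_id := by rw [← mateIso_hom b M' (ᘁY : C) Y, Iso.hom_inv_id]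
      inv_hom_id := by rw [← mateIso_hom b M' (ᘁY : C) Y, Iso.inv_hom_id] }
  naturality {U U'} f := by
    have n : (b.β U).inv ≫ M ◁ f = f ▷ M ≫ (b.β U').inv := by
      rw [Iso.inv_comp_eq, ← Category.assoc, Iso.eq_comp_inv, b.naturality]
    dsimp only [dualHalfBraidingHom]
    calc
      _ = 𝟙 _ ⊗≫ M' ◁ (f ▷ 𝟙_ C ≫ U' ◁ η_ M M') ⊗≫ M' ◁ (b.β U').inv ▷ M' ⊗≫
        ε_ M M' ▷ (U' ⊗ M') ⊗≫ 𝟙 _ := by monoidal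
      _ = 𝟙 _ ⊗≫ (M' ⊗ U) ◁ η_ M M' ⊗≫ M' ◁ (f ▷ M ≫ (b.β U').inv) ▷ M' ⊗≫
        ε_ M M' ▷ (U' ⊗ M') ⊗≫ 𝟙 _ := by rw [← whisker_exchange]; monoidal
      _ = 𝟙 _ ⊗≫ (M' ⊗ U) ◁ η_ M M' ⊗≫ M' ◁ (b.β U).inv ▷ M' ⊗≫
        ((M' ⊗ M) ◁ f ≫ ε_ M M' ▷ U') ▷ M' ⊗≫ 𝟙 _ := by rw [← n]; monoidal
      _ = _ := by rw [whisker_exchange]; monoidal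
  monoidal U U' := by
    have h : (b.β (U ⊗ U')).inv = (α_ _ _ _).hom ≫ U ◁ (b.β U').inv ≫ (α_ _ _ _).inv ≫
        (b.β U).inv ▷ U' ≫ (α_ _ _ _).hom := by
      rw [← cancel_epi (b.β (U ⊗ U')).hom, Iso.hom_inv_id, b.monoidal]
      simp
    dsimp only [dualHalfBraidingHom]
    rw [h]
    symm
    calc
      _ = 𝟙 _ ⊗≫ (M' ⊗ U) ◁ η_ M M' ▷ U' ⊗≫
          ((M' ◁ (b.β U).inv ⊗≫ ε_ M M' ▷ U ⊗≫ 𝟙 U) ▷ (M' ⊗ U') ≫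
            U ◁ dualHalfBraidingHom b M' U') ⊗≫ 𝟙 _ := by
        dsimp only [dualHalfBraidingHom]; monoidal
      _ = 𝟙 _ ⊗≫ (M' ⊗ U) ◁ (𝟙 (𝟙_ C ⊗ U') ⊗≫ η_ M M' ▷ U' ⊗≫ M ◁ dualHalfBraidingHom b M' U' ⊗≫
            𝟙 (M ⊗ U' ⊗ M')) ⊗≫
          (M' ◁ (b.β U).inv ⊗≫ ε_ M M' ▷ U ⊗≫ 𝟙 U) ▷ (U' ⊗ M') ⊗≫ 𝟙 _ := by
        rw [← whisker_exchange]; monoidal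
      _ = _ := by
        rw [coev_dualHalfBraidingHom]; monoidal


section
variable [RigidCategory C]

/-- The dual of `M` in the center, lying over the dual of the underlying object. -/
def centerDual (M : Center C) : Center C := ⟨(M.1)ᘁ, dualHalfBraiding M.2 (M.1)ᘁ⟩

/-- The duality in the center; its evaluation and coevaluation are those of `C`. -/
@[reducible]
def centerExactPairing (M : Center C) : ExactPairing M (centerDual M) where
  coevaluation' :=
    { f := η_ M.1 (M.1)ᘁ
      comm := fun U => by
        rw [Center.tensor_β, Center.tensorUnit_β]
        simp only [Iso.trans_hom, whiskerLeftIso_hom, whiskerRightIso_hom, Iso.symm_hom]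
        exact coev_central M.2 (M.1)ᘁ U }
  evaluation' :=
    { f := ε_ M.1 (M.1)ᘁ
      comm := fun U => by
        rw [Center.tensor_β, Center.tensorUnit_β]
        simp only [Iso.trans_hom, whiskerLeftIso_hom, whiskerRightIso_hom, Iso.symm_hom]
        exact ev_central M.2 (M.1)ᘁ U }
  coevaluation_evaluation' := by
    apply Center.ext
    simp only [Center.comp_f, Center.whiskerLeft_f, Center.whiskerRight_f,
      Center.associator_inv_f, Center.rightUnitor_hom_f, Center.leftUnitor_inv_f]
    exact ExactPairing.coevaluation_evaluation M.1 (M.1)ᘁ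
  evaluation_coevaluation' := by
    apply Center.ext
    simp only [Center.comp_f, Center.whiskerLeft_f, Center.whiskerRight_f,
      Center.associator_hom_f, Center.leftUnitor_hom_f, Center.rightUnitor_inv_f]
    exact ExactPairing.evaluation_coevaluation M.1 (M.1)ᘁ

instance centerRightRigid : RightRigidCategory (Center C) where
  rightDual M := { rightDual := centerDual M, exact := centerExactPairing M }
end

/-! ### Sovereign structures, traces, dimensions

The dual used throughout is Mathlib's right dual `Xᘁ`, with evaluation
`ε_ X Xᘁ : Xᘁ ⊗ X ⟶ 𝟙_ C` and coevaluation `η_ X Xᘁ : 𝟙_ C ⟶ X ⊗ Xᘁ`. -/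

/-- The dual of `X`, always the one provided by the rigid structure (also for `X = 𝟙_ C`). -/
abbrev rdual {C : Type u} [Category.{v} C] [MonoidalCategory C] [RightRigidCategory C]
    (X : C) : C := HasRightDual.rightDual X

section Sovereign

variable (C) [RightRigidCategory C]

/-- The canonical morphism `(X ⊗ Y)ᘁᘁ ⟶ Xᘁᘁ ⊗ Yᘁᘁ`. -/
def doubleDualTensor {C : Type u} [Category.{v} C] [MonoidalCategory C] [RightRigidCategory C]
    (X Y : C) : rdual (rdual (X ⊗ Y)) ⟶ rdual (rdual X) ⊗ rdual (rdual Y) :=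
  rightAdjointMate (rightDualTensorIso X Y).inv ≫ (rightDualTensorIso (rdual Y) (rdual X)).hom

/-- The canonical isomorphism from the dual of the unit object to the unit object. -/
def unitDualIso : rdual (𝟙_ C) ≅ 𝟙_ C :=
  rightDualIso (X := 𝟙_ C) (RightRigidCategory.rightDual (𝟙_ C)).exact exactPairingUnit

/-- The canonical morphism from the double dual of the unit object to the unit object. -/
def doubleDualUnit : rdual (rdual (𝟙_ C)) ⟶ 𝟙_ C :=
  @rightAdjointMate C _ _ (𝟙_ C) (rdual (𝟙_ C)) (RightRigidCategory.rightDual _)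
    (RightRigidCategory.rightDual _) (unitDualIso C).inv ≫ (unitDualIso C).hom

/-- A sovereign structure: a monoidal natural isomorphism from the identity functor to the
double dual functor. -/
structure SovereignStructure where
  φ : ∀ X : C, X ≅ rdual (rdual X)
  naturality : ∀ {X Y : C} (f : X ⟶ Y), f ≫ (φ Y).hom = (φ X).hom ≫ rightAdjointMate (rightAdjointMate f)
  tensor : ∀ X Y : C, (φ (X ⊗ Y)).hom ≫ doubleDualTensor X Y = (φ X).hom ⊗ₘ (φ Y).hom
  unit : (φ (𝟙_ C)).hom ≫ doubleDualUnit C = 𝟙 (𝟙_ C)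

namespace SovereignStructure

variable {C} (S : SovereignStructure C)

/-- The left trace of an endomorphism. -/
def leftTrace {X : C} (f : X ⟶ X) : 𝟙_ C ⟶ 𝟙_ C :=
  η_ (rdual X) (rdual (rdual X)) ≫ rdual X ◁ ((S.φ X).inv ≫ f) ≫ ε_ X (rdual X)

/-- The right trace of an endomorphism. -/
def rightTrace {X : C} (f : X ⟶ X) : 𝟙_ C ⟶ 𝟙_ C :=
  η_ X (rdual X) ≫ (f ≫ (S.φ X).hom) ▷ rdual X ≫ ε_ (rdual X) (rdual (rdual X))

/-- Left and right traces of endomorphisms coincide. -/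
def IsSpherical : Prop :=
  ∀ {X : C} (f : X ⟶ X), S.leftTrace f = S.rightTrace f

/-- The (left) dimension of an object, as an endomorphism of the unit object. -/
def dim (X : C) : 𝟙_ C ⟶ 𝟙_ C := S.leftTrace (𝟙 X)

/-- The coevaluation `𝟙_ C ⟶ Xᘁ ⊗ Xᘁᘁ ⟶ Xᘁ ⊗ X`. -/
def coev (X : C) : 𝟙_ C ⟶ rdual X ⊗ X :=
  η_ (rdual X) (rdual (rdual X)) ≫ rdual X ◁ (S.φ X).inv

end SovereignStructure

end Sovereign

/-! ### Fusion categories -/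

section Fusion

/-- A decomposition of `X` as a finite direct sum of members `V (s 0), …, V (s (n - 1))` of the
family `V`, with projections `p` and injections `q`. -/
structure Decomposition {C : Type u} [Category.{v} C] [Preadditive C] {I : Type w} (V : I → C)
    (X : C) where
  n : ℕ
  s : Fin n → I
  p : ∀ a, X ⟶ V (s a)
  q : ∀ a, V (s a) ⟶ X
  q_p_self : ∀ a, q a ≫ p a = 𝟙 (V (s a))
  q_p_of_ne : ∀ a b, a ≠ b → q a ≫ p b = 0
  sum_p_q : ∑ a, p a ≫ q a = 𝟙 X

/-- The structure of a fusion category over `k` with representative family of scalar objects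
indexed by `I`, on a `k`-linear rigid monoidal category: `Hom (V i) (V j)` is `0` for `i ≠ j` and
is freely generated by the identity for `i = j`, every object is a finite direct sum of objects
of the family, and the unit object is isomorphic to `V zero`. -/
structure FusionStructure (k : Type*) [CommRing k] (C : Type u) [Category.{v} C] [Preadditive C]
    [Linear k C] [MonoidalCategory C] (I : Type w) where
  V : I → C
  hom_eq_zero : ∀ i j, i ≠ j → ∀ f : V i ⟶ V j, f = 0
  end_bijective : ∀ i, Function.Bijective (fun c : k => c • 𝟙 (V i))
  exists_decomposition : ∀ X : C, Nonempty (Decomposition V X)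
  zero : I
  unitIso : 𝟙_ C ≅ V zero

/-- The action `Yᘁ ⊗ M ⊗ Y ⟶ M` of the centralizer on an object of the center: its `Y`-component,
given by the half-braiding `M ⊗ Y ⟶ Y ⊗ M` followed by evaluation. -/
def centerAction {C : Type u} [Category.{v} C] [MonoidalCategory C] [RightRigidCategory C]
    (M : Center C) (Y : C) : rdual Y ⊗ M.1 ⊗ Y ⟶ M.1 :=
  rdual Y ◁ (M.2.β Y).hom ≫ (α_ _ _ _).inv ≫ ε_ Y (rdual Y) ▷ M.1 ≫ (λ_ M.1).hom

/-- The canonical isomorphism `(X ⊗ Y ⊗ Z)ᘁ ≅ Zᘁ ⊗ Yᘁ ⊗ Xᘁ`. -/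
def dualTripleIso {C : Type u} [Category.{v} C] [MonoidalCategory C] [RightRigidCategory C]
    (X Y Z : C) : rdual (X ⊗ Y ⊗ Z) ≅ rdual Z ⊗ rdual Y ⊗ rdual X :=
  rightDualTensorIso X (Y ⊗ Z) ≪≫ whiskerRightIso (rightDualTensorIso Y Z) (rdual X) ≪≫ α_ _ _ _

namespace FusionStructure

variable {k : Type*} [CommRing k] {C : Type u} [Category.{v} C] [Preadditive C] [Linear k C]
  [MonoidalCategory C] [HasFiniteBiproducts C] [RightRigidCategory C] {I : Type w} [Fintype I]
  (D : FusionStructure k C I)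

/-- The summand `V_iᘁ ⊗ V_jᘁ ⊗ V_iᘁᘁ ⊗ V_j` of the coend of the center. -/
abbrev summand (ij : I × I) : C :=
  rdual (D.V ij.1) ⊗ rdual (D.V ij.2) ⊗ rdual (rdual (D.V ij.1)) ⊗ D.V ij.2

/-- The underlying object `⨁ V_iᘁ ⊗ V_jᘁ ⊗ V_iᘁᘁ ⊗ V_j` of the coend of the center. -/
def coendObj : C := ⨁ D.summand

/-- The dinatural transformation `Mᘁ ⊗ M ⟶ ⨁ V_iᘁ ⊗ V_jᘁ ⊗ V_iᘁᘁ ⊗ V_j` at an object `M` of the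
center, computed with projections `p a` and injections `q a` of a decomposition of `M`: on the
factor `Mᘁ` it is the dual of the composite of `V_iᘁ ⊗ q a ⊗ V_i` with the action
`V_iᘁ ⊗ M ⊗ V_i ⟶ M`, and on the factor `M` it is `p a`. -/
def coendι (M : Center C) (d : Decomposition D.V M.1) : rdual M.1 ⊗ M.1 ⟶ D.coendObj :=
  ∑ i : I, ∑ a : Fin d.n,
    ((rightAdjointMate ((rdual (D.V i) ◁ d.q a ▷ D.V i) ≫ centerAction M (D.V i)) ≫
        (dualTripleIso (rdual (D.V i)) (D.V (d.s a)) (D.V i)).hom) ⊗ₘ d.p a) ≫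
      (α_ _ _ _).hom ≫ rdual (D.V i) ◁ (α_ _ _ _).hom ≫ biproduct.ι D.summand (i, d.s a)

/-- The morphism `Λ = ∑ j, dim (V j) • Λ_j`, where `Λ_j` is the coevaluation
`𝟙_ C ⟶ V_jᘁ ⊗ V_j` viewed in the summand `V_0ᘁ ⊗ V_jᘁ ⊗ V_0ᘁᘁ ⊗ V_j` through `𝟙_ C ≅ V_0`. -/
def integral (S : SovereignStructure C) : 𝟙_ C ⟶ D.coendObj :=
  ∑ j : I, S.dim (D.V j) ≫ S.coev (D.V j) ≫ (λ_ _).inv ≫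
    (𝟙_ C) ◁ rdual (D.V j) ◁ (λ_ (D.V j)).inv ≫
    (rightAdjointMate (Y := 𝟙_ C) D.unitIso.inv ⊗ₘ
      (rdual (D.V j) ◁ (rightAdjointMate (Y := 𝟙_ C)
        (rightAdjointMate (X := 𝟙_ C) D.unitIso.hom) ▷ D.V j))) ≫
    biproduct.ι D.summand (D.zero, j)

/-- The object of the center with underlying object `D.coendObj` and half-braiding `β`. -/
abbrev coendCenter (β : HalfBraiding D.coendObj) : Center C := ⟨D.coendObj, β⟩

end FusionStructure

end Fusion

/-! ### Coends of braided rigid categories as Hopf algebras -/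

section Coend

variable (B : Type u) [Category.{v} B] [MonoidalCategory B] [RightRigidCategory B]

/-- The functor `(X, Y) ↦ Xᘁ ⊗ Y`, contravariant in `X`, whose coend is the coend of `B`. -/
def dualTensor : Bᵒᵖ ⥤ B ⥤ B where
  obj X := tensorLeft (rdual X.unop)
  map f := (curriedTensor B).map (rightAdjointMate f.unop)
  map_id X := by
    rw [unop_id, rightAdjointMate_id]; exact (curriedTensor B).map_id _
  map_comp f g := by
    rw [unop_comp, comp_rightAdjointMate]; exact (curriedTensor B).map_comp _ _

variable {B} {A : B}

/-- The coaction `X ⟶ X ⊗ Xᘁ ⊗ X ⟶ X ⊗ A` associated with a family `i X : Xᘁ ⊗ X ⟶ A`. -/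
def coaction (i : ∀ X : B, rdual X ⊗ X ⟶ A) (X : B) : X ⟶ X ⊗ A :=
  (λ_ X).inv ≫ η_ X (rdual X) ▷ X ≫ (α_ _ _ _).hom ≫ X ◁ i X

/-- A Hopf algebra structure on the coend `A` of a braided category is the canonical one if its
comultiplication and counit turn the coactions into comodule structures, and its multiplication
and unit make these comodule structures compatible with tensor products and the unit object. When
`i` is universal, these equations determine the Hopf algebra structure. -/
structure IsCoendHopf [BraidedCategory B] (i : ∀ X : B, rdual X ⊗ X ⟶ A) (H : HopfObj A) : Prop where
  comul : ∀ X : B, coaction i X ≫ X ◁ H.comul =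
    coaction i X ≫ coaction i X ▷ A ≫ (α_ _ _ _).hom
  counit : ∀ X : B, coaction i X ≫ X ◁ H.counit = (ρ_ X).inv
  mul : ∀ X Y : B, (coaction i X ⊗ₘ coaction i Y) ≫ tensorμ X A Y A ≫ (X ⊗ Y) ◁ H.mul =
    coaction i (X ⊗ Y)
  one : H.one = coaction i (𝟙_ B) ≫ (λ_ A).hom

/-- A two-sided integral of a Hopf algebra that is invariant under the antipode. -/
structure IsInvariantIntegral [BraidedCategory B] (H : HopfObj A) (Λ : 𝟙_ B ⟶ A) : Prop where
  left : Λ ▷ A ≫ H.mul = (λ_ A).hom ≫ H.counit ≫ Λ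
  right : A ◁ Λ ≫ H.mul = (ρ_ A).hom ≫ H.counit ≫ Λ
  antipode : Λ ≫ H.antipode = Λ

end Coend

end

end SphericalFusion

/-! By duality, a dinatural family `Xᘁ ⊗ X ⟶ Z` is the same thing as a natural family of coactions
`X ⟶ X ⊗ Z`. The coend is therefore the object representing natural coactions, and the argument is
carried out with coactions throughout.

Existence. Since Hom(V_i, V_j) = δ_ij k, a natural transformation between k-linear functors on C can
be prescribed freely on the V_i (`natTrans`, `nat_ext`). Hence F V = ⊕ V_iᘁ ⊗ V ⊗ V_i represents
natural families V ⊗ Y ⟶ Y ⊗ X, acquires a half-braiding from this property, and is the free object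
of the center on V (`isUniversal_freeNat`, `freeLift_central`, `free_hom_ext`). A natural coaction
on the center then amounts to a natural family V ⟶ F V ⊗ X on C, that is, to arbitrary morphisms (F
V_j)ᘁ ⊗ V_j ⟶ X, that is, to a morphism out of A = ⊕ (F V_j)ᘁ ⊗ V_j (`coact_existsUnique`).
Conjugating coactions by half-braidings gives the half-braiding of A, and universality lifts from C
to the center (`isUniversal_coactCNat`).

Hopf structure. Each structure morphism comes from the universal property, and identities between
morphisms out of tensor powers of A are tested on products of coactions (`Separating.tensor`,
`exists_tensor`). The antipode is the coaction of the dual object.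

Integral. V sits in F V as the summand of index zero. Compressing the coaction of F V to V gives a
family `unitCoact : V ⟶ V ⊗ A` natural in C, and Λ is the sum over j of dim(V_j) times the trace of
`unitCoact` on V_j (`traceIntegral_eq_integral`). For any natural T : V ⟶ V ⊗ A, an exchange of dual
bases gives the slide formula: the sum over j of dim(V_j) times the partial trace over V_j of T at
V_j ⊗ N is N ⊗ Λ_T, where Λ_T is the weighted sum of the traces of T (`sum_slideForm_rdual`). If N
carries a half-braiding, `unitCoact` at V ⊗ N and at N ⊗ V is the product of `unitCoact V` with the
coaction of N. Reading the slide formula in the two orders gives aΛ = ε(a)Λ (`traceIntegral_right`),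
and a left-hand analogue in which Λ still has to cross N (`traceIntegral_coact`).

The antipode sends the trace on V to the trace on Vᘁ closed on the other side. On scalar objects the
two closures agree (`crossTrace_eq_coactTrace`), and duality permutes the V_j preserving dimensions,
so SΛ = Λ. Applying S to the right integral property then gives Λ·S(a) = ε(a)Λ, and with it the
crossing can be cancelled by a Hopf algebra computation (`traceIntegral_braid`). This shows that Λ
is central and a left integral. Dimensions are never inverted, so k may be any commutative ring. -/

namespace SphericalFusion
noncomputable section

set_option linter.unusedSectionVars false

/-! ### Natural families on a fusion category -/

namespace FusionStructure

section Linear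

variable {k : Type*} [CommRing k] {C : Type u} [Category.{v} C] [Preadditive C] [Linear k C]
  [MonoidalCategory C] {I : Type w} (D : FusionStructure k C I)

include D in
theorem exists_smul_id {i : I} (f : D.V i ⟶ D.V i) : ∃ c : k, f = c • 𝟙 (D.V i) := by
  obtain ⟨c, hc⟩ := (D.end_bijective i).2 f
  exact ⟨c, hc.symm⟩

/-- A chosen decomposition of an object. -/
def dec (X : C) : Decomposition D.V X := (D.exists_decomposition X).some

variable {E : Type*} [Category E] [Preadditive E] [Linear k E] {K U : C ⥤ E}

/-- A morphism `V i ⟶ V j` is zero or a scalar multiple of an identity, and linear functors respect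
both. So naturality imposes no condition on the components at the `V i`. -/
theorem family_naturality [K.Additive] [U.Additive] [K.Linear k] [U.Linear k]
    (t : ∀ i, K.obj (D.V i) ⟶ U.obj (D.V i)) {i j : I} (f : D.V i ⟶ D.V j) :
    K.map f ≫ t j = t i ≫ U.map f := by
  by_cases h : i = j
  · subst h
    obtain ⟨c, rfl⟩ := D.exists_smul_id f
    simp
  · rw [D.hom_eq_zero i j h f]; simp

/-- Inserting `∑ p ≫ q = 𝟙` at both ends of `f` reduces the claim to the matrix entries `q a ≫ f ≫ p
b`. For `f = 𝟙` and two decompositions of one object it also gives independence of the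
decomposition. -/
theorem sum_family_naturality [K.Additive] [U.Additive] [K.Linear k] [U.Linear k]
    (t : ∀ i, K.obj (D.V i) ⟶ U.obj (D.V i)) {X Y : C} (d : Decomposition D.V X)
    (d' : Decomposition D.V Y) (f : X ⟶ Y) :
    K.map f ≫ (∑ b, K.map (d'.p b) ≫ t (d'.s b) ≫ U.map (d'.q b)) =
      (∑ a, K.map (d.p a) ≫ t (d.s a) ≫ U.map (d.q a)) ≫ U.map f := by
  have h1 : K.map f = ∑ a, K.map (d.p a) ≫ K.map (d.q a ≫ f) := by
    conv_lhs => rw [← Category.id_comp f, ← d.sum_p_q, Preadditive.sum_comp, Functor.map_sum]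
    simp
  have h2 : U.map f = ∑ b, U.map (f ≫ d'.p b) ≫ U.map (d'.q b) := by
    conv_lhs => rw [← Category.comp_id f, ← d'.sum_p_q, Preadditive.comp_sum, Functor.map_sum]
    simp
  have h3 : ∀ a b, K.map (d.q a) ≫ K.map f ≫ K.map (d'.p b) ≫ t (d'.s b) =
      t (d.s a) ≫ U.map (d.q a) ≫ U.map f ≫ U.map (d'.p b) := by
    intro a b
    have := D.family_naturality t (d.q a ≫ f ≫ d'.p b)
    simpa using this
  rw [h1, h2]
  simp only [Preadditive.sum_comp, Preadditive.comp_sum, Category.assoc, Functor.map_comp]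
  refine Finset.sum_congr rfl fun b _ => Finset.sum_congr rfl fun a _ => ?_
  rw [reassoc_of% (h3 a b)]

/-- The natural transformation with prescribed components at the objects `D.V i`. -/
def natTrans [K.Additive] [U.Additive] [K.Linear k] [U.Linear k]
    (t : ∀ i, K.obj (D.V i) ⟶ U.obj (D.V i)) : K ⟶ U where
  app X := ∑ a, K.map ((D.dec X).p a) ≫ t _ ≫ U.map ((D.dec X).q a)
  naturality _ _ f := D.sum_family_naturality t _ _ f

theorem natTrans_app [K.Additive] [U.Additive] [K.Linear k] [U.Linear k]
    (t : ∀ i, K.obj (D.V i) ⟶ U.obj (D.V i)) {X : C} (d : Decomposition D.V X) :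
    (D.natTrans t).app X = ∑ a, K.map (d.p a) ≫ t _ ≫ U.map (d.q a) := by
  have := D.sum_family_naturality t d (D.dec X) (𝟙 X)
  simpa [natTrans] using this

@[simp]
theorem natTrans_app_V [K.Additive] [U.Additive] [K.Linear k] [U.Linear k]
    (t : ∀ i, K.obj (D.V i) ⟶ U.obj (D.V i)) (i : I) : (D.natTrans t).app (D.V i) = t i := by
  let d : Decomposition D.V (D.V i) :=
    { n := 1
      s := fun _ => i
      p := fun _ => 𝟙 _
      q := fun _ => 𝟙 _
      q_p_self := by simp
      q_p_of_ne := fun a b h => (h (Subsingleton.elim a b)).elim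
      sum_p_q := by simp }
  rw [D.natTrans_app t d]
  simp [d]

omit [Linear k E] in
theorem nat_eq_sum [U.Additive] (s : K ⟶ U) {X : C} (d : Decomposition D.V X) :
    s.app X = ∑ a, K.map (d.p a) ≫ s.app _ ≫ U.map (d.q a) := by
  calc s.app X = s.app X ≫ U.map (∑ a, d.p a ≫ d.q a) := by rw [d.sum_p_q]; simp
    _ = _ := by simp [Functor.map_sum, Preadditive.comp_sum]

omit [Linear k E] in
theorem nat_ext [U.Additive] {s t : K ⟶ U} (h : ∀ i, s.app (D.V i) = t.app (D.V i)) : s = t := by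
  ext X
  rw [D.nat_eq_sum s (D.dec X), D.nat_eq_sum t (D.dec X)]
  simp only [h]

end Linear

/-! ### The summands of an object isomorphic to the unit -/

section Zero

variable {k : Type*} [CommRing k] {C : Type u} [Category.{v} C] [Preadditive C] [Linear k C]
  [MonoidalCategory C] {I : Type w} (D : FusionStructure k C I)

open Classical in
/-- The projection `V_i ⟶ 𝟙_ C`, which vanishes unless `i` is the index of the unit. -/
def toUnit (i : I) : D.V i ⟶ 𝟙_ C :=
  if h : i = D.zero then eqToHom (by rw [h]) ≫ D.unitIso.inv else 0

open Classical in
/-- The injection `𝟙_ C ⟶ V_i`, which vanishes unless `i` is the index of the unit. -/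
def ofUnit (i : I) : 𝟙_ C ⟶ D.V i :=
  if h : i = D.zero then D.unitIso.hom ≫ eqToHom (by rw [h]) else 0

@[simp]
theorem toUnit_zero : D.toUnit D.zero = D.unitIso.inv := by simp [toUnit]

@[simp]
theorem ofUnit_zero : D.ofUnit D.zero = D.unitIso.hom := by simp [ofUnit]

theorem toUnit_of_ne {i : I} (h : i ≠ D.zero) : D.toUnit i = 0 := by simp [toUnit, h]

include D in
theorem hom_unit_eq_zero {i : I} (h : i ≠ D.zero) (f : D.V i ⟶ 𝟙_ C) : f = 0 := by
  have := D.hom_eq_zero _ _ h (f ≫ D.unitIso.hom)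
  rw [← cancel_mono D.unitIso.hom, this, zero_comp]

include D in
theorem unit_hom_eq_zero {i : I} (h : i ≠ D.zero) (f : 𝟙_ C ⟶ D.V i) : f = 0 := by
  have := D.hom_eq_zero _ _ h.symm (D.unitIso.inv ≫ f)
  rw [← cancel_epi D.unitIso.inv, this, comp_zero]

theorem comp_toUnit_ofUnit {i : I} (f : 𝟙_ C ⟶ D.V i) : f ≫ D.toUnit i ≫ D.ofUnit i = f := by
  by_cases h : i = D.zero
  · subst h; simp
  · rw [D.unit_hom_eq_zero h f, zero_comp]

/-- The projections of `X` to its summands isomorphic to the unit. -/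
def unitP (X : C) (a : Fin (D.dec X).n) : X ⟶ 𝟙_ C := (D.dec X).p a ≫ D.toUnit _

/-- The injections into `X` of its summands isomorphic to the unit. -/
def unitQ (X : C) (a : Fin (D.dec X).n) : 𝟙_ C ⟶ X := D.ofUnit _ ≫ (D.dec X).q a

/-- Hom(𝟙, V_i) vanishes for i ≠ 0, so morphisms out of the unit only see the summands isomorphic to
the unit. -/
theorem sum_unitP_unitQ {X : C} (f : 𝟙_ C ⟶ X) : ∑ a, f ≫ D.unitP X a ≫ D.unitQ X a = f := by
  have h : ∀ a, f ≫ D.unitP X a ≫ D.unitQ X a = f ≫ (D.dec X).p a ≫ (D.dec X).q a := by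
    intro a
    have := D.comp_toUnit_ofUnit (f ≫ (D.dec X).p a)
    simp only [Category.assoc] at this
    simp [unitP, unitQ, reassoc_of% this]
  rw [Finset.sum_congr rfl fun a _ => h a, ← Preadditive.comp_sum, (D.dec X).sum_p_q,
    Category.comp_id]

variable [MonoidalPreadditive C] [MonoidalLinear k C]

/-- The natural family `V ⊗ Y ⟶ Y ⊗ V` supported on the summands of `Y` isomorphic to the unit. -/
def unitSwap (V : C) : tensorLeft V ⟶ 𝟭 C ⋙ tensorRight V :=
  D.natTrans (K := tensorLeft V) (U := 𝟭 C ⋙ tensorRight V)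
    fun i => V ◁ D.toUnit i ≫ (ρ_ V).hom ≫ (λ_ V).inv ≫ D.ofUnit i ▷ V

theorem unitSwap_app (V Y : C) : (D.unitSwap V).app Y =
    ∑ a, V ◁ D.unitP Y a ≫ (ρ_ V).hom ≫ (λ_ V).inv ≫ D.unitQ Y a ▷ V := by
  rw [unitSwap, D.natTrans_app _ (D.dec Y)]
  simp [unitP, unitQ]

theorem unitSwap_of_ne (V : C) {i : I} (h : i ≠ D.zero) : (D.unitSwap V).app (D.V i) = 0 := by
  simp [unitSwap, D.toUnit_of_ne h]

theorem unitSwap_unit (V : C) : (D.unitSwap V).app (𝟙_ C) = (ρ_ V).hom ≫ (λ_ V).inv := by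
  have h := (D.unitSwap V).naturality D.unitIso.hom
  have h2 : (D.unitSwap V).app (D.V D.zero) =
      V ◁ D.unitIso.inv ≫ (ρ_ V).hom ≫ (λ_ V).inv ≫ D.unitIso.hom ▷ V := by
    simp [unitSwap]
  rw [h2] at h
  dsimp at h
  rw [← cancel_mono (D.unitIso.hom ▷ V)]
  dsimp
  rw [← h]; simp

theorem unitSwap_eq_zero (V Y : C) (h : ∀ f : Y ⟶ 𝟙_ C, f = 0) : (D.unitSwap V).app Y = 0 := by
  rw [unitSwap_app]
  exact Finset.sum_eq_zero fun a _ => by rw [h (D.unitP Y a)]; simp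

-- At `V zero` the comparison is transported from the unit object by naturality along `unitIso`.
omit [MonoidalLinear k C] in
include D in
theorem nat_ext_unit {V X : C} {s t : tensorLeft V ⟶ 𝟭 C ⋙ tensorRight X}
    (h1 : s.app (𝟙_ C) = t.app (𝟙_ C)) (hs : ∀ i, i ≠ D.zero → s.app (D.V i) = 0)
    (ht : ∀ i, i ≠ D.zero → t.app (D.V i) = 0) : s = t := by
  refine D.nat_ext fun i => ?_
  by_cases h : i = D.zero
  · subst h
    have hs := s.naturality D.unitIso.inv
    have ht := t.naturality D.unitIso.inv
    rw [h1, ht] at hs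
    have : Mono ((𝟭 C ⋙ tensorRight X).map D.unitIso.inv) := inferInstance
    exact (cancel_mono _).1 hs.symm
  · rw [hs i h, ht i h]

end Zero

end FusionStructure


/-! ### Representing objects for natural families, and half-braidings from lax ones -/

section Universal

variable {C : Type u} [Category.{v} C] [MonoidalCategory C] {J : Type*} [Category J] {K U : J ⥤ C}
  {A : C}

/-- The natural family `δ` represents the natural families `K m ⟶ U m ⊗ X`. -/
structure IsUniversal (δ : K ⟶ U ⋙ tensorRight A) : Prop where
  existsUnique : ∀ {X : C} (t : K ⟶ U ⋙ tensorRight X),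
    ∃! h : A ⟶ X, ∀ m, δ.app m ≫ U.obj m ◁ h = t.app m

namespace IsUniversal

variable [RightRigidCategory C] {δ : K ⟶ U ⋙ tensorRight A} (hδ : IsUniversal δ)

omit [RightRigidCategory C] in
theorem app_naturality (δ : K ⟶ U ⋙ tensorRight A) {m n : J} (f : m ⟶ n) :
    K.map f ≫ δ.app n = (show K.obj m ⟶ U.obj m ⊗ A from δ.app m) ≫ U.map f ▷ A :=
  δ.naturality f

-- The parameter `P` is moved to the target through its dual: the transposed family `K m ⟶ U m ⊗ X ⊗
-- Pᘁ` is natural, so the universal property applies to it, and the resulting morphism is transposed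
-- back.
include hδ in
theorem exists_param {P X : C} (t : ∀ m, K.obj m ⊗ P ⟶ U.obj m ⊗ X)
    (ht : ∀ {m n : J} (f : m ⟶ n), K.map f ▷ P ≫ t n = t m ≫ U.map f ▷ X) :
    ∃ h : A ⊗ P ⟶ X, ∀ m, (show K.obj m ⟶ U.obj m ⊗ A from δ.app m) ▷ P ≫ (α_ _ _ _).hom ≫
      U.obj m ◁ h = t m := by
  obtain ⟨h, hh, -⟩ := hδ.existsUnique (X := X ⊗ rdual P)
    { app := fun m => (ρ_ _).inv ≫ K.obj m ◁ η_ P (rdual P) ≫ (α_ _ _ _).inv ≫ t m ▷ rdual P ≫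
        (α_ _ _ _).hom
      naturality := fun m n f => by
        dsimp
        have := ht f
        calc _ = 𝟙 _ ⊗≫ (K.map f ▷ (𝟙_ C) ≫ K.obj n ◁ η_ P (rdual P)) ⊗≫ t n ▷ rdual P ⊗≫ 𝟙 _ := by
              monoidal
          _ = 𝟙 _ ⊗≫ K.obj m ◁ η_ P (rdual P) ⊗≫ (K.map f ▷ P ≫ t n) ▷ rdual P ⊗≫ 𝟙 _ := by
              rw [← whisker_exchange]; monoidal
          _ = _ := by rw [this]; monoidal }
  refine ⟨h ▷ P ≫ (α_ _ _ _).hom ≫ X ◁ ε_ P (rdual P) ≫ (ρ_ _).hom, fun m => ?_⟩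
  have hm := hh m
  dsimp at hm
  calc
    _ = 𝟙 _ ⊗≫ ((show K.obj m ⟶ U.obj m ⊗ A from δ.app m) ≫ U.obj m ◁ h) ▷ P ⊗≫
      (U.obj m ⊗ X) ◁ ε_ P (rdual P) ⊗≫ 𝟙 _ := by monoidal
    _ = 𝟙 _ ⊗≫ K.obj m ◁ η_ P (rdual P) ▷ P ⊗≫ (t m ▷ (rdual P ⊗ P) ≫
      (U.obj m ⊗ X) ◁ ε_ P (rdual P)) ⊗≫ 𝟙 _ := by rw [hm]; monoidal
    _ = 𝟙 _ ⊗≫ K.obj m ◁ (η_ P (rdual P) ▷ P ⊗≫ P ◁ ε_ P (rdual P)) ⊗≫ t m ⊗≫ 𝟙 _ := by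
      rw [← whisker_exchange]; monoidal
    _ = _ := by rw [ExactPairing.evaluation_coevaluation'']; monoidal

include hδ in
theorem hom_ext_param {P X : C} {h h' : A ⊗ P ⟶ X}
    (H : ∀ m, (show K.obj m ⟶ U.obj m ⊗ A from δ.app m) ▷ P ≫ (α_ _ _ _).hom ≫ U.obj m ◁ h =
      (show K.obj m ⟶ U.obj m ⊗ A from δ.app m) ▷ P ≫ (α_ _ _ _).hom ≫ U.obj m ◁ h') : h = h' := by
  apply (tensorRightHomEquiv A P (rdual P) X).injective
  let t (h : A ⊗ P ⟶ X) : K ⟶ U ⋙ tensorRight (X ⊗ rdual P) :=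
    { app := fun m => δ.app m ≫ U.obj m ◁ tensorRightHomEquiv A P (rdual P) X h
      naturality := fun m n f => by
        have := app_naturality δ f
        dsimp
        rw [reassoc_of% this, ← whisker_exchange]
        simp }
  have key : ∀ (h : A ⊗ P ⟶ X) m, δ.app m ≫ U.obj m ◁ tensorRightHomEquiv A P (rdual P) X h =
      𝟙 _ ⊗≫ K.obj m ◁ η_ P (rdual P) ⊗≫ ((show K.obj m ⟶ U.obj m ⊗ A from δ.app m) ▷ P ≫
        (α_ _ _ _).hom ≫ U.obj m ◁ h) ▷ rdual P ⊗≫ 𝟙 _ := by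
    intro h m
    dsimp [tensorRightHomEquiv]
    calc
      _ = 𝟙 _ ⊗≫ ((show K.obj m ⟶ U.obj m ⊗ A from δ.app m) ▷ (𝟙_ C) ≫
        (U.obj m ⊗ A) ◁ η_ P (rdual P)) ⊗≫ U.obj m ◁ h ▷ rdual P ⊗≫ 𝟙 _ := by monoidal
      _ = _ := by rw [← whisker_exchange]; monoidal
  obtain ⟨g, -, hg⟩ := hδ.existsUnique (t h)
  rw [hg _ (fun m => rfl), hg (tensorRightHomEquiv A P (rdual P) X h') (fun m => ?_)]
  dsimp only [t]
  rw [key, key, H]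

omit [RightRigidCategory C] in
include hδ in
theorem hom_ext {X : C} {h h' : A ⟶ X}
    (H : ∀ m, (show K.obj m ⟶ U.obj m ⊗ A from δ.app m) ≫ U.obj m ◁ h =
      (show K.obj m ⟶ U.obj m ⊗ A from δ.app m) ≫ U.obj m ◁ h') : h = h' := by
  let t : K ⟶ U ⋙ tensorRight X :=
    { app := fun m => δ.app m ≫ U.obj m ◁ h
      naturality := fun m n f => by
        have := app_naturality δ f
        dsimp
        rw [reassoc_of% this, ← whisker_exchange]
        simp }
  obtain ⟨g, -, hg⟩ := hδ.existsUnique t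
  rw [hg _ (fun m => rfl), hg h' (fun m => (H m).symm)]

end IsUniversal

end Universal

section Lax

variable {C : Type u} [Category.{v} C] [MonoidalCategory C] [LeftRigidCategory C]

/-- In a category with left duals, a half-braiding which is not assumed to be invertible is
a half-braiding. -/
def halfBraidingOfLax {M : C} (θ : ∀ Y, M ⊗ Y ⟶ Y ⊗ M)
    (nat : ∀ {Y Y' : C} (f : Y ⟶ Y'), M ◁ f ≫ θ Y' = θ Y ≫ f ▷ M)
    (unit : θ (𝟙_ C) = (ρ_ M).hom ≫ (λ_ M).inv)
    (mon : ∀ Y Y', θ (Y ⊗ Y') = (α_ _ _ _).inv ≫ θ Y ▷ Y' ≫ (α_ _ _ _).hom ≫ Y ◁ θ Y' ≫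
      (α_ _ _ _).inv) : HalfBraiding M where
  β Y :=
    { hom := θ Y
      -- The inverse is the transpose of the component at the left dual of `Y`. Both composites
      -- reduce to a zigzag by naturality of `θ` along the evaluation, respectively the
      -- coevaluation.
      inv := 𝟙 _ ⊗≫ (Y ⊗ M) ◁ η_ (ᘁY : C) Y ⊗≫ Y ◁ (θ (ᘁY : C)) ▷ Y ⊗≫
        ε_ (ᘁY : C) Y ▷ (M ⊗ Y) ⊗≫ 𝟙 _
      hom_inv_id := by
        have n := nat (ε_ (ᘁY : C) Y)
        rw [unit, mon] at n
        calc
          _ = 𝟙 _ ⊗≫ ((θ Y) ▷ 𝟙_ C ≫ (Y ⊗ M) ◁ η_ (ᘁY : C) Y) ⊗≫ Y ◁ (θ (ᘁY : C)) ▷ Y ⊗≫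
            ε_ (ᘁY : C) Y ▷ (M ⊗ Y) ⊗≫ 𝟙 _ := by monoidal
          _ = 𝟙 _ ⊗≫ M ◁ Y ◁ η_ (ᘁY : C) Y ⊗≫ (((α_ _ _ _).inv ≫ (θ Y) ▷ (ᘁY : C) ≫
                (α_ _ _ _).hom ≫ Y ◁ (θ (ᘁY : C)) ≫ (α_ _ _ _).inv) ≫
                  ε_ (ᘁY : C) Y ▷ M) ▷ Y ⊗≫ 𝟙 _ := by
            rw [← whisker_exchange]; monoidal
          _ = 𝟙 _ ⊗≫ M ◁ (Y ◁ η_ (ᘁY : C) Y ⊗≫ ε_ (ᘁY : C) Y ▷ Y) ⊗≫ 𝟙 _ := by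
            rw [← n]; monoidal
          _ = _ := by
            rw [ExactPairing.coevaluation_evaluation'']; monoidal
      inv_hom_id := by
        have n := nat (η_ (ᘁY : C) Y)
        rw [unit, mon] at n
        calc
          _ = 𝟙 _ ⊗≫ (Y ⊗ M) ◁ η_ (ᘁY : C) Y ⊗≫ Y ◁ (θ (ᘁY : C)) ▷ Y ⊗≫
            (ε_ (ᘁY : C) Y ▷ (M ⊗ Y) ≫ 𝟙_ C ◁ θ Y) ⊗≫ 𝟙 _ := by monoidal
          _ = 𝟙 _ ⊗≫ Y ◁ (M ◁ η_ (ᘁY : C) Y ≫ ((α_ _ _ _).inv ≫ (θ (ᘁY : C)) ▷ Y ≫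
                (α_ _ _ _).hom ≫ (ᘁY : C) ◁ (θ Y) ≫ (α_ _ _ _).inv)) ⊗≫
                  ε_ (ᘁY : C) Y ▷ Y ▷ M ⊗≫ 𝟙 _ := by
            rw [← whisker_exchange]; monoidal
          _ = 𝟙 _ ⊗≫ (Y ◁ η_ (ᘁY : C) Y ⊗≫ ε_ (ᘁY : C) Y ▷ Y) ▷ M ⊗≫ 𝟙 _ := by
            rw [n]; monoidal
          _ = _ := by
            rw [ExactPairing.coevaluation_evaluation'']; monoidal }
  monoidal := mon
  naturality := nat

@[simp]
theorem halfBraidingOfLax_hom {M : C} (θ : ∀ Y, M ⊗ Y ⟶ Y ⊗ M) (nat) (unit) (mon) (Y : C) :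
    ((halfBraidingOfLax θ nat unit mon).β Y).hom = θ Y := rfl

end Lax


/-! ### Central morphisms -/

section Central

variable {C : Type u} [Category.{v} C] [MonoidalCategory C]

/-- A morphism compatible with half-braidings. -/
def IsCentral {M N : C} (b : HalfBraiding M) (b' : HalfBraiding N) (f : M ⟶ N) : Prop :=
  ∀ U, f ▷ U ≫ (b'.β U).hom = (b.β U).hom ≫ U ◁ f

namespace IsCentral

theorem id {M : C} (b : HalfBraiding M) : IsCentral b b (𝟙 M) := fun U => by simp

theorem comp {M N P : C} {b : HalfBraiding M} {b' : HalfBraiding N} {b'' : HalfBraiding P}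
    {f : M ⟶ N} {g : N ⟶ P} (hf : IsCentral b b' f) (hg : IsCentral b' b'' g) :
    IsCentral b b'' (f ≫ g) := fun U => by
  rw [comp_whiskerRight, Category.assoc, hg U, ← Category.assoc, hf U]; simp

end IsCentral

/-- The tensor product of half-braidings. -/
def tensorHalfBraiding {M N : C} (b : HalfBraiding M) (b' : HalfBraiding N) :
    HalfBraiding (M ⊗ N) :=
  (tensorObj (C := Center C) ⟨M, b⟩ ⟨N, b'⟩).2

theorem tensorHalfBraiding_hom {M N : C} (b : HalfBraiding M) (b' : HalfBraiding N) (U : C) :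
    ((tensorHalfBraiding b b').β U).hom = 𝟙 _ ⊗≫ M ◁ (b'.β U).hom ⊗≫ (b.β U).hom ▷ N ⊗≫ 𝟙 _ := by
  have : ((tensorHalfBraiding b b').β U).hom = (α_ _ _ _).hom ≫ M ◁ (b'.β U).hom ≫
    (α_ _ _ _).inv ≫ (b.β U).hom ▷ N ≫ (α_ _ _ _).hom := rfl
  rw [this]; monoidal

end Central

/-! ### The free objects of the center -/

namespace FusionStructure

variable {k : Type*} [CommRing k] {C : Type u} [Category.{v} C] [Preadditive C] [Linear k C]
  [MonoidalCategory C] [MonoidalPreadditive C] [MonoidalLinear k C] [HasFiniteBiproducts C]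
  [RigidCategory C] {I : Type w} [Fintype I] (D : FusionStructure k C I)

/-- The underlying object `⨁ V_iᘁ ⊗ V ⊗ V_i` of the free object of the center on `V`. -/
def freeObj (V : C) : C := ⨁ fun i => rdual (D.V i) ⊗ V ⊗ D.V i

/-- The inclusion of a summand of the free object. -/
def freeι (V : C) (i : I) : rdual (D.V i) ⊗ V ⊗ D.V i ⟶ D.freeObj V :=
  biproduct.ι (fun i => rdual (D.V i) ⊗ V ⊗ D.V i) i

/-- The morphism from the free object with prescribed components. -/
def freeDesc {V X : C} (t : ∀ i, rdual (D.V i) ⊗ V ⊗ D.V i ⟶ X) : D.freeObj V ⟶ X :=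
  biproduct.desc t

omit [MonoidalPreadditive C] [MonoidalLinear k C] in
@[simp]
theorem freeι_desc {V X : C} (t : ∀ i, rdual (D.V i) ⊗ V ⊗ D.V i ⟶ X) (i : I) :
    D.freeι V i ≫ D.freeDesc t = t i :=
  biproduct.ι_desc _ _

omit [MonoidalPreadditive C] [MonoidalLinear k C] in
theorem freeObj_hom_ext {V X : C} {f g : D.freeObj V ⟶ X}
    (h : ∀ i, D.freeι V i ≫ f = D.freeι V i ≫ g) : f = g :=
  biproduct.hom_ext' _ _ h

/-- The universal family `V ⊗ Y ⟶ Y ⊗ F V`. -/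
def freeNat (V : C) : tensorLeft V ⟶ 𝟭 C ⋙ tensorRight (D.freeObj V) :=
  D.natTrans (K := tensorLeft V) (U := 𝟭 C ⋙ tensorRight (D.freeObj V))
    fun i => tensorLeftHomEquiv (V ⊗ D.V i) (D.V i) (rdual (D.V i)) _ (D.freeι V i)

/-- The components of the universal family `V ⊗ Y ⟶ Y ⊗ F V`. -/
def freeMap (V Y : C) : V ⊗ Y ⟶ Y ⊗ D.freeObj V := (D.freeNat V).app Y

theorem freeMap_naturality (V : C) {Y Y' : C} (f : Y ⟶ Y') :
    V ◁ f ≫ D.freeMap V Y' = D.freeMap V Y ≫ f ▷ D.freeObj V :=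
  (D.freeNat V).naturality f

theorem freeMap_V (V : C) (i : I) : D.freeMap V (D.V i) =
    tensorLeftHomEquiv (V ⊗ D.V i) (D.V i) (rdual (D.V i)) _ (D.freeι V i) := by
  simp [freeMap, freeNat]

theorem freeMap_V_comp (V : C) (i : I) {X : C} (h : D.freeObj V ⟶ X) :
    D.freeMap V (D.V i) ≫ D.V i ◁ h =
    tensorLeftHomEquiv (V ⊗ D.V i) (D.V i) (rdual (D.V i)) _ (D.freeι V i ≫ h) := by
  rw [freeMap_V]; simp [tensorLeftHomEquiv]

/-- A natural family is freely given by its components at the `V i`. Transposed, these are morphisms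
`V_iᘁ ⊗ V ⊗ V_i ⟶ X`, that is, one morphism out of the biproduct. -/
theorem isUniversal_freeNat (V : C) : IsUniversal (D.freeNat V) where
  existsUnique {X} t := by
    refine ⟨D.freeDesc fun i =>
      (tensorLeftHomEquiv (V ⊗ D.V i) (D.V i) (rdual (D.V i)) X).symm (t.app (D.V i)),
      fun Y => ?_, fun h hh => ?_⟩
    · let s : tensorLeft V ⟶ 𝟭 C ⋙ tensorRight X :=
        { app := fun Y => D.freeMap V Y ≫ Y ◁ (D.freeDesc fun i =>
            (tensorLeftHomEquiv (V ⊗ D.V i) (D.V i) (rdual (D.V i)) X).symm (t.app (D.V i)))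
          naturality := fun Y Y' f => by
            dsimp
            rw [reassoc_of% (D.freeMap_naturality V f), ← whisker_exchange]
            simp }
      have : s = t := D.nat_ext fun i => by
        dsimp only [s]
        rw [freeMap_V_comp]
        simp
      exact congr_app this Y
    · refine D.freeObj_hom_ext fun i => ?_
      rw [freeι_desc]
      apply (tensorLeftHomEquiv (V ⊗ D.V i) (D.V i) (rdual (D.V i)) X).injective
      rw [Equiv.apply_symm_apply, ← hh (D.V i)]
      exact (D.freeMap_V_comp V i h).symm

theorem freeMap_exists {V X : C} (t : ∀ Y, V ⊗ Y ⟶ Y ⊗ X)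
    (ht : ∀ {Y Y' : C} (f : Y ⟶ Y'), V ◁ f ≫ t Y' = t Y ≫ f ▷ X) :
    ∃ h : D.freeObj V ⟶ X, ∀ Y, D.freeMap V Y ≫ Y ◁ h = t Y :=
  ((D.isUniversal_freeNat V).existsUnique
    { app := t, naturality := fun _ _ f => ht f }).exists

theorem freeMap_exists_param {V P X : C} (t : ∀ Y, (V ⊗ Y) ⊗ P ⟶ Y ⊗ X)
    (ht : ∀ {Y Y' : C} (f : Y ⟶ Y'), (V ◁ f) ▷ P ≫ t Y' = t Y ≫ f ▷ X) :
    ∃ h : D.freeObj V ⊗ P ⟶ X, ∀ Y, D.freeMap V Y ▷ P ≫ (α_ _ _ _).hom ≫ Y ◁ h = t Y :=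
  (D.isUniversal_freeNat V).exists_param t ht

theorem freeMap_hom_ext {V X : C} {h h' : D.freeObj V ⟶ X}
    (H : ∀ Y, D.freeMap V Y ≫ Y ◁ h = D.freeMap V Y ≫ Y ◁ h') : h = h' :=
  (D.isUniversal_freeNat V).hom_ext H

theorem freeMap_hom_ext_param {V P X : C} {h h' : D.freeObj V ⊗ P ⟶ X}
    (H : ∀ Y, D.freeMap V Y ▷ P ≫ (α_ _ _ _).hom ≫ Y ◁ h =
      D.freeMap V Y ▷ P ≫ (α_ _ _ _).hom ≫ Y ◁ h') : h = h' :=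
  (D.isUniversal_freeNat V).hom_ext_param H

/-- The half-braiding is forced by the wish that `freeMap` be multiplicative: crossing `Y` and then
`P` must be crossing `Y ⊗ P`. -/
theorem exists_freeBraid (V P : C) : ∃ h : D.freeObj V ⊗ P ⟶ P ⊗ D.freeObj V,
    ∀ Y, D.freeMap V Y ▷ P ≫ (α_ _ _ _).hom ≫ Y ◁ h =
      (α_ _ _ _).hom ≫ D.freeMap V (Y ⊗ P) ≫ (α_ _ _ _).hom := by
  refine D.freeMap_exists_param (fun Y => (α_ _ _ _).hom ≫ D.freeMap V (Y ⊗ P) ≫ (α_ _ _ _).hom) ?_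
  intro Y Y' f
  have := D.freeMap_naturality V (f ▷ P)
  calc _ = (α_ _ _ _).hom ≫ (V ◁ (f ▷ P) ≫ D.freeMap V (Y' ⊗ P)) ≫ (α_ _ _ _).hom := by simp
    _ = _ := by rw [this]; simp

/-- The half-braiding of the free object, as a morphism. -/
def freeBraid (V P : C) : D.freeObj V ⊗ P ⟶ P ⊗ D.freeObj V := (D.exists_freeBraid V P).choose

theorem freeMap_freeBraid (V P Y : C) :
    D.freeMap V Y ▷ P ≫ (α_ _ _ _).hom ≫ Y ◁ D.freeBraid V P =
      (α_ _ _ _).hom ≫ D.freeMap V (Y ⊗ P) ≫ (α_ _ _ _).hom := (D.exists_freeBraid V P).choose_spec Y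

/-- The half-braiding of the free object on `V`. -/
def freeHalfBraiding (V : C) : HalfBraiding (D.freeObj V) :=
  halfBraidingOfLax (D.freeBraid V)
    -- Each axiom is tested on `freeMap`, where it becomes naturality of `freeMap` in its index,
    -- along `Y ◁ f`, the right unitor and the associator respectively.
    (fun {P P'} f => by
      refine D.freeMap_hom_ext_param fun Y => ?_
      have := D.freeMap_naturality V (Y ◁ f)
      calc
        _ = 𝟙 _ ⊗≫ (D.freeMap V Y ▷ P ≫ (Y ⊗ D.freeObj V) ◁ f) ⊗≫ Y ◁ D.freeBraid V P' ⊗≫ 𝟙 _ := by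
          monoidal
        _ = 𝟙 _ ⊗≫ (V ⊗ Y) ◁ f ⊗≫ (D.freeMap V Y ▷ P' ≫ (α_ _ _ _).hom ≫ Y ◁ D.freeBraid V P') ⊗≫
            𝟙 _ := by
          rw [← whisker_exchange]; monoidal
        _ = 𝟙 _ ⊗≫ (V ◁ (Y ◁ f) ≫ D.freeMap V (Y ⊗ P')) ⊗≫ 𝟙 _ := by
          rw [freeMap_freeBraid]; monoidal
        _ = 𝟙 _ ⊗≫ ((α_ _ _ _).hom ≫ D.freeMap V (Y ⊗ P) ≫ (α_ _ _ _).hom) ⊗≫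
            Y ◁ f ▷ D.freeObj V ⊗≫ 𝟙 _ := by
          rw [this]; monoidal
        _ = _ := by rw [← freeMap_freeBraid]; monoidal)
    (by
      refine D.freeMap_hom_ext_param fun Y => ?_
      rw [freeMap_freeBraid]
      have := D.freeMap_naturality V (ρ_ Y).inv
      calc
        _ = (ρ_ _).hom ≫ (V ◁ (ρ_ Y).inv ≫ D.freeMap V (Y ⊗ 𝟙_ C)) ≫ (α_ _ _ _).hom := by simp
        _ = _ := by rw [this]; monoidal)
    (fun P P' => by
      refine D.freeMap_hom_ext_param fun Y => ?_
      rw [freeMap_freeBraid]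
      have := D.freeMap_naturality V (α_ Y P P').hom
      symm
      calc
        _ = 𝟙 _ ⊗≫ (D.freeMap V Y ▷ P ≫ (α_ _ _ _).hom ≫ Y ◁ D.freeBraid V P) ▷ P' ⊗≫
            (Y ⊗ P) ◁ D.freeBraid V P' ⊗≫ 𝟙 _ := by monoidal
        _ = 𝟙 _ ⊗≫ (D.freeMap V (Y ⊗ P) ▷ P' ≫ (α_ _ _ _).hom ≫ (Y ⊗ P) ◁ D.freeBraid V P') ⊗≫
            𝟙 _ := by rw [freeMap_freeBraid]; monoidal
        _ = 𝟙 _ ⊗≫ (D.freeMap V ((Y ⊗ P) ⊗ P') ≫ (α_ Y P P').hom ▷ D.freeObj V) ⊗≫ 𝟙 _ := by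
            rw [freeMap_freeBraid]; monoidal
        _ = _ := by rw [← this]; monoidal)

/-- The unit `V ⟶ F V`. -/
def freeUnit (V : C) : V ⟶ D.freeObj V := (ρ_ V).inv ≫ D.freeMap V (𝟙_ C) ≫ (λ_ _).hom

/-- The defining relation of the half-braiding at the index `𝟙_ C`, simplified along the unitor. It
shows that the universal family is determined by `freeUnit`, which makes `freeObj` free in the
center. -/
theorem freeMap_eq (V Y : C) :
    D.freeMap V Y = D.freeUnit V ▷ Y ≫ ((D.freeHalfBraiding V).β Y).hom := by
  have h := D.freeMap_freeBraid V Y (𝟙_ C)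
  have n := D.freeMap_naturality V (λ_ Y).inv
  change _ = D.freeUnit V ▷ Y ≫ D.freeBraid V Y
  dsimp only [freeUnit]
  symm
  calc
    _ = 𝟙 _ ⊗≫ (D.freeMap V (𝟙_ C) ▷ Y ≫ (α_ _ _ _).hom ≫ 𝟙_ C ◁ D.freeBraid V Y) ⊗≫ 𝟙 _ := by
      monoidal
    _ = 𝟙 _ ⊗≫ (V ◁ (λ_ Y).inv ≫ D.freeMap V (𝟙_ C ⊗ Y)) ⊗≫ 𝟙 _ := by rw [h]; monoidal
    _ = _ := by rw [n]; monoidal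

theorem exists_freeLift {V M : C} (b : HalfBraiding M) (q : V ⟶ M) :
    ∃ h : D.freeObj V ⟶ M, ∀ Y, D.freeMap V Y ≫ Y ◁ h = q ▷ Y ≫ (b.β Y).hom := by
  refine D.freeMap_exists (fun Y => q ▷ Y ≫ (b.β Y).hom) ?_
  intro Y Y' f
  rw [whisker_exchange_assoc, HalfBraiding.naturality]; simp

/-- The central morphism `F V ⟶ M` extending `q : V ⟶ M`. -/
def freeLift {V M : C} (b : HalfBraiding M) (q : V ⟶ M) : D.freeObj V ⟶ M :=
  (D.exists_freeLift b q).choose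

theorem freeMap_freeLift {V M : C} (b : HalfBraiding M) (q : V ⟶ M) (Y : C) :
    D.freeMap V Y ≫ Y ◁ D.freeLift b q = q ▷ Y ≫ (b.β Y).hom :=
  (D.exists_freeLift b q).choose_spec Y

/-- Tested on `freeMap`, both sides become `q` followed by the half-braiding of `M` at `Y ⊗ P`. -/
theorem freeLift_central {V M : C} (b : HalfBraiding M) (q : V ⟶ M) :
    IsCentral (D.freeHalfBraiding V) b (D.freeLift b q) := fun P => by
  have hs := D.freeMap_freeLift b q
  set h := D.freeLift b q
  refine D.freeMap_hom_ext_param fun Y => ?_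
  change _ = D.freeMap V Y ▷ P ≫ (α_ _ _ _).hom ≫ Y ◁ (D.freeBraid V P ≫ P ◁ h)
  calc
    _ = 𝟙 _ ⊗≫ (D.freeMap V Y ≫ Y ◁ h) ▷ P ⊗≫ Y ◁ (b.β P).hom ⊗≫ 𝟙 _ := by monoidal
    _ = 𝟙 _ ⊗≫ (q ▷ (Y ⊗ P) ≫ ((α_ _ _ _).inv ≫ (b.β Y).hom ▷ P ≫ (α_ _ _ _).hom ≫
        Y ◁ (b.β P).hom ≫ (α_ _ _ _).inv)) ⊗≫ 𝟙 _ := by rw [hs]; monoidal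
    _ = 𝟙 _ ⊗≫ (D.freeMap V (Y ⊗ P) ≫ (Y ⊗ P) ◁ h) ⊗≫ 𝟙 _ := by
        rw [← HalfBraiding.monoidal, hs]
    _ = 𝟙 _ ⊗≫ (D.freeMap V Y ▷ P ≫ (α_ _ _ _).hom ≫ Y ◁ D.freeBraid V P) ⊗≫
        Y ◁ P ◁ h ⊗≫ 𝟙 _ := by rw [freeMap_freeBraid]; monoidal
    _ = _ := by monoidal

@[simp]
theorem freeUnit_freeLift {V M : C} (b : HalfBraiding M) (q : V ⟶ M) :
    D.freeUnit V ≫ D.freeLift b q = q := by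
  have h := D.freeMap_freeLift b q (𝟙_ C)
  rw [halfBraiding_unit] at h
  have h2 : D.freeUnit V ≫ D.freeLift b q =
      (ρ_ V).inv ≫ (D.freeMap V (𝟙_ C) ≫ 𝟙_ C ◁ D.freeLift b q) ≫ (λ_ _).hom := by
    dsimp only [freeUnit]; monoidal
  rw [h2, h]; simp

theorem freeMap_central {V M : C} {b : HalfBraiding M} {h : D.freeObj V ⟶ M}
    (hh : IsCentral (D.freeHalfBraiding V) b h) (Y : C) :
    D.freeMap V Y ≫ Y ◁ h = (D.freeUnit V ≫ h) ▷ Y ≫ (b.β Y).hom := by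
  rw [freeMap_eq, Category.assoc, ← hh Y]; simp

theorem free_hom_ext {V M : C} {b : HalfBraiding M} {f g : D.freeObj V ⟶ M}
    (hf : IsCentral (D.freeHalfBraiding V) b f) (hg : IsCentral (D.freeHalfBraiding V) b g)
    (h : D.freeUnit V ≫ f = D.freeUnit V ≫ g) : f = g :=
  D.freeMap_hom_ext fun Y => by rw [D.freeMap_central hf, D.freeMap_central hg, h]

/-- The action of `F` on morphisms. -/
def freeMor {V W : C} (f : V ⟶ W) : D.freeObj V ⟶ D.freeObj W :=
  D.freeLift (D.freeHalfBraiding W) (f ≫ D.freeUnit W)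

theorem freeMor_central {V W : C} (f : V ⟶ W) :
    IsCentral (D.freeHalfBraiding V) (D.freeHalfBraiding W) (D.freeMor f) :=
  D.freeLift_central _ _

@[simp]
theorem freeUnit_freeMor {V W : C} (f : V ⟶ W) :
    D.freeUnit V ≫ D.freeMor f = f ≫ D.freeUnit W := D.freeUnit_freeLift _ _

theorem freeMor_freeLift {V W M : C} (b : HalfBraiding M) (f : V ⟶ W) (q : W ⟶ M) :
    D.freeMor f ≫ D.freeLift b q = D.freeLift b (f ≫ q) :=
  D.free_hom_ext ((D.freeMor_central f).comp (D.freeLift_central b q)) (D.freeLift_central b _)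
    (by rw [← Category.assoc]; simp)

theorem freeLift_comp {V M N : C} {b : HalfBraiding M} {b' : HalfBraiding N} (q : V ⟶ M)
    {f : M ⟶ N} (hf : IsCentral b b' f) : D.freeLift b q ≫ f = D.freeLift b' (q ≫ f) :=
  D.free_hom_ext ((D.freeLift_central b q).comp hf) (D.freeLift_central b' _)
    (by rw [← Category.assoc]; simp)

theorem freeMap_freeMor {V W : C} (f : V ⟶ W) (Y : C) :
    D.freeMap V Y ≫ Y ◁ D.freeMor f = f ▷ Y ≫ D.freeMap W Y := by
  rw [freeMor, freeMap_freeLift, freeMap_eq]; simp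

/-- The free functor, followed by the forgetful functor. -/
def freeFunctor : C ⥤ C where
  obj := D.freeObj
  map f := D.freeMor f
  map_id V := D.free_hom_ext (D.freeMor_central _) (IsCentral.id _) (by simp)
  map_comp f g := D.free_hom_ext (D.freeMor_central _)
    ((D.freeMor_central _).comp (D.freeMor_central _)) (by
      rw [freeUnit_freeMor, ← Category.assoc, freeUnit_freeMor, Category.assoc, Category.assoc,
        freeUnit_freeMor])

theorem freeMor_add {V W : C} (f g : V ⟶ W) : D.freeMor (f + g) = D.freeMor f + D.freeMor g :=
  D.freeMap_hom_ext fun Y => by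
    simp [freeMap_freeMor]

theorem freeMor_smul {V W : C} (r : k) (f : V ⟶ W) : D.freeMor (r • f) = r • D.freeMor f :=
  D.freeMap_hom_ext fun Y => by
    simp [freeMap_freeMor]

instance : D.freeFunctor.Additive where
  map_add := D.freeMor_add _ _

instance : D.freeFunctor.Linear k where
  map_smul f r := D.freeMor_smul r f

theorem exists_freeCounit (V : C) : ∃ h : D.freeObj V ⟶ V,
    ∀ Y, D.freeMap V Y ≫ Y ◁ h = (D.unitSwap V).app Y :=
  D.freeMap_exists (fun Y => (D.unitSwap V).app Y) fun f => (D.unitSwap V).naturality f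

/-- The projection `F V ⟶ V` to the summand of index the unit. -/
def freeCounit (V : C) : D.freeObj V ⟶ V := (D.exists_freeCounit V).choose

theorem freeMap_freeCounit (V Y : C) :
    D.freeMap V Y ≫ Y ◁ D.freeCounit V = (D.unitSwap V).app Y := (D.exists_freeCounit V).choose_spec Y

@[simp]
theorem freeUnit_freeCounit (V : C) : D.freeUnit V ≫ D.freeCounit V = 𝟙 V := by
  have h := D.freeMap_freeCounit V (𝟙_ C)
  rw [unitSwap_unit] at h
  have h2 : D.freeUnit V ≫ D.freeCounit V =
      (ρ_ V).inv ≫ (D.freeMap V (𝟙_ C) ≫ 𝟙_ C ◁ D.freeCounit V) ≫ (λ_ _).hom := by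
    dsimp only [freeUnit]; monoidal
  rw [h2, h]; simp

theorem freeCounit_naturality {V W : C} (f : V ⟶ W) :
    D.freeMor f ≫ D.freeCounit W = D.freeCounit V ≫ f := by
  refine D.freeMap_hom_ext fun Y => ?_
  rw [MonoidalCategory.whiskerLeft_comp, ← Category.assoc]
  rw [freeMap_freeMor, Category.assoc, freeMap_freeCounit, MonoidalCategory.whiskerLeft_comp,
    ← Category.assoc (D.freeMap V Y), freeMap_freeCounit, unitSwap_app, unitSwap_app,
    Preadditive.comp_sum, Preadditive.sum_comp]
  refine Finset.sum_congr rfl fun a _ => ?_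
  simp only [Category.assoc]
  rw [← whisker_exchange_assoc, ← whisker_exchange]
  simp

end FusionStructure


/-! ### The coend of the center and its coactions -/

theorem tensorLeftHomEquiv_comp {C : Type u} [Category.{v} C] [MonoidalCategory C] {X Y Y' Z Z' : C}
    [ExactPairing Y Y'] (f : Y' ⊗ X ⟶ Z) (h : Z ⟶ Z') :
    tensorLeftHomEquiv X Y Y' Z f ≫ Y ◁ h = tensorLeftHomEquiv X Y Y' Z' (f ≫ h) := by
  simp [tensorLeftHomEquiv]

/-- A morphism on the left leg of a coaction turns into its mate on the dual when the coaction is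
transposed. This produces the dualised factor in the explicit formula for `coendι`. -/
theorem tensorLeftHomEquiv_symm_mate {C : Type u} [Category.{v} C] [MonoidalCategory C]
    [RightRigidCategory C] {X M V A : C} (κ : rdual X ⊗ V ⟶ A) (f : X ⟶ M) :
    (tensorLeftHomEquiv V M (rdual M) A).symm
      (tensorLeftHomEquiv V X (rdual X) A κ ≫ f ▷ A) = rightAdjointMate f ▷ V ≫ κ := by
  dsimp [tensorLeftHomEquiv, rightAdjointMate]
  symm
  calc
    _ = 𝟙 _ ⊗≫ rdual M ◁ η_ X (rdual X) ▷ V ⊗≫ ((rdual M ◁ f ⊗≫ ε_ M (rdual M)) ▷ (rdual X ⊗ V) ≫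
      𝟙_ C ◁ κ) ⊗≫ 𝟙 _ := by monoidal
    _ = _ := by rw [← whisker_exchange]; monoidal

namespace FusionStructure

variable {k : Type*} [CommRing k] {C : Type u} [Category.{v} C] [Preadditive C] [Linear k C]
  [MonoidalCategory C] [MonoidalPreadditive C] [MonoidalLinear k C] [HasFiniteBiproducts C]
  [RigidCategory C] {I : Type w} [Fintype I] (D : FusionStructure k C I)

/-- The isomorphism of the summand of index `(i, j)` with a tensor product of two objects. -/
def summandIso (i j : I) : rdual (rdual (D.V i) ⊗ D.V j ⊗ D.V i) ⊗ D.V j ≅ D.summand (i, j) :=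
  whiskerRightIso (dualTripleIso (rdual (D.V i)) (D.V j) (D.V i)) (D.V j) ≪≫
    α_ _ _ _ ≪≫ whiskerLeftIso (rdual (D.V i)) (α_ _ _ _)

/-- The inclusion into the coend of the summand of index `(i, j)`. -/
def summandι (i j : I) : D.summand (i, j) ⟶ D.coendObj := biproduct.ι D.summand (i, j)

/-- The inclusion into the coend of the summand of index `(i, j)`, as a tensor product of two
objects. -/
def coendIn (i j : I) : rdual (rdual (D.V i) ⊗ D.V j ⊗ D.V i) ⊗ D.V j ⟶ D.coendObj :=
  (D.summandIso i j).hom ≫ D.summandι i j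

/-- The morphism from the coend with prescribed components. -/
def coendDesc {X : C} (t : ∀ i j, rdual (rdual (D.V i) ⊗ D.V j ⊗ D.V i) ⊗ D.V j ⟶ X) :
    D.coendObj ⟶ X :=
  biproduct.desc fun ij : I × I => (D.summandIso ij.1 ij.2).inv ≫ t ij.1 ij.2

theorem summandι_desc {X : C} (t : ∀ i j, rdual (rdual (D.V i) ⊗ D.V j ⊗ D.V i) ⊗ D.V j ⟶ X)
    (i j : I) : D.summandι i j ≫ D.coendDesc t = (D.summandIso i j).inv ≫ t i j :=
  biproduct.ι_desc _ _

@[simp]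
theorem coendIn_desc {X : C} (t : ∀ i j, rdual (rdual (D.V i) ⊗ D.V j ⊗ D.V i) ⊗ D.V j ⟶ X)
    (i j : I) : D.coendIn i j ≫ D.coendDesc t = t i j := by
  rw [coendIn, Category.assoc, summandι_desc, Iso.hom_inv_id_assoc]

theorem coendObj_hom_ext {X : C} {f g : D.coendObj ⟶ X}
    (h : ∀ i j, D.coendIn i j ≫ f = D.coendIn i j ≫ g) : f = g := by
  refine biproduct.hom_ext' _ _ fun ij => ?_
  change D.summandι ij.1 ij.2 ≫ f = D.summandι ij.1 ij.2 ≫ g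
  have := h ij.1 ij.2
  simpa only [coendIn, Category.assoc, cancel_epi] using this

/-- The projection of the free object to a summand. -/
def freeπ (V : C) (i : I) : D.freeObj V ⟶ rdual (D.V i) ⊗ V ⊗ D.V i :=
  biproduct.π (fun i => rdual (D.V i) ⊗ V ⊗ D.V i) i

theorem freeι_π_self (V : C) (i : I) : D.freeι V i ≫ D.freeπ V i = 𝟙 _ :=
  biproduct.ι_π_self _ _

theorem freeι_π_ne (V : C) {i j : I} (h : i ≠ j) : D.freeι V i ≫ D.freeπ V j = 0 :=
  biproduct.ι_π_ne _ h

theorem freeπ_hom_ext {V X Z : C} {f g : X ⟶ D.freeObj V ⊗ Z}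
    (h : ∀ i, f ≫ D.freeπ V i ▷ Z = g ≫ D.freeπ V i ▷ Z) : f = g := by
  have key : ∑ i, D.freeπ V i ≫ D.freeι V i = 𝟙 _ := D.freeObj_hom_ext fun i => by
    rw [Preadditive.comp_sum, Finset.sum_eq_single i]
    · rw [← Category.assoc, freeι_π_self, Category.id_comp, Category.comp_id]
    · intro j _ hj
      rw [← Category.assoc, D.freeι_π_ne V hj.symm, zero_comp]
    · simp
  have e : ∀ f : X ⟶ D.freeObj V ⊗ Z, f = ∑ i, (f ≫ D.freeπ V i ▷ Z) ≫ D.freeι V i ▷ Z := by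
    intro f
    calc f = f ≫ (∑ i, D.freeπ V i ≫ D.freeι V i) ▷ Z := by rw [key]; simp
      _ = _ := by simp [sum_whiskerRight, Preadditive.comp_sum]
  rw [e f, e g]
  exact Finset.sum_congr rfl fun i _ => by rw [h i]

/-- The natural family `V ⟶ F V ⊗ A`. -/
def freeCoactNat : 𝟭 C ⟶ D.freeFunctor ⋙ tensorRight D.coendObj :=
  D.natTrans (K := 𝟭 C) (U := D.freeFunctor ⋙ tensorRight D.coendObj) fun j =>
    ∑ i, tensorLeftHomEquiv (D.V j) _ (rdual (rdual (D.V i) ⊗ D.V j ⊗ D.V i)) _ (D.coendIn i j) ≫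
      D.freeι (D.V j) i ▷ D.coendObj

/-- The components of the natural family `V ⟶ F V ⊗ A`. -/
def freeCoact (V : C) : V ⟶ D.freeObj V ⊗ D.coendObj := D.freeCoactNat.app V

theorem freeCoact_naturality {V W : C} (f : V ⟶ W) :
    f ≫ D.freeCoact W = D.freeCoact V ≫ D.freeMor f ▷ D.coendObj :=
  D.freeCoactNat.naturality f

theorem freeCoact_V (j : I) : D.freeCoact (D.V j) =
    ∑ i, tensorLeftHomEquiv (D.V j) _ (rdual (rdual (D.V i) ⊗ D.V j ⊗ D.V i)) _ (D.coendIn i j) ≫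
      D.freeι (D.V j) i ▷ D.coendObj := by
  exact D.natTrans_app_V (K := 𝟭 C) (U := D.freeFunctor ⋙ tensorRight D.coendObj) _ j

theorem freeCoact_eq {X : C} (d : Decomposition D.V X) : D.freeCoact X =
    ∑ a, d.p a ≫ D.freeCoact (D.V (d.s a)) ≫ D.freeMor (d.q a) ▷ D.coendObj :=
  D.nat_eq_sum D.freeCoactNat d

/-- The projection isolates one term of the sum defining the coaction, so a morphism out of the
coend can be read off component by component. -/
theorem freeCoact_V_comp (i j : I) {X : C} (h : D.coendObj ⟶ X) :
    (D.freeCoact (D.V j) ≫ D.freeObj (D.V j) ◁ h) ≫ D.freeπ (D.V j) i ▷ X =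
    tensorLeftHomEquiv (D.V j) _ (rdual (rdual (D.V i) ⊗ D.V j ⊗ D.V i)) _
      (D.coendIn i j ≫ h) := by
  rw [freeCoact_V, Category.assoc, whisker_exchange, Preadditive.sum_comp,
    Finset.sum_eq_single i]
  · have := D.freeι_π_self (D.V j) i
    rw [← tensorLeftHomEquiv_comp]
    simp only [Category.assoc]
    rw [← comp_whiskerRight_assoc, this]
    simp
  · intro i' _ hi
    have := D.freeι_π_ne (D.V j) hi
    simp only [Category.assoc]
    rw [← comp_whiskerRight_assoc, this]
    simp
  · simp

/-- The coaction of the coend on an object with half-braiding. -/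
def coact {M : C} (b : HalfBraiding M) : M ⟶ M ⊗ D.coendObj :=
  D.freeCoact M ≫ D.freeLift b (𝟙 M) ▷ D.coendObj

theorem coact_naturality {M N : C} {b : HalfBraiding M} {b' : HalfBraiding N} {f : M ⟶ N}
    (hf : IsCentral b b' f) : f ≫ D.coact b' = D.coact b ≫ f ▷ D.coendObj := by
  dsimp only [coact]
  rw [← Category.assoc, freeCoact_naturality, Category.assoc, Category.assoc, ← comp_whiskerRight,
    ← comp_whiskerRight, freeMor_freeLift, D.freeLift_comp _ hf]
  simp

/-- A triangle identity of the free-forgetful adjunction. Together with the definition of `coact` it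
shows that the coactions on the center and the family `freeCoact` on `C` determine each other. -/
theorem freeUnit_coact (V : C) :
    D.freeUnit V ≫ D.coact (D.freeHalfBraiding V) = D.freeCoact V := by
  dsimp only [coact]
  have : D.freeMor (D.freeUnit V) ≫ D.freeLift (D.freeHalfBraiding V) (𝟙 _) = 𝟙 _ := by
    rw [freeMor_freeLift]
    exact D.free_hom_ext (D.freeLift_central _ _) (IsCentral.id _) (by simp)
  rw [← Category.assoc, freeCoact_naturality, Category.assoc, ← comp_whiskerRight, this]
  simp

/-- Restricting `t` to free objects along the unit gives a family `V ⟶ F V ⊗ X` natural in `V`, and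
`t` is recovered from it through `freeLift b (𝟙 M)`. Such a family is given by arbitrary components
at the `V j`, projected to the summands of `F (V j)`. The transposes of these are the components of
`h`. -/
theorem coact_existsUnique {X : C} (t : ∀ (M : C) (_ : HalfBraiding M), M ⟶ M ⊗ X)
    (ht : ∀ {M N : C} {b : HalfBraiding M} {b' : HalfBraiding N} {f : M ⟶ N},
      IsCentral b b' f → f ≫ t N b' = t M b ≫ f ▷ X) :
    ∃! h : D.coendObj ⟶ X, ∀ M b, D.coact b ≫ M ◁ h = t M b := by
  let s (V : C) : V ⟶ D.freeObj V ⊗ X := D.freeUnit V ≫ t _ (D.freeHalfBraiding V)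
  have hs : ∀ {V W : C} (f : V ⟶ W), f ≫ s W = s V ≫ D.freeMor f ▷ X := by
    intro V W f
    dsimp only [s]
    rw [Category.assoc, ← ht (D.freeMor_central f), ← Category.assoc, ← Category.assoc,
      freeUnit_freeMor]
  have hc : ∀ {V W : C} (f : V ⟶ W) (h : D.coendObj ⟶ X),
      f ≫ D.freeCoact W ≫ D.freeObj W ◁ h =
        (D.freeCoact V ≫ D.freeObj V ◁ h) ≫ D.freeMor f ▷ X := by
    intro V W f h
    rw [← Category.assoc, freeCoact_naturality, Category.assoc, Category.assoc, whisker_exchange]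
  refine ⟨D.coendDesc fun i j => (tensorLeftHomEquiv (D.V j) _
    (rdual (rdual (D.V i) ⊗ D.V j ⊗ D.V i)) X).symm (s (D.V j) ≫ D.freeπ _ i ▷ X), ?_, ?_⟩
  · intro M b
    set h := D.coendDesc fun i j => (tensorLeftHomEquiv (D.V j) _
      (rdual (rdual (D.V i) ⊗ D.V j ⊗ D.V i)) X).symm (s (D.V j) ≫ D.freeπ _ i ▷ X) with hh
    have key : ∀ V, D.freeCoact V ≫ D.freeObj V ◁ h = s V := by
      intro V
      let u1 : 𝟭 C ⟶ D.freeFunctor ⋙ tensorRight X :=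
        { app := fun V => D.freeCoact V ≫ D.freeObj V ◁ h
          naturality := fun V W f => hc f h }
      let u2 : 𝟭 C ⟶ D.freeFunctor ⋙ tensorRight X :=
        { app := fun V => s V
          naturality := fun V W f => hs f }
      have : u1 = u2 := D.nat_ext fun j => D.freeπ_hom_ext fun i => by
        change (D.freeCoact (D.V j) ≫ D.freeObj (D.V j) ◁ h) ≫ D.freeπ (D.V j) i ▷ X =
          s (D.V j) ≫ D.freeπ (D.V j) i ▷ X
        rw [freeCoact_V_comp, hh, coendIn_desc, Equiv.apply_symm_apply]
      exact congr_app this V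
    dsimp only [coact]
    rw [Category.assoc, ← whisker_exchange, ← Category.assoc, key]
    dsimp only [s]
    rw [Category.assoc, ← ht (D.freeLift_central b _), ← Category.assoc]
    simp
  · intro h hh
    refine D.coendObj_hom_ext fun i j => ?_
    rw [coendIn_desc, Equiv.eq_symm_apply, ← freeCoact_V_comp, ← freeUnit_coact,
      Category.assoc (D.freeUnit _), hh]

/-- The coactions, as a natural transformation. -/
def coactNat : Center.forget C ⟶ Center.forget C ⋙ tensorRight D.coendObj where
  app M := D.coact M.2
  naturality _ _ f := D.coact_naturality f.comm

theorem isUniversal_coactNat : IsUniversal D.coactNat where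
  existsUnique {X} t := by
    obtain ⟨h, h1, h2⟩ := D.coact_existsUnique (fun M b => t.app ⟨M, b⟩)
      (fun {M N b b' f} hf => t.naturality (X := ⟨M, b⟩) (Y := ⟨N, b'⟩) ⟨f, hf⟩)
    exact ⟨h, fun M => h1 M.1 M.2, fun h' hh' => h2 h' fun M b => hh' ⟨M, b⟩⟩

theorem coact_exists_param {P X : C} (t : ∀ (M : C) (_ : HalfBraiding M), M ⊗ P ⟶ M ⊗ X)
    (ht : ∀ {M N : C} {b : HalfBraiding M} {b' : HalfBraiding N} {f : M ⟶ N},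
      IsCentral b b' f → f ▷ P ≫ t N b' = t M b ≫ f ▷ X) :
    ∃ h : D.coendObj ⊗ P ⟶ X, ∀ {M : C} (b : HalfBraiding M),
      D.coact b ▷ P ≫ (α_ _ _ _).hom ≫ M ◁ h = t M b := by
  obtain ⟨h, hh⟩ := D.isUniversal_coactNat.exists_param (P := P) (X := X)
    (fun M => t M.1 M.2) (fun f => ht f.comm)
  exact ⟨h, fun {M} b => hh ⟨M, b⟩⟩

theorem coact_hom_ext_param {P X : C} {h h' : D.coendObj ⊗ P ⟶ X}
    (H : ∀ (M : C) (b : HalfBraiding M), D.coact b ▷ P ≫ (α_ _ _ _).hom ≫ M ◁ h =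
      D.coact b ▷ P ≫ (α_ _ _ _).hom ≫ M ◁ h') : h = h' :=
  D.isUniversal_coactNat.hom_ext_param fun M => H M.1 M.2

/-- The coactions can only be central if the half-braiding of the coend is obtained by conjugating
them with the half-braidings of the coacted objects. The conjugated family is natural, so it defines
a morphism. -/
theorem exists_coendBraid (P : C) : ∃ h : D.coendObj ⊗ P ⟶ P ⊗ D.coendObj,
    ∀ {M : C} (b : HalfBraiding M), D.coact b ▷ P ≫ (α_ _ _ _).hom ≫ M ◁ h =
      (b.β P).hom ≫ P ◁ D.coact b ≫ (α_ _ _ _).inv ≫ (b.β P).inv ▷ D.coendObj ≫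
        (α_ _ _ _).hom := by
  refine D.coact_exists_param (fun M b => (b.β P).hom ≫ P ◁ D.coact b ≫ (α_ _ _ _).inv ≫
    (b.β P).inv ▷ D.coendObj ≫ (α_ _ _ _).hom) ?_
  intro M N b b' f hf
  have n : (b.β P).inv ≫ f ▷ P = P ◁ f ≫ (b'.β P).inv := by
    rw [Iso.inv_comp_eq, ← Category.assoc, Iso.eq_comp_inv, hf P]
  have n2 := D.coact_naturality hf
  calc
    _ = (f ▷ P ≫ (b'.β P).hom) ≫ P ◁ D.coact b' ≫ (α_ _ _ _).inv ≫
        (b'.β P).inv ▷ D.coendObj ≫ (α_ _ _ _).hom := by simp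
    _ = (b.β P).hom ≫ P ◁ (f ≫ D.coact b') ≫ (α_ _ _ _).inv ≫
        (b'.β P).inv ▷ D.coendObj ≫ (α_ _ _ _).hom := by rw [hf P]; simp
    _ = (b.β P).hom ≫ P ◁ D.coact b ≫ (α_ _ _ _).inv ≫
        (P ◁ f ≫ (b'.β P).inv) ▷ D.coendObj ≫ (α_ _ _ _).hom := by rw [n2]; monoidal
    _ = _ := by rw [← n]; monoidal

/-- The half-braiding of the coend, as a morphism. -/
def coendBraid (P : C) : D.coendObj ⊗ P ⟶ P ⊗ D.coendObj := (D.exists_coendBraid P).choose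

theorem coact_coendBraid {M : C} (b : HalfBraiding M) (P : C) :
    D.coact b ▷ P ≫ (α_ _ _ _).hom ≫ M ◁ D.coendBraid P =
      (b.β P).hom ≫ P ◁ D.coact b ≫ (α_ _ _ _).inv ≫ (b.β P).inv ▷ D.coendObj ≫
        (α_ _ _ _).hom := (D.exists_coendBraid P).choose_spec b

theorem coact_coendBraid' {M : C} (b : HalfBraiding M) (P : C) :
    D.coact b ▷ P ≫ (α_ _ _ _).hom ≫ M ◁ D.coendBraid P ≫ (α_ _ _ _).inv ≫
      (b.β P).hom ▷ D.coendObj ≫ (α_ _ _ _).hom = (b.β P).hom ≫ P ◁ D.coact b := by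
  have := D.coact_coendBraid b P
  rw [← Category.assoc (α_ _ _ _).hom, ← Category.assoc (D.coact b ▷ P), this]
  simp

/-- The half-braiding of the coend. -/
def coendHalfBraiding : HalfBraiding D.coendObj :=
  halfBraidingOfLax D.coendBraid
    (fun {P P'} f => by
      refine D.coact_hom_ext_param fun M b => ?_
      have n1 := b.naturality f
      have n2 : (b.β P).inv ≫ M ◁ f = f ▷ M ≫ (b.β P').inv := by
        rw [Iso.inv_comp_eq, ← Category.assoc, Iso.eq_comp_inv, n1]
      calc
        _ = 𝟙 _ ⊗≫ (D.coact b ▷ P ≫ (M ⊗ D.coendObj) ◁ f) ⊗≫ M ◁ D.coendBraid P' ⊗≫ 𝟙 _ := by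
          monoidal
        _ = 𝟙 _ ⊗≫ M ◁ f ⊗≫ (D.coact b ▷ P' ≫ (α_ _ _ _).hom ≫ M ◁ D.coendBraid P') ⊗≫ 𝟙 _ := by
          rw [← whisker_exchange]; monoidal
        _ = 𝟙 _ ⊗≫ (M ◁ f ≫ (b.β P').hom) ⊗≫ P' ◁ D.coact b ⊗≫ (b.β P').inv ▷ D.coendObj ⊗≫
            𝟙 _ := by rw [coact_coendBraid]; monoidal
        _ = 𝟙 _ ⊗≫ (b.β P).hom ⊗≫ (f ▷ M ≫ P' ◁ D.coact b) ⊗≫ (b.β P').inv ▷ D.coendObj ⊗≫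
            𝟙 _ := by rw [n1]; monoidal
        _ = 𝟙 _ ⊗≫ (b.β P).hom ⊗≫ P ◁ D.coact b ⊗≫ (f ▷ M ≫ (b.β P').inv) ▷ D.coendObj ⊗≫
            𝟙 _ := by rw [← whisker_exchange]; monoidal
        _ = 𝟙 _ ⊗≫ ((b.β P).hom ≫ P ◁ D.coact b ≫ (α_ _ _ _).inv ≫ (b.β P).inv ▷ D.coendObj ≫
        (α_ _ _ _).hom) ⊗≫ M ◁ f ▷ D.coendObj ⊗≫ 𝟙 _ := by rw [← n2]; monoidal
        _ = _ := by rw [← coact_coendBraid]; monoidal)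
    (by
      refine D.coact_hom_ext_param fun M b => ?_
      have e : (b.β (𝟙_ C)).inv = (λ_ M).hom ≫ (ρ_ M).inv := by
        rw [← cancel_epi (b.β (𝟙_ C)).hom, Iso.hom_inv_id, halfBraiding_unit]; simp
      rw [coact_coendBraid, e, halfBraiding_unit]
      monoidal)
    (fun P P' => by
      refine D.coact_hom_ext_param fun M b => ?_
      have h : (b.β (P ⊗ P')).inv = (α_ _ _ _).hom ≫ P ◁ (b.β P').inv ≫ (α_ _ _ _).inv ≫
          (b.β P).inv ▷ P' ≫ (α_ _ _ _).hom := by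
        rw [← cancel_epi (b.β (P ⊗ P')).hom, Iso.hom_inv_id, b.monoidal]
        simp
      rw [coact_coendBraid, h, b.monoidal]
      symm
      calc
        _ = 𝟙 _ ⊗≫ (D.coact b ▷ P ≫ (α_ _ _ _).hom ≫ M ◁ D.coendBraid P) ▷ P' ⊗≫
            M ◁ P ◁ D.coendBraid P' ⊗≫ 𝟙 _ := by monoidal
        _ = 𝟙 _ ⊗≫ (b.β P).hom ▷ P' ⊗≫ P ◁ D.coact b ▷ P' ⊗≫
            ((b.β P).inv ▷ (D.coendObj ⊗ P') ≫ (M ⊗ P) ◁ D.coendBraid P') ⊗≫ 𝟙 _ := by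
          rw [coact_coendBraid]; monoidal
        _ = 𝟙 _ ⊗≫ (b.β P).hom ▷ P' ⊗≫ P ◁ (D.coact b ▷ P' ≫ (α_ _ _ _).hom ≫
            M ◁ D.coendBraid P') ⊗≫ (b.β P).inv ▷ (P' ⊗ D.coendObj) ⊗≫ 𝟙 _ := by
          rw [← whisker_exchange]; monoidal
        _ = _ := by rw [coact_coendBraid]; monoidal)

theorem coact_central {M : C} (b : HalfBraiding M) :
    IsCentral b (tensorHalfBraiding b D.coendHalfBraiding) (D.coact b) := fun P => by
  rw [tensorHalfBraiding_hom]
  have := D.coact_coendBraid' b P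
  rw [← this]
  dsimp only [coendHalfBraiding]
  rw [halfBraidingOfLax_hom]
  monoidal

/-- Here the morphisms `r_i` of the statement appear: on the summand of index `i` the central
extension of `q` is the half-braiding followed by evaluation. -/
theorem freeι_freeLift {V M : C} (b : HalfBraiding M) (q : V ⟶ M) (i : I) :
    D.freeι V i ≫ D.freeLift b q = (rdual (D.V i) ◁ q ▷ D.V i) ≫ rdual (D.V i) ◁ (b.β (D.V i)).hom ≫
      (α_ _ _ _).inv ≫ ε_ (D.V i) (rdual (D.V i)) ▷ M ≫ (λ_ M).hom := by
  apply (tensorLeftHomEquiv (V ⊗ D.V i) (D.V i) (rdual (D.V i)) M).injective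
  rw [← freeMap_V_comp, freeMap_freeLift, ← Equiv.symm_apply_eq]
  simp [tensorLeftHomEquiv]

theorem coact_eq {M : C} (b : HalfBraiding M) (d : Decomposition D.V M) :
    D.coact b = ∑ a, ∑ i, d.p a ≫ tensorLeftHomEquiv (D.V (d.s a)) _
      (rdual (rdual (D.V i) ⊗ D.V (d.s a) ⊗ D.V i)) _ (D.coendIn i (d.s a)) ≫
        ((rdual (D.V i) ◁ d.q a ▷ D.V i) ≫ rdual (D.V i) ◁ (b.β (D.V i)).hom ≫
      (α_ _ _ _).inv ≫ ε_ (D.V i) (rdual (D.V i)) ▷ M ≫ (λ_ M).hom) ▷ D.coendObj := by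
  rw [coact, D.freeCoact_eq d, Preadditive.sum_comp]
  refine Finset.sum_congr rfl fun a _ => ?_
  rw [Category.assoc, Category.assoc, ← comp_whiskerRight, freeMor_freeLift, freeCoact_V,
    Category.comp_id, Preadditive.sum_comp, Preadditive.comp_sum]
  refine Finset.sum_congr rfl fun i _ => ?_
  rw [Category.assoc, ← comp_whiskerRight, freeι_freeLift]

/-- The coend as an object of the center. -/
def coendC : Center C := ⟨D.coendObj, D.coendHalfBraiding⟩

/-- The coaction as a morphism of the center. -/
def coactC (M : Center C) : M ⟶ M ⊗ D.coendC where
  f := D.coact M.2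
  comm := D.coact_central M.2

theorem coactC_naturality {M N : Center C} (f : M ⟶ N) :
    f ≫ D.coactC N = D.coactC M ≫ f ▷ D.coendC :=
  Center.ext _ _ (D.coact_naturality f.comm)

/-- The coactions in the center, as a natural transformation. -/
def coactCNat : 𝟭 (Center C) ⟶ 𝟭 (Center C) ⋙ tensorRight D.coendC where
  app M := D.coactC M
  naturality _ _ f := D.coactC_naturality f

/-- The coaction `coact b` is itself central, and the half-braiding of `M` is invertible, so it can
be moved to the other side and cancelled. What remains is separated by the coactions. -/
theorem isCentral_of_coact {X : C} (b' : HalfBraiding X) (h : D.coendObj ⟶ X)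
    (H : ∀ {M : C} (b : HalfBraiding M), IsCentral b (tensorHalfBraiding b b') (D.coact b ≫ M ◁ h)) :
    IsCentral D.coendHalfBraiding b' h := fun P => by
  refine D.coact_hom_ext_param fun M b => ?_
  have h1 := H b P
  have h2 := D.coact_central b P
  rw [tensorHalfBraiding_hom] at h1 h2
  have h1' : (D.coact b ≫ M ◁ h) ▷ P ≫ (α_ _ _ _).hom ≫ M ◁ (b'.β P).hom =
      (b.β P).hom ≫ P ◁ (D.coact b ≫ M ◁ h) ≫ (α_ _ _ _).inv ≫ (b.β P).inv ▷ X ≫ (α_ _ _ _).hom := by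
    calc
      _ = ((D.coact b ≫ M ◁ h) ▷ P ≫ (𝟙 _ ⊗≫ M ◁ (b'.β P).hom ⊗≫ (b.β P).hom ▷ X ⊗≫ 𝟙 (P ⊗ M ⊗ X))) ⊗≫
        (b.β P).inv ▷ X ⊗≫ 𝟙 _ := by
          symm
          calc _ = (D.coact b ≫ M ◁ h) ▷ P ⊗≫ M ◁ (b'.β P).hom ⊗≫
                ((b.β P).hom ≫ (b.β P).inv) ▷ X ⊗≫ 𝟙 _ := by monoidal
            _ = _ := by rw [Iso.hom_inv_id]; monoidal
      _ = _ := by rw [h1]; monoidal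
  have h2' : (D.coact b) ▷ P ≫ (α_ _ _ _).hom ≫ M ◁ (D.coendHalfBraiding.β P).hom =
      (b.β P).hom ≫ P ◁ (D.coact b) ≫ (α_ _ _ _).inv ≫ (b.β P).inv ▷ D.coendObj ≫
        (α_ _ _ _).hom := D.coact_coendBraid b P
  calc
    _ = (D.coact b ≫ M ◁ h) ▷ P ≫ (α_ _ _ _).hom ≫ M ◁ (b'.β P).hom := by monoidal
    _ = 𝟙 _ ⊗≫ (b.β P).hom ⊗≫ P ◁ D.coact b ⊗≫ ((P ⊗ M) ◁ h ≫ (b.β P).inv ▷ X) ⊗≫ 𝟙 _ := by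
      rw [h1']; monoidal
    _ = 𝟙 _ ⊗≫ ((b.β P).hom ≫ P ◁ (D.coact b) ≫ (α_ _ _ _).inv ≫ (b.β P).inv ▷ D.coendObj ≫
        (α_ _ _ _).hom) ⊗≫ M ◁ P ◁ h ⊗≫ 𝟙 _ := by rw [whisker_exchange]; monoidal
    _ = _ := by rw [← h2']; monoidal

/-- The comparison morphism is found in `C`. It is automatically central because its composites with
the coactions are. -/
theorem isUniversal_coactCNat : IsUniversal D.coactCNat where
  existsUnique {X} t := by
    obtain ⟨h, h1, h2⟩ := D.coact_existsUnique (X := X.1) (fun M b => (t.app ⟨M, b⟩).f)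
      (fun {M N b b' f} hf => congr_arg Center.Hom.f (t.naturality (X := ⟨M, b⟩) (Y := ⟨N, b'⟩) ⟨f, hf⟩))
    have hc : IsCentral D.coendHalfBraiding X.2 h := D.isCentral_of_coact X.2 h fun {M} b => by
      rw [h1]; exact (t.app ⟨M, b⟩).comm
    refine ⟨⟨h, hc⟩, fun M => Center.ext _ _ (h1 M.1 M.2), fun h' hh' => Center.ext _ _ ?_⟩
    exact h2 h'.f fun M b => congr_arg Center.Hom.f (hh' ⟨M, b⟩)

end FusionStructure


/-! ### Universal coactions and coends -/

section UniversalCoaction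

variable {B : Type u} [Category.{v} B] [MonoidalCategory B] {A : B}

/-- A natural family of morphisms `X ⟶ X ⊗ A`, universal among such families. -/
structure IsUniversalCoaction (δ : ∀ X : B, X ⟶ X ⊗ A) : Prop where
  naturality : ∀ {X Y : B} (f : X ⟶ Y), f ≫ δ Y = δ X ≫ f ▷ A
  existsUnique : ∀ {Z : B} (t : ∀ X : B, X ⟶ X ⊗ Z),
    (∀ {X Y : B} (f : X ⟶ Y), f ≫ t Y = t X ≫ f ▷ Z) → ∃! h : A ⟶ Z, ∀ X, δ X ≫ X ◁ h = t X

/-- A family of morphisms `K m ⟶ K m ⊗ A` separating the morphisms out of `A`. -/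
def Separating {J : Type*} {K : J → B} (a : ∀ m, K m ⟶ K m ⊗ A) : Prop :=
  ∀ {Z : B} {h h' : A ⟶ Z}, (∀ m, a m ≫ K m ◁ h = a m ≫ K m ◁ h') → h = h'

theorem Separating.param [RightRigidCategory B] {J : Type*} {K : J → B} {a : ∀ m, K m ⟶ K m ⊗ A}
    (ha : Separating a) {P Z : B} {h h' : A ⊗ P ⟶ Z}
    (H : ∀ m, a m ▷ P ≫ (α_ _ _ _).hom ≫ K m ◁ h = a m ▷ P ≫ (α_ _ _ _).hom ≫ K m ◁ h') :
    h = h' := by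
  apply (tensorRightHomEquiv A P (rdual P) Z).injective
  refine ha fun m => ?_
  have key : ∀ (h : A ⊗ P ⟶ Z), a m ≫ K m ◁ tensorRightHomEquiv A P (rdual P) Z h =
      𝟙 _ ⊗≫ K m ◁ η_ P (rdual P) ⊗≫ (a m ▷ P ≫ (α_ _ _ _).hom ≫ K m ◁ h) ▷ rdual P ⊗≫ 𝟙 _ := by
    intro h
    dsimp [tensorRightHomEquiv]
    calc
      _ = 𝟙 _ ⊗≫ (a m ▷ (𝟙_ B) ≫ (K m ⊗ A) ◁ η_ P (rdual P)) ⊗≫ K m ◁ h ▷ rdual P ⊗≫ 𝟙 _ := by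
        monoidal
      _ = _ := by rw [← whisker_exchange]; monoidal
  rw [key, key, H]

namespace IsUniversalCoaction

variable {δ : ∀ X : B, X ⟶ X ⊗ A} (hδ : IsUniversalCoaction δ)

include hδ

theorem separating : Separating δ := by
  intro Z h h' H
  refine (hδ.existsUnique (fun X => δ X ≫ X ◁ h') fun {X Y} f => ?_).unique H fun _ => rfl
  rw [← Category.assoc, hδ.naturality, Category.assoc, Category.assoc, ← whisker_exchange]

theorem isUniversal :
    IsUniversal (K := 𝟭 B) (U := 𝟭 B) { app := δ, naturality := fun _ _ f => hδ.naturality f } where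
  existsUnique t := hδ.existsUnique (fun X => t.app X) fun f => t.naturality f

theorem exists_param [RightRigidCategory B] {P Z : B} (t : ∀ X : B, X ⊗ P ⟶ X ⊗ Z)
    (ht : ∀ {X Y : B} (f : X ⟶ Y), f ▷ P ≫ t Y = t X ≫ f ▷ Z) :
    ∃ h : A ⊗ P ⟶ Z, ∀ X, δ X ▷ P ≫ (α_ _ _ _).hom ≫ X ◁ h = t X :=
  hδ.isUniversal.exists_param t ht

end IsUniversalCoaction

variable [RightRigidCategory B]

/-- The family `Xᘁ ⊗ X ⟶ A` associated with a family of coactions. -/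
def coendFam (δ : ∀ X : B, X ⟶ X ⊗ A) (X : B) : rdual X ⊗ X ⟶ A :=
  (tensorLeftHomEquiv X X (rdual X) A).symm (δ X)

theorem coaction_eq (i : ∀ X : B, rdual X ⊗ X ⟶ A) (X : B) :
    coaction i X = tensorLeftHomEquiv X X (rdual X) A (i X) := by
  simp [coaction, tensorLeftHomEquiv]

theorem coaction_coendFam (δ : ∀ X : B, X ⟶ X ⊗ A) (X : B) : coaction (coendFam δ) X = δ X := by
  rw [coaction_eq, coendFam, Equiv.apply_symm_apply]

/-- Dinaturality and naturality are transposes of each other: the coevaluation exchanges `f` on one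
leg with its mate on the other. -/
theorem coaction_naturality {i : ∀ X : B, rdual X ⊗ X ⟶ A} {X Y : B} {f : X ⟶ Y}
    (hi : rightAdjointMate f ▷ X ≫ i X = rdual Y ◁ f ≫ i Y) :
    f ≫ coaction i Y = coaction i X ≫ f ▷ A := by
  dsimp only [coaction]
  have := coevaluation_comp_rightAdjointMate f
  calc
    _ = 𝟙 _ ⊗≫ (𝟙_ B ◁ f ≫ η_ Y (rdual Y) ▷ Y) ⊗≫ Y ◁ i Y := by monoidal
    _ = 𝟙 _ ⊗≫ η_ Y (rdual Y) ▷ X ⊗≫ Y ◁ (rdual Y ◁ f ≫ i Y) := by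
      rw [whisker_exchange]; monoidal
    _ = 𝟙 _ ⊗≫ (η_ Y (rdual Y) ≫ Y ◁ rightAdjointMate f) ▷ X ⊗≫ Y ◁ i X := by
      rw [← hi]; monoidal
    _ = 𝟙 _ ⊗≫ η_ X (rdual X) ▷ X ⊗≫ (f ▷ (rdual X ⊗ X) ≫ Y ◁ i X) := by
      rw [this]; monoidal
    _ = _ := by rw [← whisker_exchange]; monoidal

theorem coendFam_dinatural {δ : ∀ X : B, X ⟶ X ⊗ A}
    (hδ : ∀ {X Y : B} (f : X ⟶ Y), f ≫ δ Y = δ X ≫ f ▷ A) {X Y : B} (f : X ⟶ Y) :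
    rightAdjointMate f ▷ X ≫ coendFam δ X = rdual Y ◁ f ≫ coendFam δ Y := by
  have := rightAdjointMate_comp_evaluation f
  have n := hδ f
  dsimp [coendFam, tensorLeftHomEquiv]
  calc
    _ = 𝟙 _ ⊗≫ (rightAdjointMate f ▷ X ≫ rdual X ◁ δ X) ⊗≫ ε_ X (rdual X) ▷ A ⊗≫ 𝟙 _ := by
      monoidal
    _ = 𝟙 _ ⊗≫ rdual Y ◁ δ X ⊗≫ (rightAdjointMate f ▷ X ≫ ε_ X (rdual X)) ▷ A ⊗≫ 𝟙 _ := by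
      rw [← whisker_exchange]; monoidal
    _ = 𝟙 _ ⊗≫ rdual Y ◁ (δ X ≫ f ▷ A) ⊗≫ ε_ Y (rdual Y) ▷ A ⊗≫ 𝟙 _ := by
      rw [this]; monoidal
    _ = _ := by rw [← n]; monoidal

theorem coendFam_comp_eq_iff {δ : ∀ X : B, X ⟶ X ⊗ A} {Z : B} {i : ∀ X : B, rdual X ⊗ X ⟶ Z}
    (h : A ⟶ Z) (X : B) : coendFam δ X ≫ h = i X ↔ δ X ≫ X ◁ h = coaction i X := by
  rw [coaction_eq, coendFam, ← Equiv.symm_apply_eq (tensorLeftHomEquiv X X (rdual X) Z)]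
  have : (tensorLeftHomEquiv X X (rdual X) Z).symm (δ X ≫ X ◁ h) =
      (tensorLeftHomEquiv X X (rdual X) A).symm (δ X) ≫ h := by
    rw [Equiv.symm_apply_eq, ← tensorLeftHomEquiv_comp, Equiv.apply_symm_apply]
  rw [this]

/-- A universal coaction exhibits a coend. -/
theorem IsUniversalCoaction.nonempty_isColimit {δ : ∀ X : B, X ⟶ X ⊗ A}
    (hδ : IsUniversalCoaction δ)
    (hi : ∀ ⦃X Y : B⦄ (f : X ⟶ Y),
      rightAdjointMate f ▷ X ≫ coendFam δ X = rdual Y ◁ f ≫ coendFam δ Y) :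
    Nonempty (IsColimit (Cowedge.mk (F := dualTensor B) A (coendFam δ) hi)) := by
  have key : ∀ (E : Cowedge (dualTensor B)), ∃! h : A ⟶ E.pt, ∀ X, coendFam δ X ≫ h = E.π X := by
    intro E
    have hE : ∀ {X Y : B} (f : X ⟶ Y), rightAdjointMate f ▷ X ≫ E.π X = rdual Y ◁ f ≫ E.π Y :=
      fun f => Cowedge.condition E f
    have e : ∀ (h : A ⟶ E.pt) X, coendFam δ X ≫ h = E.π X ↔
        δ X ≫ X ◁ h = coaction (A := E.pt) (fun X : B => E.π X) X :=
      fun h X => coendFam_comp_eq_iff (i := fun X : B => E.π X) h X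
    obtain ⟨h, h1, h2⟩ := hδ.existsUnique (coaction (A := E.pt) fun X : B => E.π X)
      fun f => coaction_naturality (hE f)
    exact ⟨h, fun X => (e h X).2 (h1 X), fun h' H => h2 h' fun X => (e h' X).1 (H X)⟩
  exact ⟨Multicofork.IsColimit.mk _ (fun E => (key E).choose) (fun E X => (key E).choose_spec.1 X)
    (fun E m hm => (key E).choose_spec.2 m hm)⟩

end UniversalCoaction

/-! ### The Hopf algebra structure of a coend -/

section Hopf

variable {B : Type u} [Category.{v} B] [MonoidalCategory B] [BraidedCategory B]

/-- Naturality of the braiding lets `c` act after `A₁` has crossed `N`. The product of two coactions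
becomes an iterated one, so universal properties can be used one variable at a time. -/
theorem tensorHom_tensorμ_whiskerLeft {M N A₁ A₂ Z : B} (a : M ⟶ M ⊗ A₁) (c : N ⟶ N ⊗ A₂)
    (h : A₂ ⊗ A₁ ⟶ Z) :
    (a ⊗ₘ c) ≫ tensorμ M A₁ N A₂ ≫ (M ⊗ N) ◁ ((β_ A₁ A₂).hom ≫ h) =
      a ▷ N ≫ (α_ _ _ _).hom ≫ M ◁ ((β_ A₁ N).hom ≫ c ▷ A₁ ≫ (α_ _ _ _).hom ≫ N ◁ h) ≫
        (α_ _ _ _).inv := by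
  have n : A₁ ◁ c ≫ (β_ A₁ (N ⊗ A₂)).hom = (β_ A₁ N).hom ≫ c ▷ A₁ :=
    BraidedCategory.braiding_naturality_right A₁ c
  rw [BraidedCategory.braiding_tensor_right_hom] at n
  rw [MonoidalCategory.tensorHom_def]
  dsimp only [tensorμ]
  calc
    _ = 𝟙 _ ⊗≫ a ▷ N ⊗≫ M ◁ (A₁ ◁ c ≫ ((α_ _ _ _).inv ≫ (β_ A₁ N).hom ▷ A₂ ≫ (α_ _ _ _).hom ≫
          N ◁ (β_ A₁ A₂).hom ≫ (α_ _ _ _).inv)) ⊗≫ M ◁ N ◁ h ⊗≫ 𝟙 _ := by monoidal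
    _ = _ := by rw [n]; monoidal

variable [RightRigidCategory B]

/-- While one family is used for separation the other variable is a parameter. By iteration,
identities on `(A ⊗ A) ⊗ A` can be tested on triple products of coactions. -/
theorem Separating.tensor {J J' : Type*} {A₁ A₂ : B} {K : J → B} {K' : J' → B}
    {a : ∀ m, K m ⟶ K m ⊗ A₁} {c : ∀ m, K' m ⟶ K' m ⊗ A₂} (ha : Separating a)
    (hc : Separating c) :
    Separating (K := fun m : J × J' => K m.1 ⊗ K' m.2)
      (fun m => (a m.1 ⊗ₘ c m.2) ≫ tensorμ (K m.1) A₁ (K' m.2) A₂) := by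
  intro Z h h' H
  have e : ∀ h : A₁ ⊗ A₂ ⟶ Z, h = (β_ A₁ A₂).hom ≫ ((β_ A₁ A₂).inv ≫ h) := fun h => by simp
  rw [e h, e h']
  congr 1
  refine hc.param fun m' => ?_
  rw [← cancel_epi (β_ A₁ (K' m')).hom]
  refine ha.param fun m => ?_
  rw [← cancel_mono (α_ _ _ _).inv]
  have := H (m, m')
  dsimp only at this
  rw [e h, e h', Category.assoc, Category.assoc, tensorHom_tensorμ_whiskerLeft,
    tensorHom_tensorμ_whiskerLeft] at this
  simpa only [Category.assoc] using this

variable {A : B} {δ : ∀ X : B, X ⟶ X ⊗ A} (hδ : IsUniversalCoaction δ)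

namespace IsUniversalCoaction

include hδ

/-- For fixed `N` the universal property gives `g N`, which is natural in `N` because the coactions
on `M` separate. It is then applied a second time in `N`. -/
theorem exists_tensor {Z : B} (t : ∀ M N : B, M ⊗ N ⟶ (M ⊗ N) ⊗ Z)
    (ht₁ : ∀ {M M' : B} (f : M ⟶ M') (N : B), f ▷ N ≫ t M' N = t M N ≫ (f ▷ N) ▷ Z)
    (ht₂ : ∀ (M : B) {N N' : B} (f : N ⟶ N'), M ◁ f ≫ t M N' = t M N ≫ (M ◁ f) ▷ Z) :
    ∃ h : A ⊗ A ⟶ Z, ∀ M N, (δ M ⊗ₘ δ N) ≫ tensorμ M A N A ≫ (M ⊗ N) ◁ h = t M N := by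
  have h1 : ∀ N, ∃ g : A ⊗ N ⟶ N ⊗ Z, ∀ M, δ M ▷ N ≫ (α_ _ _ _).hom ≫ M ◁ g =
      t M N ≫ (α_ _ _ _).hom := fun N =>
    hδ.exists_param (fun M => t M N ≫ (α_ _ _ _).hom) fun f => by
      rw [← Category.assoc, ht₁]; simp
  choose g hg using h1
  have gn : ∀ {N N' : B} (f : N ⟶ N'), A ◁ f ≫ g N' = g N ≫ f ▷ Z := by
    intro N N' f
    refine Separating.param hδ.separating fun M => ?_
    calc
      _ = (δ M ▷ N ≫ (M ⊗ A) ◁ f) ⊗≫ M ◁ g N' := by monoidal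
      _ = M ◁ f ≫ (δ M ▷ N' ≫ (α_ _ _ _).hom ≫ M ◁ g N') := by
        rw [← whisker_exchange]; monoidal
      _ = (M ◁ f ≫ t M N') ⊗≫ 𝟙 _ := by rw [hg]; monoidal
      _ = (t M N ≫ (α_ _ _ _).hom) ≫ M ◁ f ▷ Z := by rw [ht₂]; monoidal
      _ = _ := by rw [← hg]; simp
  -- The inverse braiding cancels the braiding `β_ A N` that `tensorHom_tensorμ_whiskerLeft`
  -- introduces.
  obtain ⟨h, hh⟩ := hδ.exists_param (P := A) (Z := Z) (fun N => (β_ A N).inv ≫ g N) (by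
    intro N N' f
    rw [BraidedCategory.braiding_inv_naturality_left_assoc, gn, Category.assoc])
  refine ⟨(β_ A A).hom ≫ h, fun M N => ?_⟩
  rw [tensorHom_tensorμ_whiskerLeft, hh, Iso.hom_inv_id_assoc, ← Category.assoc (α_ _ _ _).hom,
    ← Category.assoc (δ M ▷ N), hg]
  simp

end IsUniversalCoaction

end Hopf


/-! ### Structure morphisms and bialgebra axioms -/

section Hopf

variable {B : Type u} [Category.{v} B] [MonoidalCategory B] [BraidedCategory B]
  [RightRigidCategory B] {A : B} {δ : ∀ X : B, X ⟶ X ⊗ A} (hδ : IsUniversalCoaction δ)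

/-- The composite `X ⟶ X ⊗ Xᘁ ⊗ X ⟶ X ⊗ Xᘁ ⊗ A ⊗ X ⟶ X ⊗ Xᘁ ⊗ X ⊗ A ⟶ X ⊗ A`, whose middle maps
are the coaction of the dual and a braiding. -/
def antiCoact (δ : ∀ X : B, X ⟶ X ⊗ A) (X : B) : X ⟶ X ⊗ A :=
  𝟙 _ ⊗≫ η_ X (rdual X) ▷ X ⊗≫ X ◁ δ (rdual X) ▷ X ⊗≫ X ◁ rdual X ◁ (β_ A X).hom ⊗≫
    X ◁ ε_ X (rdual X) ▷ A ⊗≫ 𝟙 _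

namespace IsUniversalCoaction

include hδ

/-- The morphism `f` is carried through the coevaluation, coaction, and braiding to the evaluation.
There it becomes its mate on the dual, which passes back through the coaction of the dual and leaves
as `f` through the coevaluation. -/
theorem antiCoact_naturality {X Y : B} (f : X ⟶ Y) :
    f ≫ antiCoact δ Y = antiCoact δ X ≫ f ▷ A := by
  have h1 := coevaluation_comp_rightAdjointMate f
  have h2 := rightAdjointMate_comp_evaluation f
  have h3 := hδ.naturality (rightAdjointMate f)
  have h4 := BraidedCategory.braiding_naturality_right A f
  dsimp only [antiCoact]
  calc
    _ = 𝟙 _ ⊗≫ (𝟙_ B ◁ f ≫ η_ Y (rdual Y) ▷ Y) ⊗≫ Y ◁ δ (rdual Y) ▷ Y ⊗≫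
        Y ◁ rdual Y ◁ (β_ A Y).hom ⊗≫ Y ◁ ε_ Y (rdual Y) ▷ A ⊗≫ 𝟙 _ := by monoidal
    _ = 𝟙 _ ⊗≫ η_ Y (rdual Y) ▷ X ⊗≫ Y ◁ (rdual Y ◁ f ≫ δ (rdual Y) ▷ Y) ⊗≫
        Y ◁ rdual Y ◁ (β_ A Y).hom ⊗≫ Y ◁ ε_ Y (rdual Y) ▷ A ⊗≫ 𝟙 _ := by
      rw [whisker_exchange]; monoidal
    _ = 𝟙 _ ⊗≫ η_ Y (rdual Y) ▷ X ⊗≫ Y ◁ δ (rdual Y) ▷ X ⊗≫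
        Y ◁ rdual Y ◁ (A ◁ f ≫ (β_ A Y).hom) ⊗≫ Y ◁ ε_ Y (rdual Y) ▷ A ⊗≫ 𝟙 _ := by
      rw [whisker_exchange]; monoidal
    _ = 𝟙 _ ⊗≫ η_ Y (rdual Y) ▷ X ⊗≫ Y ◁ δ (rdual Y) ▷ X ⊗≫
        Y ◁ rdual Y ◁ (β_ A X).hom ⊗≫ Y ◁ (rdual Y ◁ f ≫ ε_ Y (rdual Y)) ▷ A ⊗≫ 𝟙 _ := by
      rw [h4]; monoidal
    _ = 𝟙 _ ⊗≫ η_ Y (rdual Y) ▷ X ⊗≫ Y ◁ δ (rdual Y) ▷ X ⊗≫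
        Y ◁ (rdual Y ◁ (β_ A X).hom ≫ rightAdjointMate f ▷ (X ⊗ A)) ⊗≫
        Y ◁ ε_ X (rdual X) ▷ A ⊗≫ 𝟙 _ := by
      rw [← h2]; monoidal
    _ = 𝟙 _ ⊗≫ η_ Y (rdual Y) ▷ X ⊗≫ Y ◁ (δ (rdual Y) ≫ rightAdjointMate f ▷ A) ▷ X ⊗≫
        Y ◁ rdual X ◁ (β_ A X).hom ⊗≫ Y ◁ ε_ X (rdual X) ▷ A ⊗≫ 𝟙 _ := by
      rw [whisker_exchange]; monoidal
    _ = 𝟙 _ ⊗≫ (η_ Y (rdual Y) ≫ Y ◁ rightAdjointMate f) ▷ X ⊗≫ Y ◁ δ (rdual X) ▷ X ⊗≫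
        Y ◁ rdual X ◁ (β_ A X).hom ⊗≫ Y ◁ ε_ X (rdual X) ▷ A ⊗≫ 𝟙 _ := by
      rw [← h3]; monoidal
    _ = 𝟙 _ ⊗≫ η_ X (rdual X) ▷ X ⊗≫ (f ▷ (rdual X ⊗ X) ≫ Y ◁ (δ (rdual X) ▷ X ⊗≫
        rdual X ◁ (β_ A X).hom ⊗≫ ε_ X (rdual X) ▷ A)) ⊗≫ 𝟙 _ := by
      rw [h1]; monoidal
    _ = _ := by rw [← whisker_exchange]; monoidal

theorem exists_comul : ∃ h : A ⟶ A ⊗ A, ∀ X, δ X ≫ X ◁ h = δ X ≫ δ X ▷ A ≫ (α_ _ _ _).hom :=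
  (hδ.existsUnique (fun X => δ X ≫ δ X ▷ A ≫ (α_ _ _ _).hom) fun {X Y} f => by
    have := hδ.naturality f
    rw [reassoc_of% this, ← comp_whiskerRight_assoc, this]; simp).exists

theorem exists_counit : ∃ h : A ⟶ 𝟙_ B, ∀ X, δ X ≫ X ◁ h = (ρ_ X).inv :=
  (hδ.existsUnique (fun X => (ρ_ X).inv) fun {X Y} f => by simp).exists

theorem exists_antipode : ∃ h : A ⟶ A, ∀ X, δ X ≫ X ◁ h = antiCoact δ X :=
  (hδ.existsUnique (fun X => antiCoact δ X) fun f => hδ.antiCoact_naturality f).exists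

theorem exists_mul : ∃ h : A ⊗ A ⟶ A, ∀ M N, (δ M ⊗ₘ δ N) ≫ tensorμ M A N A ≫ (M ⊗ N) ◁ h =
    δ (M ⊗ N) :=
  hδ.exists_tensor (fun M N => δ (M ⊗ N)) (fun f N => hδ.naturality (f ▷ N))
    (fun M _ _ f => hδ.naturality (M ◁ f))

/-- The comultiplication of the coend. -/
def comul : A ⟶ A ⊗ A := hδ.exists_comul.choose

/-- The counit of the coend. -/
def counit : A ⟶ 𝟙_ B := hδ.exists_counit.choose

/-- The antipode of the coend. -/
def antipode : A ⟶ A := hδ.exists_antipode.choose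

/-- The multiplication of the coend. -/
def mul : A ⊗ A ⟶ A := hδ.exists_mul.choose

omit hδ in
/-- The unit of the coend. -/
def one (_ : IsUniversalCoaction δ) : 𝟙_ B ⟶ A := δ (𝟙_ B) ≫ (λ_ A).hom

theorem coact_comul (X : B) : δ X ≫ X ◁ hδ.comul = δ X ≫ δ X ▷ A ≫ (α_ _ _ _).hom :=
  hδ.exists_comul.choose_spec X

theorem coact_counit (X : B) : δ X ≫ X ◁ hδ.counit = (ρ_ X).inv :=
  hδ.exists_counit.choose_spec X

theorem coact_antipode (X : B) : δ X ≫ X ◁ hδ.antipode = antiCoact δ X :=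
  hδ.exists_antipode.choose_spec X

theorem coact_mul (M N : B) : (δ M ⊗ₘ δ N) ≫ tensorμ M A N A ≫ (M ⊗ N) ◁ hδ.mul = δ (M ⊗ N) :=
  hδ.exists_mul.choose_spec M N

theorem coact_unit : δ (𝟙_ B) = hδ.one ≫ (λ_ A).inv := by simp [one]

theorem coact_mul' (M N : B) : 𝟙 _ ⊗≫ δ M ▷ N ⊗≫ M ◁ A ◁ δ N ⊗≫ M ◁ (β_ A N).hom ▷ A ⊗≫
    (M ⊗ N) ◁ hδ.mul = δ (M ⊗ N) := by
  rw [← hδ.coact_mul, MonoidalCategory.tensorHom_def]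
  dsimp only [tensorμ]
  monoidal

theorem counit_comul : hδ.comul ≫ hδ.counit ▷ A = (λ_ A).inv := by
  refine hδ.separating fun X => ?_
  have h1 := hδ.coact_comul X
  have h2 := hδ.coact_counit X
  calc
    _ = (δ X ≫ X ◁ hδ.comul) ≫ X ◁ hδ.counit ▷ A := by simp
    _ = δ X ≫ (δ X ≫ X ◁ hδ.counit) ▷ A ⊗≫ 𝟙 _ := by rw [h1]; monoidal
    _ = _ := by rw [h2]; monoidal

theorem comul_counit : hδ.comul ≫ A ◁ hδ.counit = (ρ_ A).inv := by
  refine hδ.separating fun X => ?_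
  have h1 := hδ.coact_comul X
  have h2 := hδ.coact_counit X
  calc
    _ = (δ X ≫ X ◁ hδ.comul) ≫ X ◁ A ◁ hδ.counit := by simp
    _ = δ X ≫ (δ X ▷ A ≫ (X ⊗ A) ◁ hδ.counit) ⊗≫ 𝟙 _ := by rw [h1]; monoidal
    _ = (δ X ≫ X ◁ hδ.counit) ≫ δ X ▷ 𝟙_ B ⊗≫ 𝟙 _ := by rw [← whisker_exchange]; monoidal
    _ = _ := by rw [h2]; monoidal

theorem comul_assoc : hδ.comul ≫ A ◁ hδ.comul = hδ.comul ≫ hδ.comul ▷ A ≫ (α_ A A A).hom := by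
  refine hδ.separating fun X => ?_
  have h1 := hδ.coact_comul X
  calc
    _ = (δ X ≫ X ◁ hδ.comul) ≫ X ◁ A ◁ hδ.comul := by simp
    _ = δ X ≫ (δ X ▷ A ≫ (X ⊗ A) ◁ hδ.comul) ⊗≫ 𝟙 _ := by rw [h1]; monoidal
    _ = (δ X ≫ X ◁ hδ.comul) ≫ δ X ▷ (A ⊗ A) ⊗≫ 𝟙 _ := by rw [← whisker_exchange]; monoidal
    _ = δ X ≫ (δ X ≫ δ X ▷ A ≫ (α_ _ _ _).hom) ▷ A ⊗≫ 𝟙 _ := by rw [h1]; monoidal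
    _ = δ X ≫ (δ X ≫ X ◁ hδ.comul) ▷ A ⊗≫ 𝟙 _ := by rw [h1]
    _ = (δ X ≫ δ X ▷ A ≫ (α_ _ _ _).hom) ⊗≫ X ◁ hδ.comul ▷ A ⊗≫ 𝟙 _ := by monoidal
    _ = _ := by rw [← h1]; monoidal

theorem one_mul : hδ.one ▷ A ≫ hδ.mul = (λ_ A).hom := by
  rw [← cancel_epi (λ_ A).inv]
  refine hδ.separating fun X => ?_
  have h1 := hδ.coact_mul' (𝟙_ B) X
  have h2 := hδ.naturality (λ_ X).hom
  have h3 := hδ.coact_unit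
  have h4 := BraidedCategory.braiding_naturality_left hδ.one X
  rw [braiding_tensorUnit_left] at h4
  calc
    _ = 𝟙 _ ⊗≫ δ X ⊗≫ (((λ_ X).hom ≫ (ρ_ X).inv) ≫ X ◁ hδ.one) ▷ A ⊗≫ X ◁ hδ.mul := by monoidal
    _ = 𝟙 _ ⊗≫ ((𝟙_ B) ◁ δ X ≫ hδ.one ▷ (X ⊗ A)) ⊗≫ (β_ A X).hom ▷ A ⊗≫ X ◁ hδ.mul := by
      rw [← h4]; monoidal
    _ = (λ_ X).inv ≫ (𝟙 _ ⊗≫ (hδ.one ≫ (λ_ A).inv) ▷ X ⊗≫ 𝟙_ B ◁ A ◁ δ X ⊗≫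
        𝟙_ B ◁ (β_ A X).hom ▷ A ⊗≫ (𝟙_ B ⊗ X) ◁ hδ.mul) ≫ (λ_ X).hom ▷ A := by
      rw [whisker_exchange]; monoidal
    _ = (λ_ X).inv ≫ δ (𝟙_ B ⊗ X) ≫ (λ_ X).hom ▷ A := by
      rw [← h1, h3]; monoidal
    _ = _ := by rw [← h2]; simp

theorem mul_one : A ◁ hδ.one ≫ hδ.mul = (ρ_ A).hom := by
  rw [← cancel_epi (ρ_ A).inv]
  refine hδ.separating fun X => ?_
  have h1 := hδ.coact_mul' X (𝟙_ B)
  have h2 := hδ.naturality (ρ_ X).hom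
  have h3 := hδ.coact_unit
  rw [braiding_tensorUnit_right] at h1
  calc
    _ = (ρ_ X).inv ≫ (𝟙 _ ⊗≫ δ X ▷ 𝟙_ B ⊗≫ X ◁ A ◁ (hδ.one ≫ (λ_ A).inv) ⊗≫
        X ◁ ((ρ_ A).hom ≫ (λ_ A).inv) ▷ A ⊗≫ (X ⊗ 𝟙_ B) ◁ hδ.mul) ≫ (ρ_ X).hom ▷ A := by
      monoidal
    _ = (ρ_ X).inv ≫ δ (X ⊗ 𝟙_ B) ≫ (ρ_ X).hom ▷ A := by
      rw [← h1, h3]; monoidal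
    _ = _ := by rw [← h2]; simp

theorem coact_tensor_natural {M N A₁ A₂ A₁' A₂' : B} (a : M ⟶ M ⊗ A₁) (c : N ⟶ N ⊗ A₂)
    (f : A₁ ⟶ A₁') (g : A₂ ⟶ A₂') : (a ⊗ₘ c) ≫ tensorμ M A₁ N A₂ ≫ (M ⊗ N) ◁ (f ⊗ₘ g) =
      ((a ≫ M ◁ f) ⊗ₘ (c ≫ N ◁ g)) ≫ tensorμ M A₁' N A₂' := by
  have := tensorμ_natural (𝟙 M) f (𝟙 N) g
  simp only [id_tensorHom, MonoidalCategory.whiskerLeft_id] at this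
  rw [← this, MonoidalCategory.tensorHom_comp_tensorHom_assoc]

/-- On a triple product of coactions both sides give the coaction on the triple tensor product, up
to associators. The comparison of the shuffles is `tensor_associativity`. -/
theorem mul_assoc : hδ.mul ▷ A ≫ hδ.mul = (α_ A A A).hom ≫ A ◁ hδ.mul ≫ hδ.mul := by
  refine Separating.tensor (Separating.tensor hδ.separating hδ.separating) hδ.separating ?_
  rintro ⟨⟨M, N⟩, P⟩
  dsimp only
  have h1 : (((δ M ⊗ₘ δ N) ≫ tensorμ M A N A) ⊗ₘ δ P) ≫ tensorμ (M ⊗ N) (A ⊗ A) P A ≫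
      ((M ⊗ N) ⊗ P) ◁ (hδ.mul ▷ A) = (δ (M ⊗ N) ⊗ₘ δ P) ≫ tensorμ (M ⊗ N) A P A := by
    rw [← tensorHom_id, hδ.coact_tensor_natural, Category.assoc, hδ.coact_mul]
    simp
  have h2 : (δ M ⊗ₘ ((δ N ⊗ₘ δ P) ≫ tensorμ N A P A)) ≫ tensorμ M A (N ⊗ P) (A ⊗ A) ≫
      (M ⊗ (N ⊗ P)) ◁ (A ◁ hδ.mul) = (δ M ⊗ₘ δ (N ⊗ P)) ≫ tensorμ M A (N ⊗ P) A := by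
    rw [← id_tensorHom A, hδ.coact_tensor_natural, Category.assoc, hδ.coact_mul]
    simp
  have h3 := tensor_associativity M A N A P A
  have h4 : ((((δ M ⊗ₘ δ N) ≫ tensorμ M A N A) ⊗ₘ δ P) ≫ tensorμ (M ⊗ N) (A ⊗ A) P A) ≫
      ((α_ M N P).hom ⊗ₘ (α_ A A A).hom) = (α_ M N P).hom ≫
        (δ M ⊗ₘ ((δ N ⊗ₘ δ P) ≫ tensorμ N A P A)) ≫ tensorμ M A (N ⊗ P) (A ⊗ A) := by
    calc
      _ = ((δ M ⊗ₘ δ N) ⊗ₘ δ P) ≫ (tensorμ M A N A ▷ (P ⊗ A)) ≫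
        tensorμ (M ⊗ N) (A ⊗ A) P A ≫ ((α_ M N P).hom ⊗ₘ (α_ A A A).hom) := by
          rw [← tensorHom_id, MonoidalCategory.tensorHom_comp_tensorHom_assoc]; simp
      _ = _ := by
          rw [h3, MonoidalCategory.associator_naturality_assoc, ← id_tensorHom,
            MonoidalCategory.tensorHom_comp_tensorHom_assoc]; simp
  rw [← cancel_mono ((α_ M N P).hom ▷ A)]
  calc
    _ = (((((δ M ⊗ₘ δ N) ≫ tensorμ M A N A) ⊗ₘ δ P) ≫ tensorμ (M ⊗ N) (A ⊗ A) P A ≫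
      ((M ⊗ N) ⊗ P) ◁ (hδ.mul ▷ A)) ≫ ((M ⊗ N) ⊗ P) ◁ hδ.mul) ≫ (α_ M N P).hom ▷ A := by simp
    _ = (α_ M N P).hom ≫ δ (M ⊗ N ⊗ P) := by
      rw [h1, Category.assoc (δ (M ⊗ N) ⊗ₘ δ P), hδ.coact_mul, hδ.naturality]
    _ = (α_ M N P).hom ≫ ((δ M ⊗ₘ ((δ N ⊗ₘ δ P) ≫ tensorμ N A P A)) ≫
        tensorμ M A (N ⊗ P) (A ⊗ A) ≫ (M ⊗ (N ⊗ P)) ◁ (A ◁ hδ.mul)) ≫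
          (M ⊗ (N ⊗ P)) ◁ hδ.mul := by
      rw [h2, Category.assoc (δ M ⊗ₘ δ (N ⊗ P)), hδ.coact_mul]
    _ = (((((δ M ⊗ₘ δ N) ≫ tensorμ M A N A) ⊗ₘ δ P) ≫ tensorμ (M ⊗ N) (A ⊗ A) P A) ≫
      ((α_ M N P).hom ⊗ₘ (α_ A A A).hom)) ≫ (M ⊗ (N ⊗ P)) ◁ (A ◁ hδ.mul ≫ hδ.mul) := by
      rw [h4]; simp
    _ = _ := by
      rw [MonoidalCategory.tensorHom_def' (α_ M N P).hom]
      simp only [Category.assoc, MonoidalCategory.whiskerLeft_comp]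
      rw [← whisker_exchange_assoc, ← whisker_exchange]

omit hδ in
theorem comp_whiskerLeft_iterate {X A₁ A₂ : B} (T : X ⟶ X ⊗ A₁) (f : A₁ ⟶ A₂) :
    (T ≫ X ◁ f) ≫ (T ≫ X ◁ f) ▷ A₂ ≫ (α_ _ _ _).hom =
      T ≫ T ▷ A₁ ≫ (α_ _ _ _).hom ≫ X ◁ (f ⊗ₘ f) := by
  rw [MonoidalCategory.tensorHom_def]
  calc
    _ = T ≫ (X ◁ f ≫ T ▷ A₂) ⊗≫ X ◁ f ▷ A₂ ⊗≫ 𝟙 _ := by monoidal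
    _ = T ≫ T ▷ A₁ ⊗≫ X ◁ (A₁ ◁ f ≫ f ▷ A₂) ⊗≫ 𝟙 _ := by rw [whisker_exchange]; monoidal
    _ = _ := by rw [whisker_exchange]; monoidal

/-- Both sides compute the twice iterated coaction on `M ⊗ N`: once as a whole, once factor by
factor. The two shuffles agree by `associator_monoidal`. -/
theorem mul_comul : hδ.mul ≫ hδ.comul =
    (hδ.comul ⊗ₘ hδ.comul) ≫ tensorμ A A A A ≫ (hδ.mul ⊗ₘ hδ.mul) := by
  refine Separating.tensor hδ.separating hδ.separating ?_
  rintro ⟨M, N⟩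
  dsimp only
  have h := associator_monoidal M A A N A A
  have n := tensorμ_natural (δ M) (𝟙 A) (δ N) (𝟙 A)
  simp only [tensorHom_id, MonoidalCategory.id_whiskerRight] at n
  calc
    _ = (((δ M ⊗ₘ δ N) ≫ tensorμ M A N A) ≫ (M ⊗ N) ◁ hδ.mul) ≫ (M ⊗ N) ◁ hδ.comul := by simp
    _ = (((δ M ⊗ₘ δ N) ≫ tensorμ M A N A) ≫ (M ⊗ N) ◁ hδ.mul) ≫
        (((δ M ⊗ₘ δ N) ≫ tensorμ M A N A) ≫ (M ⊗ N) ◁ hδ.mul) ▷ A ≫ (α_ _ _ _).hom := by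
      rw [Category.assoc (δ M ⊗ₘ δ N), hδ.coact_mul, hδ.coact_comul]
    _ = ((δ M ⊗ₘ δ N) ≫ tensorμ M A N A) ≫
        ((δ M ⊗ₘ δ N) ≫ tensorμ M A N A) ▷ (A ⊗ A) ≫ (α_ _ _ _).hom ≫
          (M ⊗ N) ◁ (hδ.mul ⊗ₘ hδ.mul) := comp_whiskerLeft_iterate _ _
    _ = ((δ M ≫ δ M ▷ A) ⊗ₘ (δ N ≫ δ N ▷ A)) ≫ (tensorμ (M ⊗ A) A (N ⊗ A) A ≫
          tensorμ M A N A ▷ (A ⊗ A) ≫ (α_ _ _ _).hom) ≫ (M ⊗ N) ◁ (hδ.mul ⊗ₘ hδ.mul) := by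
      rw [comp_whiskerRight, ← MonoidalCategory.tensorHom_comp_tensorHom]
      simp only [Category.assoc]
      rw [reassoc_of% n]
    _ = ((δ M ≫ M ◁ hδ.comul) ⊗ₘ (δ N ≫ N ◁ hδ.comul)) ≫ tensorμ M (A ⊗ A) N (A ⊗ A) ≫
          (M ⊗ N) ◁ tensorμ A A A A ≫ (M ⊗ N) ◁ (hδ.mul ⊗ₘ hδ.mul) := by
      rw [h, hδ.coact_comul, hδ.coact_comul]
      simp
    _ = _ := by
      rw [← reassoc_of% hδ.coact_tensor_natural]
      simp

end IsUniversalCoaction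
end Hopf


/-! ### Unit, counit and antipode axioms; the Hopf algebra -/

section Hopf

variable {B : Type u} [Category.{v} B] [MonoidalCategory B] [BraidedCategory B]
  [RightRigidCategory B] {A : B} {δ : ∀ X : B, X ⟶ X ⊗ A} (hδ : IsUniversalCoaction δ)

namespace IsUniversalCoaction

include hδ

theorem one_comul : hδ.one ≫ hδ.comul = (λ_ (𝟙_ B)).inv ≫ (hδ.one ⊗ₘ hδ.one) := by
  have h1 := hδ.coact_comul (𝟙_ B)
  rw [hδ.coact_unit] at h1
  rw [MonoidalCategory.tensorHom_def]
  calc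
    _ = ((hδ.one ≫ (λ_ A).inv) ≫ 𝟙_ B ◁ hδ.comul) ≫ (λ_ _).hom := by simp
    _ = 𝟙 _ ⊗≫ (𝟙_ B ◁ hδ.one ≫ hδ.one ▷ A) ⊗≫ 𝟙 _ := by rw [h1]; monoidal
    _ = _ := by rw [whisker_exchange]; monoidal

theorem one_counit : hδ.one ≫ hδ.counit = 𝟙 (𝟙_ B) := by
  have h1 := hδ.coact_counit (𝟙_ B)
  rw [hδ.coact_unit] at h1
  calc
    _ = ((hδ.one ≫ (λ_ A).inv) ≫ 𝟙_ B ◁ hδ.counit) ≫ (λ_ _).hom := by simp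
    _ = _ := by rw [h1]; monoidal

theorem mul_counit : hδ.mul ≫ hδ.counit = (hδ.counit ⊗ₘ hδ.counit) ≫ (λ_ (𝟙_ B)).hom := by
  refine Separating.tensor hδ.separating hδ.separating ?_
  rintro ⟨M, N⟩
  dsimp only
  have n : tensorμ M (𝟙_ B) N (𝟙_ B) = ((ρ_ M).hom ⊗ₘ (ρ_ N).hom) ≫ (ρ_ (M ⊗ N)).inv ≫
      (M ⊗ N) ◁ (λ_ (𝟙_ B)).inv := by
    rw [rightUnitor_monoidal]; simp
  calc
    _ = ((δ M ⊗ₘ δ N) ≫ tensorμ M A N A ≫ (M ⊗ N) ◁ hδ.mul) ≫ (M ⊗ N) ◁ hδ.counit := by simp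
    _ = (((δ M ≫ M ◁ hδ.counit) ⊗ₘ (δ N ≫ N ◁ hδ.counit)) ≫ tensorμ M (𝟙_ B) N (𝟙_ B)) ≫
        (M ⊗ N) ◁ (λ_ (𝟙_ B)).hom := by
      rw [hδ.coact_mul, hδ.coact_counit, hδ.coact_counit, hδ.coact_counit, n]
      rw [← Category.assoc, MonoidalCategory.tensorHom_comp_tensorHom]
      simp
    _ = _ := by rw [← hδ.coact_tensor_natural]; simp

/-- Since the antipode is the coaction of the dual, a zigzag around the coaction on `Mᘁ ⊗ M`
appears. Naturality along the evaluation reduces it to the coaction on the unit object. -/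
theorem antipode_left : hδ.comul ≫ hδ.antipode ▷ A ≫ hδ.mul = hδ.counit ≫ hδ.one := by
  refine hδ.separating fun M => ?_
  have h1 := hδ.coact_comul M
  have h2 := hδ.coact_counit M
  have h3 := hδ.coact_antipode M
  have h4 := hδ.coact_mul' (rdual M) M
  have h5 := hδ.naturality (ε_ M (rdual M))
  rw [hδ.coact_unit] at h5
  calc
    _ = (δ M ≫ M ◁ hδ.comul) ≫ M ◁ (hδ.antipode ▷ A ≫ hδ.mul) := by simp
    _ = δ M ≫ (δ M ≫ M ◁ hδ.antipode) ▷ A ⊗≫ M ◁ hδ.mul := by rw [h1]; monoidal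
    _ = 𝟙 _ ⊗≫ (𝟙_ B ◁ δ M ≫ η_ M (rdual M) ▷ (M ⊗ A)) ⊗≫ M ◁ δ (rdual M) ▷ M ▷ A ⊗≫
        M ◁ rdual M ◁ (β_ A M).hom ▷ A ⊗≫ (M ◁ (ε_ M (rdual M) ▷ (A ⊗ A) ≫ 𝟙_ B ◁ hδ.mul)) ⊗≫
          𝟙 _ := by
      rw [h3, antiCoact]; monoidal
    _ = 𝟙 _ ⊗≫ η_ M (rdual M) ▷ M ⊗≫ M ◁ (rdual M ◁ δ M ≫ δ (rdual M) ▷ (M ⊗ A)) ⊗≫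
        M ◁ rdual M ◁ (β_ A M).hom ▷ A ⊗≫ M ◁ (rdual M ⊗ M) ◁ hδ.mul ⊗≫
          M ◁ ε_ M (rdual M) ▷ A ⊗≫ 𝟙 _ := by
      rw [whisker_exchange, ← whisker_exchange (ε_ M (rdual M)) hδ.mul]; monoidal
    _ = 𝟙 _ ⊗≫ η_ M (rdual M) ▷ M ⊗≫ M ◁ (𝟙 (rdual M ⊗ M) ⊗≫ δ (rdual M) ▷ M ⊗≫ rdual M ◁ A ◁ δ M ⊗≫
        rdual M ◁ (β_ A M).hom ▷ A ⊗≫ (rdual M ⊗ M) ◁ hδ.mul) ⊗≫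
          M ◁ ε_ M (rdual M) ▷ A ⊗≫ 𝟙 _ := by
      rw [whisker_exchange]; monoidal
    _ = 𝟙 _ ⊗≫ η_ M (rdual M) ▷ M ⊗≫ M ◁ (δ (rdual M ⊗ M) ≫ ε_ M (rdual M) ▷ A) ⊗≫ 𝟙 _ := by
      rw [h4]; monoidal
    _ = 𝟙 _ ⊗≫ (η_ M (rdual M) ▷ M ⊗≫ M ◁ ε_ M (rdual M)) ⊗≫ M ◁ hδ.one := by
      rw [← h5]; monoidal
    _ = (ρ_ M).inv ≫ M ◁ hδ.one := by
      rw [ExactPairing.evaluation_coevaluation'']; monoidal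
    _ = _ := by rw [← h2]; simp

/-- The same with the coaction on `M ⊗ Mᘁ` and naturality along the coevaluation. The evaluation
must first be pulled across the coend (`h6`), and the multiplication moved in front of the crossing
with `M` (`h7`). -/
theorem antipode_right : hδ.comul ≫ A ◁ hδ.antipode ≫ hδ.mul = hδ.counit ≫ hδ.one := by
  refine hδ.separating fun M => ?_
  have h1 := hδ.coact_comul M
  have h2 := hδ.coact_counit M
  have h3 := hδ.coact_antipode M
  have h4 := hδ.coact_mul' M (rdual M)
  have h5 := hδ.naturality (η_ M (rdual M))
  have h6 := BraidedCategory.braiding_naturality_right A (ε_ M (rdual M))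
  have h7 := BraidedCategory.braiding_naturality_left hδ.mul M
  have h8 := BraidedCategory.braiding_naturality_left hδ.one M
  rw [braiding_tensorUnit_right, BraidedCategory.braiding_tensor_right_hom] at h6
  rw [BraidedCategory.braiding_tensor_left_hom] at h7
  rw [braiding_tensorUnit_left] at h8
  rw [hδ.coact_unit] at h5
  calc
    _ = (δ M ≫ M ◁ hδ.comul) ≫ M ◁ (A ◁ hδ.antipode ≫ hδ.mul) := by simp
    _ = δ M ≫ (δ M ▷ A ≫ (M ⊗ A) ◁ hδ.antipode) ⊗≫ M ◁ hδ.mul := by rw [h1]; monoidal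
    _ = (δ M ≫ M ◁ hδ.antipode) ≫ δ M ▷ A ⊗≫ M ◁ hδ.mul := by
      rw [← whisker_exchange]; monoidal
    _ = 𝟙 _ ⊗≫ η_ M (rdual M) ▷ M ⊗≫ M ◁ δ (rdual M) ▷ M ⊗≫
        (M ◁ (rdual M ◁ (β_ A M).hom ⊗≫ ε_ M (rdual M) ▷ A ⊗≫ 𝟙 A) ≫ δ M ▷ A) ⊗≫
          M ◁ hδ.mul := by
      rw [h3, antiCoact]; monoidal
    _ = 𝟙 _ ⊗≫ η_ M (rdual M) ▷ M ⊗≫ (M ◁ δ (rdual M) ▷ M ≫ δ M ▷ ((rdual M ⊗ A) ⊗ M)) ⊗≫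
        M ◁ A ◁ rdual M ◁ (β_ A M).hom ⊗≫
          M ◁ (A ◁ ε_ M (rdual M) ≫ (ρ_ A).hom ≫ (λ_ A).inv) ▷ A ⊗≫ M ◁ hδ.mul := by
      rw [whisker_exchange]; monoidal
    _ = 𝟙 _ ⊗≫ η_ M (rdual M) ▷ M ⊗≫ δ M ▷ (rdual M ⊗ M) ⊗≫ M ◁ A ◁ δ (rdual M) ▷ M ⊗≫
        M ◁ (A ◁ rdual M ◁ (β_ A M).hom ⊗≫ (β_ A (rdual M)).hom ▷ (M ⊗ A)) ⊗≫
        M ◁ rdual M ◁ (β_ A M).hom ▷ A ⊗≫ M ◁ (ε_ M (rdual M) ▷ (A ⊗ A) ≫ 𝟙_ B ◁ hδ.mul) ⊗≫ 𝟙 _ := by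
      rw [whisker_exchange, h6]; monoidal
    _ = 𝟙 _ ⊗≫ η_ M (rdual M) ▷ M ⊗≫ δ M ▷ (rdual M ⊗ M) ⊗≫ M ◁ A ◁ δ (rdual M) ▷ M ⊗≫
        M ◁ ((A ⊗ rdual M) ◁ (β_ A M).hom ≫ (β_ A (rdual M)).hom ▷ (M ⊗ A)) ⊗≫
        M ◁ rdual M ◁ (β_ A M).hom ▷ A ⊗≫ M ◁ (rdual M ⊗ M) ◁ hδ.mul ⊗≫
          M ◁ ε_ M (rdual M) ▷ A ⊗≫ 𝟙 _ := by
      rw [← whisker_exchange (ε_ M (rdual M)) hδ.mul]; monoidal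
    _ = 𝟙 _ ⊗≫ η_ M (rdual M) ▷ M ⊗≫ δ M ▷ (rdual M ⊗ M) ⊗≫ M ◁ A ◁ δ (rdual M) ▷ M ⊗≫
        M ◁ (β_ A (rdual M)).hom ▷ A ▷ M ⊗≫ M ◁ rdual M ◁ ((α_ A A M).hom ≫ A ◁ (β_ A M).hom ≫
          (α_ _ _ _).inv ≫ (β_ A M).hom ▷ A ≫ (α_ _ _ _).hom) ⊗≫ M ◁ rdual M ◁ M ◁ hδ.mul ⊗≫
          M ◁ ε_ M (rdual M) ▷ A ⊗≫ 𝟙 _ := by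
      rw [whisker_exchange]; monoidal
    _ = 𝟙 _ ⊗≫ η_ M (rdual M) ▷ M ⊗≫ (𝟙 (M ⊗ rdual M) ⊗≫ δ M ▷ (rdual M) ⊗≫ M ◁ A ◁ δ (rdual M) ⊗≫
        M ◁ (β_ A (rdual M)).hom ▷ A ⊗≫ (M ⊗ rdual M) ◁ hδ.mul) ▷ M ⊗≫
          M ◁ rdual M ◁ (β_ A M).hom ⊗≫ M ◁ ε_ M (rdual M) ▷ A ⊗≫ 𝟙 _ := by
      calc
        _ = 𝟙 _ ⊗≫ η_ M (rdual M) ▷ M ⊗≫ δ M ▷ (rdual M ⊗ M) ⊗≫ M ◁ A ◁ δ (rdual M) ▷ M ⊗≫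
          M ◁ (β_ A (rdual M)).hom ▷ A ▷ M ⊗≫ M ◁ rdual M ◁ (((α_ A A M).hom ≫ A ◁ (β_ A M).hom ≫
          (α_ _ _ _).inv ≫ (β_ A M).hom ▷ A ≫ (α_ _ _ _).hom) ≫ M ◁ hδ.mul) ⊗≫
          M ◁ ε_ M (rdual M) ▷ A ⊗≫ 𝟙 _ := by monoidal
        _ = _ := by rw [← h7]; monoidal
    _ = 𝟙 _ ⊗≫ (η_ M (rdual M) ≫ δ (M ⊗ rdual M)) ▷ M ⊗≫
          M ◁ rdual M ◁ (β_ A M).hom ⊗≫ M ◁ ε_ M (rdual M) ▷ A ⊗≫ 𝟙 _ := by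
      rw [h4]; monoidal
    _ = 𝟙 _ ⊗≫ ((hδ.one ≫ (λ_ A).inv) ≫ η_ M (rdual M) ▷ A) ▷ M ⊗≫
          M ◁ rdual M ◁ (β_ A M).hom ⊗≫ M ◁ ε_ M (rdual M) ▷ A ⊗≫ 𝟙 _ := by
      rw [h5]
    _ = 𝟙 _ ⊗≫ (hδ.one ▷ M ≫ (β_ A M).hom) ⊗≫
          (η_ M (rdual M) ▷ M ⊗≫ M ◁ ε_ M (rdual M)) ▷ A ⊗≫ 𝟙 _ := by
      calc
        _ = 𝟙 _ ⊗≫ hδ.one ▷ M ⊗≫ (η_ M (rdual M) ▷ (A ⊗ M) ≫ (M ⊗ rdual M) ◁ (β_ A M).hom) ⊗≫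
          M ◁ ε_ M (rdual M) ▷ A ⊗≫ 𝟙 _ := by monoidal
        _ = _ := by rw [← whisker_exchange]; monoidal
    _ = (ρ_ M).inv ≫ M ◁ hδ.one := by
      rw [ExactPairing.evaluation_coevaluation'', h8]; monoidal
    _ = _ := by rw [← h2]; simp

/-- The Hopf algebra structure of the coend. -/
@[reducible]
def hopfObj : HopfObj A where
  one := hδ.one
  mul := hδ.mul
  one_mul := hδ.one_mul
  mul_one := hδ.mul_one
  mul_assoc := hδ.mul_assoc
  counit := hδ.counit
  comul := hδ.comul
  counit_comul := hδ.counit_comul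
  comul_counit := hδ.comul_counit
  comul_assoc := hδ.comul_assoc
  mul_comul := hδ.mul_comul
  one_comul := hδ.one_comul
  mul_counit := hδ.mul_counit
  one_counit := hδ.one_counit
  antipode := hδ.antipode
  antipode_left := hδ.antipode_left
  antipode_right := hδ.antipode_right

theorem mul_antipode : hδ.mul ≫ hδ.antipode =
    (hδ.antipode ⊗ₘ hδ.antipode) ≫ (β_ A A).hom ≫ hδ.mul :=
  letI := hδ.hopfObj
  HopfObj.mul_antipode A

theorem isCoendHopf : IsCoendHopf (coendFam δ) hδ.hopfObj where
  comul X := by rw [coaction_coendFam]; exact hδ.coact_comul X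
  counit X := by rw [coaction_coendFam]; exact hδ.coact_counit X
  mul X Y := by simp only [coaction_coendFam]; exact hδ.coact_mul X Y
  one := by rw [coaction_coendFam]; rfl

end IsUniversalCoaction
end Hopf


/-! ### The coend of the center of a fusion category -/

namespace FusionStructure

variable {k : Type*} [CommRing k] {C : Type u} [Category.{v} C] [Preadditive C] [Linear k C]
  [MonoidalCategory C] [MonoidalPreadditive C] [MonoidalLinear k C] [HasFiniteBiproducts C]
  [RigidCategory C] {I : Type w} [Fintype I] (D : FusionStructure k C I)

theorem isUniversalCoaction_coactC : IsUniversalCoaction D.coactC where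
  naturality := D.coactC_naturality
  existsUnique {Z} t ht := D.isUniversal_coactCNat.existsUnique (X := Z)
    { app := t, naturality := fun _ _ f => ht f }

/-- `coact_eq` expands the coaction along `d`, and the factor acting on `M` becomes its mate on `Mᘁ`
by `tensorLeftHomEquiv_symm_mate`. The left side does not involve `d`, so `coendι` is independent of
the decomposition. -/
theorem tensorLeftHomEquiv_symm_coact {M : C} (b : HalfBraiding M) (d : Decomposition D.V M) :
    (tensorLeftHomEquiv M M (rdual M) D.coendObj).symm (D.coact b) = D.coendι ⟨M, b⟩ d := by
  have hadd : ∀ {J : Type w} [Fintype J] (g : J → (M ⟶ M ⊗ D.coendObj)),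
      (tensorLeftHomEquiv M M (rdual M) D.coendObj).symm (∑ i, g i) =
        ∑ i, (tensorLeftHomEquiv M M (rdual M) D.coendObj).symm (g i) := by
    intro J _ g
    simp [tensorLeftHomEquiv, Preadditive.sum_comp, whiskerLeft_sum]
  have hadd' : ∀ {n : ℕ} (g : Fin n → (M ⟶ M ⊗ D.coendObj)),
      (tensorLeftHomEquiv M M (rdual M) D.coendObj).symm (∑ i, g i) =
        ∑ i, (tensorLeftHomEquiv M M (rdual M) D.coendObj).symm (g i) := by
    intro J g
    simp [tensorLeftHomEquiv, Preadditive.sum_comp, whiskerLeft_sum]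
  change _ = ∑ i : I, ∑ a : Fin d.n, ((rightAdjointMate ((rdual (D.V i) ◁ d.q a ▷ D.V i) ≫
    rdual (D.V i) ◁ (b.β (D.V i)).hom ≫ (α_ _ _ _).inv ≫ ε_ (D.V i) (rdual (D.V i)) ▷ M ≫
      (λ_ M).hom) ≫ (dualTripleIso (rdual (D.V i)) (D.V (d.s a)) (D.V i)).hom) ⊗ₘ d.p a) ≫
        (α_ _ _ _).hom ≫ rdual (D.V i) ◁ (α_ _ _ _).hom ≫ D.summandι i (d.s a)
  rw [D.coact_eq b d, hadd', Finset.sum_comm]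
  refine Eq.trans (Finset.sum_congr rfl fun a _ => hadd _) ?_
  refine Finset.sum_congr rfl fun a _ => Finset.sum_congr rfl fun i _ => ?_
  have e : ∀ g : D.V (d.s a) ⟶ M ⊗ D.coendObj,
      (tensorLeftHomEquiv M M (rdual M) D.coendObj).symm (d.p a ≫ g) =
      rdual M ◁ d.p a ≫ (tensorLeftHomEquiv (D.V (d.s a)) M (rdual M) D.coendObj).symm g := by
    intro g
    simp [tensorLeftHomEquiv]
  rw [e, tensorLeftHomEquiv_symm_mate, MonoidalCategory.tensorHom_def']
  dsimp only [coendIn, summandIso]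
  simp only [Iso.trans_hom, whiskerRightIso_hom, whiskerLeftIso_hom, comp_whiskerRight,
    Category.assoc]

theorem coendFam_coactC (M : Center C) (d : Decomposition D.V M.1) :
    (coendFam D.coactC M).f = D.coendι M d := by
  have h : coendFam D.coactC M = rdual M ◁ D.coactC M ≫ (α_ _ _ _).inv ≫
      ε_ M (rdual M) ▷ D.coendC ≫ (λ_ _).hom := rfl
  have h' : (tensorLeftHomEquiv M.1 M.1 (rdual M.1) D.coendObj).symm (D.coact M.2) =
      rdual M.1 ◁ D.coact M.2 ≫ (α_ _ _ _).inv ≫ ε_ M.1 (rdual M.1) ▷ D.coendObj ≫ (λ_ _).hom := rfl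
  refine Eq.trans ?_ (D.tensorLeftHomEquiv_symm_coact M.2 d)
  rw [h, h']
  simp only [Center.comp_f, Center.whiskerLeft_f, Center.whiskerRight_f,
      Center.associator_inv_f, Center.leftUnitor_hom_f]
  rfl

end FusionStructure


/-! ### Pivotal calculus -/

namespace SovereignStructure

variable {C : Type u} [Category.{v} C] [MonoidalCategory C] [RightRigidCategory C]
  (S : SovereignStructure C)

/-- The evaluation `X ⊗ Xᘁ ⟶ 𝟙_ C`. -/
def ev (X : C) : X ⊗ rdual X ⟶ 𝟙_ C :=
  (S.φ X).hom ▷ rdual X ≫ ε_ (rdual X) (rdual (rdual X))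

/-- The duality between `Xᘁ` and `X` given by the sovereign structure. -/
@[reducible]
def pairing (X : C) : ExactPairing (rdual X) X where
  coevaluation' := S.coev X
  evaluation' := S.ev X
  coevaluation_evaluation' := by
    rw [← cancel_mono ((λ_ X).hom ≫ (S.φ X).hom)]
    dsimp only [coev, ev]
    calc
      _ = 𝟙 _ ⊗≫ X ◁ η_ (rdual X) (rdual (rdual X)) ⊗≫ (X ⊗ rdual X) ◁ (S.φ X).inv ⊗≫
        (S.φ X).hom ▷ (rdual X ⊗ X) ⊗≫
          (ε_ (rdual X) (rdual (rdual X)) ▷ X ≫ 𝟙_ C ◁ (S.φ X).hom) ⊗≫ 𝟙 _ := by monoidal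
      _ = 𝟙 _ ⊗≫ X ◁ η_ (rdual X) (rdual (rdual X)) ⊗≫ (X ⊗ rdual X) ◁ (S.φ X).inv ⊗≫
        ((S.φ X).hom ▷ (rdual X ⊗ X) ≫ rdual (rdual X) ◁ rdual X ◁ (S.φ X).hom) ⊗≫
          ε_ (rdual X) (rdual (rdual X)) ▷ rdual (rdual X) ⊗≫ 𝟙 _ := by
        rw [← whisker_exchange]; monoidal
      _ = 𝟙 _ ⊗≫ X ◁ η_ (rdual X) (rdual (rdual X)) ⊗≫ (X ⊗ rdual X) ◁ ((S.φ X).inv ≫ (S.φ X).hom) ⊗≫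
        (S.φ X).hom ▷ (rdual X ⊗ rdual (rdual X)) ⊗≫
          ε_ (rdual X) (rdual (rdual X)) ▷ rdual (rdual X) ⊗≫ 𝟙 _ := by
        rw [← whisker_exchange]; monoidal
      _ = 𝟙 _ ⊗≫ (X ◁ η_ (rdual X) (rdual (rdual X)) ≫
        (S.φ X).hom ▷ (rdual X ⊗ rdual (rdual X))) ⊗≫
          ε_ (rdual X) (rdual (rdual X)) ▷ rdual (rdual X) ⊗≫ 𝟙 _ := by
        rw [Iso.inv_hom_id]; monoidal
      _ = 𝟙 _ ⊗≫ (S.φ X).hom ⊗≫ (rdual (rdual X) ◁ η_ (rdual X) (rdual (rdual X)) ⊗≫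
          ε_ (rdual X) (rdual (rdual X)) ▷ rdual (rdual X)) ⊗≫ 𝟙 _ := by
        rw [whisker_exchange]; monoidal
      _ = _ := by rw [ExactPairing.coevaluation_evaluation'']; monoidal
  evaluation_coevaluation' := by
    dsimp only [coev, ev]
    calc
      _ = 𝟙 _ ⊗≫ η_ (rdual X) (rdual (rdual X)) ▷ rdual X ⊗≫
        rdual X ◁ ((S.φ X).inv ≫ (S.φ X).hom) ▷ rdual X ⊗≫
          rdual X ◁ ε_ (rdual X) (rdual (rdual X)) ⊗≫ 𝟙 _ := by monoidal
      _ = 𝟙 _ ⊗≫ (η_ (rdual X) (rdual (rdual X)) ▷ rdual X ⊗≫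
          rdual X ◁ ε_ (rdual X) (rdual (rdual X))) ⊗≫ 𝟙 _ := by
        rw [Iso.inv_hom_id]; monoidal
      _ = _ := by rw [ExactPairing.evaluation_coevaluation'']; monoidal

theorem coev_ev (X : C) : X ◁ S.coev X ⊗≫ S.ev X ▷ X = ⊗𝟙.hom :=
  letI := S.pairing X
  ExactPairing.coevaluation_evaluation'' (X := rdual X) (Y := X)

theorem ev_coev (X : C) : S.coev X ▷ rdual X ⊗≫ rdual X ◁ S.ev X = ⊗𝟙.hom :=
  letI := S.pairing X
  ExactPairing.evaluation_coevaluation'' (X := rdual X) (Y := X)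

theorem inv_naturality {X Y : C} (f : X ⟶ Y) :
    (S.φ X).inv ≫ f = rightAdjointMate (rightAdjointMate f) ≫ (S.φ Y).inv := by
  rw [Iso.inv_comp_eq, ← Category.assoc, Iso.eq_comp_inv, S.naturality]

theorem coev_naturality {X Y : C} (f : X ⟶ Y) :
    S.coev X ≫ rdual X ◁ f = S.coev Y ≫ rightAdjointMate f ▷ Y := by
  have h := coevaluation_comp_rightAdjointMate (rightAdjointMate f)
  dsimp only [coev]
  calc
    _ = (η_ (rdual X) (rdual (rdual X)) ≫ rdual X ◁ rightAdjointMate (rightAdjointMate f)) ≫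
        rdual X ◁ (S.φ Y).inv := by
      simp only [Category.assoc, ← MonoidalCategory.whiskerLeft_comp, inv_naturality]
    _ = (η_ (rdual Y) (rdual (rdual Y)) ≫ rightAdjointMate f ▷ rdual (rdual Y)) ≫
        rdual X ◁ (S.φ Y).inv := congr_arg (· ≫ _) h
    _ = _ := by rw [Category.assoc, Category.assoc, whisker_exchange]

theorem ev_naturality {X Y : C} (f : X ⟶ Y) :
    f ▷ rdual Y ≫ S.ev Y = X ◁ rightAdjointMate f ≫ S.ev X := by
  have h := rightAdjointMate_comp_evaluation (rightAdjointMate f)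
  dsimp only [ev]
  rw [← Category.assoc, ← comp_whiskerRight, S.naturality, comp_whiskerRight, Category.assoc,
    whisker_exchange_assoc]
  exact congr_arg (_ ≫ ·) h

end SovereignStructure

/-! ### Evaluation and coevaluation of duals of tensor products -/

section

variable {C : Type u} [Category.{v} C] [MonoidalCategory C]

theorem rightDualIso_hom_ev {X Y₁ Y₂ : C} (p₁ : ExactPairing X Y₁) (p₂ : ExactPairing X Y₂) :
    (rightDualIso p₁ p₂).hom ▷ X ≫ p₂.evaluation' = p₁.evaluation' := by
  have h := @rightAdjointMate_comp_evaluation C _ _ X X ⟨Y₂⟩ ⟨Y₁⟩ (𝟙 X)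
  simp only [MonoidalCategory.whiskerLeft_id, Category.id_comp] at h
  exact h

theorem rightDualIso_hom_coev {X Y₁ Y₂ : C} (p₁ : ExactPairing X Y₁) (p₂ : ExactPairing X Y₂) :
    p₁.coevaluation' ≫ X ◁ (rightDualIso p₁ p₂).hom = p₂.coevaluation' := by
  have h := @coevaluation_comp_rightAdjointMate C _ _ X X ⟨Y₂⟩ ⟨Y₁⟩ (𝟙 X)
  simp only [MonoidalCategory.id_whiskerRight, Category.comp_id] at h
  exact h

theorem rightDualTensorIso_ev [RightRigidCategory C] (X Y : C) :
    ε_ (X ⊗ Y) (rdual (X ⊗ Y)) = (rightDualTensorIso X Y).hom ▷ (X ⊗ Y) ⊗≫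
      rdual Y ◁ ε_ X (rdual X) ▷ Y ⊗≫ ε_ Y (rdual Y) := by
  refine (rightDualIso_hom_ev (HasRightDual.exact (X := X ⊗ Y))
    (ExactPairing.tensor (X₁ := X) (Y₁ := rdual X) (X₂ := Y) (Y₂ := rdual Y))).symm.trans ?_
  refine (congr_arg (_ ≫ ·) (ExactPairing.tensor_evaluation (X₁ := X) (Y₁ := rdual X) (X₂ := Y) (Y₂ := rdual Y))).trans ?_
  dsimp only [rightDualTensorIso]
  monoidal

theorem rightDualTensorIso_coev [RightRigidCategory C] (X Y : C) :
    η_ (X ⊗ Y) (rdual (X ⊗ Y)) ≫ (X ⊗ Y) ◁ (rightDualTensorIso X Y).hom =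
      η_ X (rdual X) ⊗≫ X ◁ η_ Y (rdual Y) ▷ rdual X ⊗≫ 𝟙 _ := by
  refine (rightDualIso_hom_coev (HasRightDual.exact (X := X ⊗ Y))
    (ExactPairing.tensor (X₁ := X) (Y₁ := rdual X) (X₂ := Y) (Y₂ := rdual Y))).trans ?_
  refine (ExactPairing.tensor_coevaluation (X₁ := X) (Y₁ := rdual X) (X₂ := Y) (Y₂ := rdual Y)).trans ?_
  monoidal

end

namespace SovereignStructure

variable {C : Type u} [Category.{v} C] [MonoidalCategory C] [RightRigidCategory C]
  (S : SovereignStructure C)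

/-- Monoidality of `φ` is exactly what makes the reversed coevaluations nest. The same holds for the
evaluations in `tensor_ev`. -/
theorem coev_tensor (X Y : C) :
    S.coev (X ⊗ Y) ≫ (rightDualTensorIso X Y).hom ▷ (X ⊗ Y) =
      S.coev Y ⊗≫ rdual Y ◁ S.coev X ▷ Y ⊗≫ 𝟙 _ := by
  have hφ : (S.φ (X ⊗ Y)).inv = doubleDualTensor X Y ≫ ((S.φ X).inv ⊗ₘ (S.φ Y).inv) := by
    rw [← cancel_epi (S.φ (X ⊗ Y)).hom, Iso.hom_inv_id, ← Category.assoc, S.tensor,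
      MonoidalCategory.tensorHom_comp_tensorHom, Iso.hom_inv_id, Iso.hom_inv_id,
      MonoidalCategory.id_tensorHom_id]
  have h := coevaluation_comp_rightAdjointMate (rightDualTensorIso X Y).inv
  have h' := rightDualTensorIso_coev (rdual Y) (rdual X)
  dsimp only [coev]
  rw [hφ, doubleDualTensor]
  calc
    _ = (η_ (rdual (X ⊗ Y)) (rdual (rdual (X ⊗ Y))) ≫
          rdual (X ⊗ Y) ◁ rightAdjointMate (rightDualTensorIso X Y).inv) ≫
        rdual (X ⊗ Y) ◁ ((rightDualTensorIso (rdual Y) (rdual X)).hom ≫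
          ((S.φ X).inv ⊗ₘ (S.φ Y).inv)) ≫ (rightDualTensorIso X Y).hom ▷ (X ⊗ Y) := by
      simp only [MonoidalCategory.whiskerLeft_comp, Category.assoc]
    _ = (η_ (rdual Y ⊗ rdual X) (rdual (rdual Y ⊗ rdual X)) ≫
          (rightDualTensorIso X Y).inv ▷ rdual (rdual Y ⊗ rdual X)) ≫
        rdual (X ⊗ Y) ◁ ((rightDualTensorIso (rdual Y) (rdual X)).hom ≫
          ((S.φ X).inv ⊗ₘ (S.φ Y).inv)) ≫ (rightDualTensorIso X Y).hom ▷ (X ⊗ Y) :=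
      congr_arg (· ≫ _) h
    _ = (η_ (rdual Y ⊗ rdual X) (rdual (rdual Y ⊗ rdual X)) ≫
          (rdual Y ⊗ rdual X) ◁ (rightDualTensorIso (rdual Y) (rdual X)).hom) ≫
          (rdual Y ⊗ rdual X) ◁ ((S.φ X).inv ⊗ₘ (S.φ Y).inv) := by
      rw [whisker_exchange, Category.assoc, ← comp_whiskerRight_assoc, Iso.inv_hom_id,
        MonoidalCategory.id_whiskerRight, Category.id_comp, MonoidalCategory.whiskerLeft_comp,
        Category.assoc]
    _ = _ := by
      rw [h', MonoidalCategory.tensorHom_def]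
      calc
        _ = η_ (rdual Y) (rdual (rdual Y)) ⊗≫ rdual Y ◁ ((η_ (rdual X) (rdual (rdual X)) ≫
              rdual X ◁ (S.φ X).inv) ▷ rdual (rdual Y) ≫
            (rdual X ⊗ X) ◁ (S.φ Y).inv) ⊗≫ 𝟙 _ := by monoidal
        _ = _ := by rw [← whisker_exchange]; monoidal

theorem tensor_ev (X Y : C) :
    (X ⊗ Y) ◁ (rightDualTensorIso X Y).inv ≫ S.ev (X ⊗ Y) =
      𝟙 _ ⊗≫ X ◁ S.ev Y ▷ rdual X ⊗≫ S.ev X := by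
  have hφ : (S.φ (X ⊗ Y)).hom = ((S.φ X).hom ⊗ₘ (S.φ Y).hom) ≫
      (rightDualTensorIso (rdual Y) (rdual X)).inv ≫
        rightAdjointMate (rightDualTensorIso X Y).hom := by
    rw [← S.tensor, doubleDualTensor]
    simp only [Category.assoc, Iso.hom_inv_id_assoc]
    rw [← comp_rightAdjointMate, Iso.hom_inv_id, rightAdjointMate_id, Category.comp_id]
  have h := rightAdjointMate_comp_evaluation (rightDualTensorIso X Y).hom
  have h' := rightDualTensorIso_ev (rdual Y) (rdual X)
  dsimp only [ev]
  rw [whisker_exchange_assoc, hφ]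
  calc
    _ = ((S.φ X).hom ⊗ₘ (S.φ Y).hom) ▷ (rdual Y ⊗ rdual X) ≫
      (rightDualTensorIso (rdual Y) (rdual X)).inv ▷ (rdual Y ⊗ rdual X) ≫
        rightAdjointMate (rightDualTensorIso X Y).hom ▷ (rdual Y ⊗ rdual X) ≫
        rdual (rdual (X ⊗ Y)) ◁ (rightDualTensorIso X Y).inv ≫
        ε_ (rdual (X ⊗ Y)) (rdual (rdual (X ⊗ Y))) := by
      simp only [comp_whiskerRight, Category.assoc]
    _ = ((S.φ X).hom ⊗ₘ (S.φ Y).hom) ▷ (rdual Y ⊗ rdual X) ≫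
      (rightDualTensorIso (rdual Y) (rdual X)).inv ▷ (rdual Y ⊗ rdual X) ≫
        rdual (rdual Y ⊗ rdual X) ◁ (rightDualTensorIso X Y).inv ≫
        rightAdjointMate (rightDualTensorIso X Y).hom ▷ rdual (X ⊗ Y) ≫
        ε_ (rdual (X ⊗ Y)) (rdual (rdual (X ⊗ Y))) := by
      rw [whisker_exchange_assoc]
    _ = ((S.φ X).hom ⊗ₘ (S.φ Y).hom) ▷ (rdual Y ⊗ rdual X) ≫
      (rightDualTensorIso (rdual Y) (rdual X)).inv ▷ (rdual Y ⊗ rdual X) ≫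
        rdual (rdual Y ⊗ rdual X) ◁ (rightDualTensorIso X Y).inv ≫
        rdual (rdual Y ⊗ rdual X) ◁ (rightDualTensorIso X Y).hom ≫
        ε_ (rdual Y ⊗ rdual X) (rdual (rdual Y ⊗ rdual X)) :=
      congr_arg (fun t => _ ≫ _ ≫ _ ≫ t) h
    _ = _ := by
      rw [← MonoidalCategory.whiskerLeft_comp_assoc, Iso.inv_hom_id,
        MonoidalCategory.whiskerLeft_id, Category.id_comp, h', MonoidalCategory.tensorHom_def']
      calc
        _ = 𝟙 _ ⊗≫ X ◁ (S.φ Y).hom ▷ (rdual Y ⊗ rdual X) ⊗≫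
          (S.φ X).hom ▷ (rdual (rdual Y) ⊗ rdual Y ⊗ rdual X) ⊗≫
          ((rightDualTensorIso (rdual Y) (rdual X)).inv ≫
            (rightDualTensorIso (rdual Y) (rdual X)).hom) ▷ (rdual Y ⊗ rdual X) ⊗≫
          rdual (rdual X) ◁ ε_ (rdual Y) (rdual (rdual Y)) ▷ rdual X ⊗≫
          ε_ (rdual X) (rdual (rdual X)) := by monoidal
        _ = 𝟙 _ ⊗≫ X ◁ (S.φ Y).hom ▷ (rdual Y ⊗ rdual X) ⊗≫
          ((S.φ X).hom ▷ (rdual (rdual Y) ⊗ rdual Y) ≫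
          rdual (rdual X) ◁ ε_ (rdual Y) (rdual (rdual Y))) ▷ rdual X ⊗≫
          ε_ (rdual X) (rdual (rdual X)) := by
          rw [Iso.inv_hom_id]; monoidal
        _ = _ := by rw [← whisker_exchange]; monoidal

/-- Applied only to the unit object, but stated for any `E` with `u : Eᘁ ≅ E` so that the two
available duals of the unit are not confused. -/
theorem ev_of_selfDual {E : C} (u : rdual E ≅ E)
    (h : (S.φ E).hom ≫ rightAdjointMate u.inv ≫ u.hom = 𝟙 E) :
    E ◁ u.inv ≫ S.ev E = u.inv ▷ E ≫ ε_ E (rdual E) := by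
  have hφ : (S.φ E).hom = u.inv ≫ rightAdjointMate u.hom := by
    rw [← Category.comp_id (S.φ E).hom, ← rightAdjointMate_id, ← u.hom_inv_id,
      comp_rightAdjointMate, ← Category.assoc]
    refine congr_arg (· ≫ _) ?_
    rw [← cancel_mono u.hom, Category.assoc, h, u.inv_hom_id]
  have h' := rightAdjointMate_comp_evaluation u.hom
  dsimp only [ev]
  rw [hφ, comp_whiskerRight, Category.assoc]
  refine (congr_arg (fun t => _ ≫ _ ≫ t) h').trans ?_
  rw [whisker_exchange_assoc, ← MonoidalCategory.whiskerLeft_comp_assoc, u.inv_hom_id,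
    MonoidalCategory.whiskerLeft_id, Category.id_comp]

theorem unit_ev : 𝟙_ C ◁ (unitDualIso C).inv ≫ S.ev (𝟙_ C) = (λ_ (𝟙_ C)).hom := by
  refine (S.ev_of_selfDual (unitDualIso C) S.unit).trans ?_
  rw [← cancel_epi ((unitDualIso C).hom ▷ 𝟙_ C), ← comp_whiskerRight_assoc, Iso.hom_inv_id,
    MonoidalCategory.id_whiskerRight, Category.id_comp]
  refine (rightDualIso_hom_ev (RightRigidCategory.rightDual (𝟙_ C)).exact
    exactPairingUnit).symm.trans ?_
  refine congr_arg (_ ≫ ·) ?_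
  change (ρ_ (𝟙_ C)).hom = _
  monoidal

/-- The transpose of the evaluation. -/
def evMate (X : C) : rdual (𝟙_ C) ⟶ rdual (rdual X ⊗ X) :=
  @rightAdjointMate C _ _ (rdual X ⊗ X) (𝟙_ C) (RightRigidCategory.rightDual _)
    (RightRigidCategory.rightDual _) (ε_ X (rdual X))

/-- The coevaluation of the unit object. -/
def unitCoev : 𝟙_ C ⟶ 𝟙_ C ⊗ rdual (𝟙_ C) :=
  (RightRigidCategory.rightDual (𝟙_ C)).exact.coevaluation'

theorem unitCoev_evMate (X : C) : unitCoev ≫ 𝟙_ C ◁ evMate X =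
    η_ (rdual X ⊗ X) (rdual (rdual X ⊗ X)) ≫ ε_ X (rdual X) ▷ rdual (rdual X ⊗ X) :=
  @coevaluation_comp_rightAdjointMate C _ _ (rdual X ⊗ X) (𝟙_ C)
    (RightRigidCategory.rightDual _) (RightRigidCategory.rightDual _) (ε_ X (rdual X))

theorem evMate_ev (X : C) : ε_ X (rdual X) ▷ rdual (𝟙_ C) ≫ S.ev (𝟙_ C) =
    (rdual X ⊗ X) ◁ evMate X ≫ S.ev (rdual X ⊗ X) :=
  S.ev_naturality (ε_ X (rdual X))

/-- The transpose of an evaluation is the coevaluation of the dual, by a zigzag once the duals of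
`𝟙_ C` and of `Xᘁ ⊗ X` are identified. -/
theorem evMate_eq (X : C) :
    (unitDualIso C).inv ≫ evMate X ≫ (rightDualTensorIso (rdual X) X).hom =
      η_ (rdual X) (rdual (rdual X)) := by
  have h := unitCoev_evMate X
  have h' := rightDualTensorIso_coev (rdual X) X
  have hu := rightDualIso_hom_coev (RightRigidCategory.rightDual (𝟙_ C)).exact
    exactPairingUnit
  have hu' : (λ_ (𝟙_ C)).inv ≫ 𝟙_ C ◁ (unitDualIso C).inv = unitCoev := by
    rw [← cancel_mono (𝟙_ C ◁ (unitDualIso C).hom), Category.assoc,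
      ← MonoidalCategory.whiskerLeft_comp, Iso.inv_hom_id, MonoidalCategory.whiskerLeft_id,
      Category.comp_id]
    refine Eq.trans ?_ hu.symm
    change _ = (ρ_ (𝟙_ C)).inv
    monoidal
  calc
    _ = ((λ_ (𝟙_ C)).inv ≫ 𝟙_ C ◁ (unitDualIso C).inv) ≫ 𝟙_ C ◁ evMate X
        ≫ 𝟙_ C ◁ (rightDualTensorIso (rdual X) X).hom ≫ (λ_ _).hom := by monoidal
    _ = (unitCoev ≫ 𝟙_ C ◁ evMate X)
        ≫ 𝟙_ C ◁ (rightDualTensorIso (rdual X) X).hom ≫ (λ_ _).hom := by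
      rw [hu', Category.assoc]
    _ = (η_ (rdual X ⊗ X) (rdual (rdual X ⊗ X)) ≫
          (rdual X ⊗ X) ◁ (rightDualTensorIso (rdual X) X).hom) ≫
        ε_ X (rdual X) ▷ _ ≫ (λ_ _).hom := by
      rw [h, Category.assoc, Category.assoc, whisker_exchange_assoc]
    _ = η_ (rdual X) (rdual (rdual X)) ⊗≫ (rdual X ◁ η_ X (rdual X) ⊗≫ ε_ X (rdual X) ▷ rdual X) ▷
        rdual (rdual X) ⊗≫ 𝟙 _ := by
      rw [h']; monoidal
    _ = _ := by rw [ExactPairing.coevaluation_evaluation'']; monoidal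

/-- The sovereign structure at a dual is the inverse of the dual of the sovereign structure. -/
theorem whiskerLeft_ev_rdual (X : C) :
    rdual X ◁ (S.φ X).hom ≫ S.ev (rdual X) = ε_ X (rdual X) := by
  -- Naturality of `S.ev` along the evaluation of `X` compares the unit object with `Xᘁ ⊗ X`. The
  -- former is normalised by `unit_ev`, the latter is split by `tensor_ev`, and `evMate_eq` leaves a
  -- zigzag.
  have h := S.evMate_ev X
  have h' := S.tensor_ev (rdual X) X
  have hm := evMate_eq X
  have hu := S.unit_ev
  symm
  calc
    _ = (ρ_ _).inv ≫ ε_ X (rdual X) ▷ 𝟙_ C ≫ (λ_ (𝟙_ C)).hom := by monoidal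
    _ = (ρ_ _).inv ≫ (rdual X ⊗ X) ◁ (unitDualIso C).inv ≫ ε_ X (rdual X) ▷ rdual (𝟙_ C) ≫
        S.ev (𝟙_ C) := by
      rw [← hu, whisker_exchange_assoc]
    _ = (ρ_ _).inv ≫ (rdual X ⊗ X) ◁ (unitDualIso C).inv ≫
        (rdual X ⊗ X) ◁ evMate X ≫ S.ev (rdual X ⊗ X) := by
      rw [h]
    _ = (ρ_ _).inv ≫ (rdual X ⊗ X) ◁ ((unitDualIso C).inv ≫
        evMate X ≫ (rightDualTensorIso (rdual X) X).hom) ≫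
        (rdual X ⊗ X) ◁ (rightDualTensorIso (rdual X) X).inv ≫ S.ev (rdual X ⊗ X) := by
      simp only [MonoidalCategory.whiskerLeft_comp, Category.assoc]
      rw [← MonoidalCategory.whiskerLeft_comp_assoc _ (rightDualTensorIso (rdual X) X).hom,
        Iso.hom_inv_id, MonoidalCategory.whiskerLeft_id, Category.id_comp]
    _ = 𝟙 _ ⊗≫ rdual X ◁ (X ◁ η_ (rdual X) (rdual (rdual X)) ⊗≫ S.ev X ▷ rdual (rdual X)) ⊗≫
        S.ev (rdual X) := by
      rw [hm, h']; monoidal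
    _ = 𝟙 _ ⊗≫ rdual X ◁ ((X ◁ η_ (rdual X) (rdual (rdual X)) ≫
          (S.φ X).hom ▷ (rdual X ⊗ rdual (rdual X))) ⊗≫
        ε_ (rdual X) (rdual (rdual X)) ▷ rdual (rdual X)) ⊗≫ S.ev (rdual X) := by
      dsimp only [ev]; monoidal
    _ = 𝟙 _ ⊗≫ rdual X ◁ (S.φ X).hom ⊗≫ rdual X ◁
        (rdual (rdual X) ◁ η_ (rdual X) (rdual (rdual X)) ⊗≫
        ε_ (rdual X) (rdual (rdual X)) ▷ rdual (rdual X)) ⊗≫ S.ev (rdual X) := by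
      rw [whisker_exchange]; monoidal
    _ = _ := by
      rw [ExactPairing.coevaluation_evaluation'']; monoidal

theorem coev_rdual (X : C) :
    S.coev (rdual X) = η_ X (rdual X) ≫ (S.φ X).hom ▷ rdual X := by
  have h := S.whiskerLeft_ev_rdual X
  calc
    _ = S.coev (rdual X) ⊗≫ rdual (rdual X) ◁ (rdual X ◁ η_ X (rdual X) ⊗≫
        ε_ X (rdual X) ▷ rdual X) ⊗≫ 𝟙 _ := by
      rw [ExactPairing.coevaluation_evaluation'']; monoidal
    _ = 𝟙 _ ⊗≫ (S.coev (rdual X) ▷ 𝟙_ C ≫ (rdual (rdual X) ⊗ rdual X) ◁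
        (η_ X (rdual X) ≫ (S.φ X).hom ▷ rdual X)) ⊗≫
        rdual (rdual X) ◁ S.ev (rdual X) ▷ rdual X ⊗≫ 𝟙 _ := by
      rw [← h]; monoidal
    _ = 𝟙 _ ⊗≫ (η_ X (rdual X) ≫ (S.φ X).hom ▷ rdual X) ⊗≫
        (S.coev (rdual X) ▷ rdual (rdual X) ⊗≫
        rdual (rdual X) ◁ S.ev (rdual X)) ▷ rdual X ⊗≫ 𝟙 _ := by
      rw [← whisker_exchange]; monoidal
    _ = _ := by rw [S.ev_coev]; monoidal

end SovereignStructure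


/-! ### Traces and partial traces -/

namespace SovereignStructure

section

variable {C : Type u} [Category.{v} C] [MonoidalCategory C] [RightRigidCategory C]
  (S : SovereignStructure C)

theorem leftTrace_eq {X : C} (f : X ⟶ X) :
    S.leftTrace f = S.coev X ≫ rdual X ◁ f ≫ ε_ X (rdual X) := by
  simp only [leftTrace, coev, MonoidalCategory.whiskerLeft_comp, Category.assoc]

theorem rightTrace_eq {X : C} (f : X ⟶ X) :
    S.rightTrace f = η_ X (rdual X) ≫ f ▷ rdual X ≫ S.ev X := by
  simp only [rightTrace, ev, comp_whiskerRight, Category.assoc]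

theorem rightTrace_comm {X Y : C} (f : X ⟶ Y) (g : Y ⟶ X) :
    S.rightTrace (f ≫ g) = S.rightTrace (g ≫ f) := by
  have h := coevaluation_comp_rightAdjointMate f
  rw [rightTrace_eq, rightTrace_eq, comp_whiskerRight, Category.assoc, ev_naturality,
    ← reassoc_of% h, ev_naturality, comp_rightAdjointMate, MonoidalCategory.whiskerLeft_comp,
    Category.assoc]

/-- The partial left trace. -/
def partialTrace (V : C) {N Z : C} (f : V ⊗ N ⟶ V ⊗ Z) : N ⟶ Z :=
  (λ_ N).inv ≫ S.coev V ▷ N ≫ (α_ _ _ _).hom ≫ rdual V ◁ f ≫ (α_ _ _ _).inv ≫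
    ε_ V (rdual V) ▷ Z ≫ (λ_ Z).hom

theorem partialTrace_comm {X Y N Z : C} (f : X ⊗ N ⟶ Y ⊗ Z) (g : Y ⟶ X) :
    S.partialTrace X (f ≫ g ▷ Z) = S.partialTrace Y (g ▷ N ≫ f) := by
  have h₁ := rightAdjointMate_comp_evaluation g
  have h₂ := S.coev_naturality g
  dsimp only [partialTrace]
  calc
    _ = 𝟙 _ ⊗≫ S.coev X ▷ N ⊗≫ rdual X ◁ f ⊗≫ (rdual X ◁ g ≫ ε_ X (rdual X)) ▷ Z ⊗≫ 𝟙 _ := by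
      monoidal
    _ = 𝟙 _ ⊗≫ S.coev X ▷ N ⊗≫ (rdual X ◁ f ≫ rightAdjointMate g ▷ (Y ⊗ Z)) ⊗≫
        ε_ Y (rdual Y) ▷ Z ⊗≫ 𝟙 _ := by
      rw [← h₁]; monoidal
    _ = 𝟙 _ ⊗≫ (S.coev X ≫ rightAdjointMate g ▷ X) ▷ N ⊗≫ rdual Y ◁ f ⊗≫
        ε_ Y (rdual Y) ▷ Z ⊗≫ 𝟙 _ := by
      rw [whisker_exchange]; monoidal
    _ = _ := by
      rw [← h₂]; monoidal

theorem partialTrace_whiskerLeft_comp (V : C) {N N' Z Z' : C} (u : N ⟶ N') (f : V ⊗ N' ⟶ V ⊗ Z)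
    (w : Z ⟶ Z') :
    S.partialTrace V (V ◁ u ≫ f ≫ V ◁ w) = u ≫ S.partialTrace V f ≫ w := by
  dsimp only [partialTrace]
  calc
    _ = 𝟙 _ ⊗≫ (S.coev V ▷ N ≫ (rdual V ⊗ V) ◁ u) ⊗≫ rdual V ◁ f ⊗≫
        ((rdual V ⊗ V) ◁ w ≫ ε_ V (rdual V) ▷ Z') ⊗≫ 𝟙 _ := by monoidal
    _ = 𝟙 _ ⊗≫ u ⊗≫ S.coev V ▷ N' ⊗≫ rdual V ◁ f ⊗≫
        ((rdual V ⊗ V) ◁ w ≫ ε_ V (rdual V) ▷ Z') ⊗≫ 𝟙 _ := by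
      rw [← whisker_exchange]; monoidal
    _ = _ := by rw [whisker_exchange]; monoidal

theorem partialTrace_tensor (V W : C) {N Z : C} (f : (V ⊗ W) ⊗ N ⟶ (V ⊗ W) ⊗ Z) :
    S.partialTrace (V ⊗ W) f =
      S.partialTrace W (S.partialTrace V ((α_ _ _ _).inv ≫ f ≫ (α_ _ _ _).hom)) := by
  have h₁ := S.coev_tensor V W
  have h₂ := rightDualTensorIso_ev V W
  dsimp only [partialTrace]
  rw [h₂]
  calc
    _ = 𝟙 _ ⊗≫ S.coev (V ⊗ W) ▷ N ⊗≫ (rdual (V ⊗ W) ◁ f ≫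
        (rightDualTensorIso V W).hom ▷ ((V ⊗ W) ⊗ Z)) ⊗≫
        (rdual W ◁ ε_ V (rdual V) ▷ W ⊗≫ ε_ W (rdual W)) ▷ Z ⊗≫ 𝟙 _ := by monoidal
    _ = 𝟙 _ ⊗≫ (S.coev (V ⊗ W) ≫ (rightDualTensorIso V W).hom ▷ (V ⊗ W)) ▷ N ⊗≫
        (rdual W ⊗ rdual V) ◁ f ⊗≫
        (rdual W ◁ ε_ V (rdual V) ▷ W ⊗≫ ε_ W (rdual W)) ▷ Z ⊗≫ 𝟙 _ := by
      rw [whisker_exchange]; monoidal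
    _ = _ := by rw [h₁]; monoidal

theorem rightTrace_tensor (V W : C) (f : V ⊗ W ⟶ V ⊗ W) :
    S.rightTrace f = S.rightTrace ((ρ_ V).inv ≫ V ◁ η_ W (rdual W) ≫ (α_ _ _ _).inv ≫
      f ▷ rdual W ≫ (α_ _ _ _).hom ≫ V ◁ S.ev W ≫ (ρ_ V).hom) := by
  have h₁ := rightDualTensorIso_coev V W
  have h₂ := S.tensor_ev V W
  rw [rightTrace_eq, rightTrace_eq]
  calc
    _ = η_ (V ⊗ W) (rdual (V ⊗ W)) ≫ f ▷ rdual (V ⊗ W) ≫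
        (V ⊗ W) ◁ (rightDualTensorIso V W).hom ≫ (V ⊗ W) ◁ (rightDualTensorIso V W).inv ≫
        S.ev (V ⊗ W) := by
      rw [← MonoidalCategory.whiskerLeft_comp_assoc, Iso.hom_inv_id,
        MonoidalCategory.whiskerLeft_id, Category.id_comp]
    _ = (η_ (V ⊗ W) (rdual (V ⊗ W)) ≫ (V ⊗ W) ◁ (rightDualTensorIso V W).hom) ≫
        f ▷ (rdual W ⊗ rdual V) ≫ (V ⊗ W) ◁ (rightDualTensorIso V W).inv ≫
        S.ev (V ⊗ W) := by
      rw [← whisker_exchange_assoc, Category.assoc]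
    _ = _ := by rw [h₁, h₂]; monoidal

end

end SovereignStructure

/-! ### Sliding a dual strand through a trace -/

section

variable {C : Type u} [Category.{v} C] [MonoidalCategory C] [RightRigidCategory C]
  (S : SovereignStructure C) {A : C} (T : ∀ V : C, V ⟶ V ⊗ A)

/-- The trace of the coaction `T` on `V`. -/
def traceElt (V : C) : 𝟙_ C ⟶ A :=
  S.coev V ≫ rdual V ◁ T V ≫ (α_ _ _ _).inv ≫ ε_ V (rdual V) ▷ A ≫ (λ_ A).hom

/-- The pairing `(p, q) ↦ partialTrace (p ≫ T ≫ q)`. -/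
def slideForm (N X Y : C) (p : X ⊗ N ⟶ Y) (q : Y ⟶ X ⊗ N) : N ⟶ N ⊗ A :=
  S.partialTrace X (p ≫ T Y ≫ q ▷ A ≫ (α_ _ _ _).hom)

/-- Cyclicity of the partial trace. With `slideForm_comm_right` the pairing is balanced over both
`X` and `Y`, which permits the exchange of dual bases. -/
theorem slideForm_comm_left {N X X' Y : C} (g : X' ⟶ X) (p : X ⊗ N ⟶ Y) (q : Y ⟶ X' ⊗ N) :
    slideForm S T N X' Y (g ▷ N ≫ p) q = slideForm S T N X Y p (q ≫ g ▷ N) := by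
  dsimp only [slideForm]
  rw [Category.assoc, ← S.partialTrace_comm]
  congr 1
  monoidal

variable (hT : ∀ {V W : C} (f : V ⟶ W), f ≫ T W = T V ≫ f ▷ A)

include hT in
theorem slideForm_comm_right {N X Y Y' : C} (h : Y ⟶ Y') (p : X ⊗ N ⟶ Y) (q : Y' ⟶ X ⊗ N) :
    slideForm S T N X Y' (p ≫ h) q = slideForm S T N X Y p (h ≫ q) := by
  dsimp only [slideForm]
  rw [Category.assoc, reassoc_of% hT, comp_whiskerRight_assoc]

/-- With this cap and cup the trace over `V` closes by itself, and the loop of `W` straightens into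
the strand `Wᘁ` by two zigzags. -/
theorem slideForm_tensor (V W : C) :
    slideForm S T (rdual W) (V ⊗ W) V ((α_ _ _ _).hom ≫ V ◁ S.ev W ≫ (ρ_ V).hom)
      ((ρ_ V).inv ≫ V ◁ η_ W (rdual W) ≫ (α_ _ _ _).inv) =
      (ρ_ (rdual W)).inv ≫ rdual W ◁ traceElt S T V := by
  have hV : S.partialTrace V ((ρ_ V).hom ≫ T V) = traceElt S T V := by
    dsimp only [SovereignStructure.partialTrace, traceElt]
    monoidal
  have h : (α_ V W (rdual W)).inv ≫ (((α_ _ _ _).hom ≫ V ◁ S.ev W ≫ (ρ_ V).hom) ≫ T V ≫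
      ((ρ_ V).inv ≫ V ◁ η_ W (rdual W) ≫ (α_ _ _ _).inv) ▷ A ≫ (α_ _ _ _).hom) ≫
        (α_ _ _ _).hom = V ◁ S.ev W ≫ ((ρ_ V).hom ≫ T V) ≫
          V ◁ ((λ_ A).inv ≫ η_ W (rdual W) ▷ A ≫ (α_ _ _ _).hom) := by
    monoidal
  rw [slideForm, S.partialTrace_tensor, h, S.partialTrace_whiskerLeft_comp, hV]
  dsimp only [SovereignStructure.partialTrace]
  calc
    _ = 𝟙 _ ⊗≫ (S.coev W ▷ rdual W ⊗≫ rdual W ◁ S.ev W) ⊗≫ rdual W ◁ traceElt S T V ⊗≫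
        (rdual W ◁ η_ W (rdual W) ⊗≫ ε_ W (rdual W) ▷ rdual W) ▷ A ⊗≫ 𝟙 _ := by monoidal
    _ = _ := by rw [S.ev_coev, ExactPairing.coevaluation_evaluation'']; monoidal

end


/-! ### The slide formula -/

namespace FusionStructure

variable {k : Type*} [CommRing k] {C : Type u} [Category.{v} C] [Preadditive C] [Linear k C]
  [MonoidalCategory C] [MonoidalPreadditive C] [MonoidalLinear k C] [HasFiniteBiproducts C]
  [RigidCategory C] {I : Type w} [Fintype I] (D : FusionStructure k C I) (S : SovereignStructure C)

include D in
theorem exists_smul_id_unit (f : 𝟙_ C ⟶ 𝟙_ C) : ∃ c : k, f = c • 𝟙 (𝟙_ C) := by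
  obtain ⟨c, hc⟩ := D.exists_smul_id (D.unitIso.inv ≫ f ≫ D.unitIso.hom)
  refine ⟨c, ?_⟩
  rw [← cancel_epi D.unitIso.inv, ← cancel_mono D.unitIso.hom, Category.assoc, hc]
  simp

include D in
theorem smul_id_unit_injective {c c' : k} (h : c • 𝟙 (𝟙_ C) = c' • 𝟙 (𝟙_ C)) : c = c' := by
  refine (D.end_bijective D.zero).1 ?_
  have := congr_arg (fun f => D.unitIso.inv ≫ f ≫ D.unitIso.hom) h
  simpa using this

/-- The dimension of `D.V j` as a scalar. -/
def dimScalar (j : I) : k := (D.exists_smul_id_unit (S.dim (D.V j))).choose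

theorem dim_eq (j : I) : S.dim (D.V j) = D.dimScalar S j • 𝟙 (𝟙_ C) :=
  (D.exists_smul_id_unit (S.dim (D.V j))).choose_spec

theorem rightTrace_smul_id (hS : S.IsSpherical) (j : I) (c : k) :
    S.rightTrace (c • 𝟙 (D.V j)) = (D.dimScalar S j * c) • 𝟙 (𝟙_ C) := by
  have h : S.rightTrace (c • 𝟙 (D.V j)) = c • S.rightTrace (𝟙 (D.V j)) := by
    simp [S.rightTrace_eq, MonoidalLinear.smul_whiskerRight]
  rw [h, ← hS, mul_comm, mul_smul, ← dim_eq, SovereignStructure.dim]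

-- The decomposition is sorted by isotypic type. Terms of the wrong type are set to zero, so that
-- one index set `Fin d.n` serves for every `l`.
open scoped Classical in
theorem exists_dualBasis (X : C) : ∃ (n : ℕ) (P : ∀ l, Fin n → (X ⟶ D.V l))
    (Q : ∀ l, Fin n → (D.V l ⟶ X)), 𝟙 X = ∑ l, ∑ a, P l a ≫ Q l a := by
  let d := D.dec X
  refine ⟨d.n, fun l a => if h : d.s a = l then d.p a ≫ eqToHom (by rw [h]) else 0,
    fun l a => if h : d.s a = l then eqToHom (by rw [h]) ≫ d.q a else 0, ?_⟩
  rw [Finset.sum_comm, ← d.sum_p_q]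
  refine Finset.sum_congr rfl fun a _ => ?_
  rw [Finset.sum_eq_single (d.s a)]
  · simp
  · intro l _ hl
    dsimp only
    rw [dif_neg hl.symm, Limits.zero_comp]
  · simp

theorem hom_to_eq_sum {X : C} {n : ℕ} {P : ∀ l, Fin n → (X ⟶ D.V l)}
    {Q : ∀ l, Fin n → (D.V l ⟶ X)} (h : 𝟙 X = ∑ l, ∑ a, P l a ≫ Q l a) {l : I} (p : X ⟶ D.V l) :
    p = ∑ a, P l a ≫ Q l a ≫ p := by
  conv_lhs => rw [← Category.id_comp p, h, Preadditive.sum_comp]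
  rw [Finset.sum_eq_single l]
  · simp [Preadditive.sum_comp]
  · intro l' _ hl
    rw [Preadditive.sum_comp]
    refine Finset.sum_eq_zero fun a _ => ?_
    rw [Category.assoc, D.hom_eq_zero l' l hl (Q l' a ≫ p), Limits.comp_zero]
  · simp

variable {A : C} (T : ∀ V : C, V ⟶ V ⊗ A)

theorem slideForm_sum_smul_left {N X Y : C} {ι : Type*} [Fintype ι] (t : ι → k)
    (p : ι → (X ⊗ N ⟶ Y)) (q : Y ⟶ X ⊗ N) :
    slideForm S T N X Y (∑ a, t a • p a) q = ∑ a, t a • slideForm S T N X Y (p a) q := by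
  simp [slideForm, SovereignStructure.partialTrace, Preadditive.sum_comp, Preadditive.comp_sum,
    whiskerLeft_sum]

theorem slideForm_sum_smul_right {N X Y : C} {ι : Type*} [Fintype ι] (t : ι → k) (p : X ⊗ N ⟶ Y)
    (q : ι → (Y ⟶ X ⊗ N)) :
    slideForm S T N X Y p (∑ a, t a • q a) = ∑ a, t a • slideForm S T N X Y p (q a) := by
  simp [slideForm, SovereignStructure.partialTrace, Preadditive.sum_comp, Preadditive.comp_sum,
    whiskerLeft_sum, sum_whiskerRight]

theorem slideForm_sum_left {N X Y : C} {ι : Type*} [Fintype ι] (p : ι → (X ⊗ N ⟶ Y))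
    (q : Y ⟶ X ⊗ N) :
    slideForm S T N X Y (∑ a, p a) q = ∑ a, slideForm S T N X Y (p a) q := by
  simp [slideForm, SovereignStructure.partialTrace, Preadditive.sum_comp, Preadditive.comp_sum,
    whiskerLeft_sum]

theorem slideForm_sum_right {N X Y : C} {ι : Type*} [Fintype ι] (p : X ⊗ N ⟶ Y)
    (q : ι → (Y ⟶ X ⊗ N)) :
    slideForm S T N X Y p (∑ a, q a) = ∑ a, slideForm S T N X Y p (q a) := by
  simp [slideForm, SovereignStructure.partialTrace, Preadditive.sum_comp, Preadditive.comp_sum,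
    whiskerLeft_sum, sum_whiskerRight]

end FusionStructure

/-! ### Bending a strand, and its effect on traces -/

section Transpose

variable {C : Type u} [Category.{v} C] [MonoidalCategory C] [RightRigidCategory C]
  (S : SovereignStructure C)

/-- The transpose of `q : Y ⟶ X ⊗ W` for the duality between `Wᘁ` and `W`. -/
def bendOut {X Y W : C} (q : Y ⟶ X ⊗ W) : Y ⊗ rdual W ⟶ X :=
  q ▷ rdual W ≫ (α_ _ _ _).hom ≫ X ◁ S.ev W ≫ (ρ_ X).hom

/-- The transpose of `p : X ⊗ W ⟶ Y` for the duality between `W` and `Wᘁ`. -/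
def bendIn {X Y W : C} (p : X ⊗ W ⟶ Y) : X ⟶ Y ⊗ rdual W :=
  (ρ_ X).inv ≫ X ◁ η_ W (rdual W) ≫ (α_ _ _ _).inv ≫ p ▷ rdual W

/-- The inverse of the transposition `bendIn`. -/
def unbend {X Y W : C} (q : X ⟶ Y ⊗ rdual W) : X ⊗ W ⟶ Y :=
  q ▷ W ≫ (α_ _ _ _).hom ≫ Y ◁ ε_ W (rdual W) ≫ (ρ_ Y).hom

theorem bendIn_unbend {X Y W : C} (q : X ⟶ Y ⊗ rdual W) : bendIn (unbend q) = q := by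
  dsimp only [bendIn, unbend]
  calc
    _ = 𝟙 _ ⊗≫ (X ◁ η_ W (rdual W) ≫ q ▷ (W ⊗ rdual W)) ⊗≫ Y ◁ ε_ W (rdual W) ▷ rdual W
        ⊗≫ 𝟙 _ := by monoidal
    _ = 𝟙 _ ⊗≫ q ⊗≫ Y ◁ (rdual W ◁ η_ W (rdual W) ⊗≫ ε_ W (rdual W) ▷ rdual W)
        ⊗≫ 𝟙 _ := by rw [whisker_exchange]; monoidal
    _ = _ := by rw [ExactPairing.coevaluation_evaluation'']; monoidal

/-- Both sides close up the same diagram: cyclicity moves the trace from `X` to `Y ⊗ W`, and closing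
`W` first leaves a trace over `Y`. -/
theorem rightTrace_bend {X Y W : C} (q : Y ⟶ X ⊗ rdual W) (q' : X ⟶ Y ⊗ W) :
    S.rightTrace (q' ≫ unbend q) = S.rightTrace (q ≫ bendOut S q') := by
  rw [S.rightTrace_comm, S.rightTrace_tensor]
  congr 1
  conv_rhs => rw [← bendIn_unbend q]
  dsimp only [bendIn, bendOut]
  simp only [comp_whiskerRight, Category.assoc]

end Transpose

/-! ### Exchange of dual bases -/

namespace FusionStructure

variable {k : Type*} [CommRing k] {C : Type u} [Category.{v} C] [Preadditive C] [Linear k C]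
  [MonoidalCategory C] [MonoidalPreadditive C] [MonoidalLinear k C] [HasFiniteBiproducts C]
  [RigidCategory C] {I : Type w} [Fintype I] (D : FusionStructure k C I) (S : SovereignStructure C)
  {A : C} (T : ∀ V : C, V ⟶ V ⊗ A)

/-- The two families of bases are related by scalar matrices `s` and `t`, and closed diagrams give
d_j s = d_l t. The weights are thus exchanged without dividing by a dimension. -/
theorem slideForm_bend (hS : S.IsSpherical) (W : C) (j l : I) {n m : ℕ}
    {P : ∀ i, Fin n → (D.V j ⊗ rdual W ⟶ D.V i)} {Q : ∀ i, Fin n → (D.V i ⟶ D.V j ⊗ rdual W)}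
    (h : 𝟙 _ = ∑ i, ∑ a, P i a ≫ Q i a)
    {P' : ∀ i, Fin m → (D.V l ⊗ W ⟶ D.V i)} {Q' : ∀ i, Fin m → (D.V i ⟶ D.V l ⊗ W)}
    (h' : 𝟙 _ = ∑ i, ∑ a, P' i a ≫ Q' i a) :
    D.dimScalar S j • ∑ a, slideForm S T (rdual W) (D.V j) (D.V l) (P l a) (Q l a) =
      D.dimScalar S l • ∑ b, slideForm S T (rdual W) (D.V j) (D.V l) (bendOut S (Q' j b))
        (bendIn (P' j b)) := by
  choose s hs using fun a b => D.exists_smul_id (Q' j b ≫ unbend (Q l a))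
  choose t ht using fun a b => D.exists_smul_id (Q l a ≫ bendOut S (Q' j b))
  -- Tracing a scalar endomorphism of `V j` multiplies the scalar by the dimension of `V j`, by
  -- sphericity; the two closed diagrams agree by `rightTrace_bend`.
  have hst : ∀ a b, D.dimScalar S j * s a b = D.dimScalar S l * t a b := by
    intro a b
    refine D.smul_id_unit_injective ?_
    rw [← D.rightTrace_smul_id S hS, ← D.rightTrace_smul_id S hS, ← hs, ← ht, rightTrace_bend]
  have h₁ : ∀ a, Q l a = ∑ b, s a b • bendIn (P' j b) := by
    intro a
    have e := congr_arg bendIn (D.hom_to_eq_sum h' (unbend (Q l a)))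
    rw [bendIn_unbend] at e
    rw [e]
    simp only [hs]
    simp [bendIn, sum_whiskerRight, Preadditive.comp_sum]
  have h₂ : ∀ b, bendOut S (Q' j b) = ∑ a, t a b • P l a := by
    intro b
    refine (D.hom_to_eq_sum h (bendOut S (Q' j b))).trans ?_
    simp only [ht]
    simp
  calc
    _ = ∑ a, ∑ b, (D.dimScalar S j * s a b) •
        slideForm S T (rdual W) (D.V j) (D.V l) (P l a) (bendIn (P' j b)) := by
      rw [Finset.smul_sum]
      refine Finset.sum_congr rfl fun a _ => ?_
      conv_lhs => rw [h₁ a, slideForm_sum_smul_right, Finset.smul_sum]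
      simp only [smul_smul]
    _ = ∑ b, ∑ a, (D.dimScalar S l * t a b) •
        slideForm S T (rdual W) (D.V j) (D.V l) (P l a) (bendIn (P' j b)) := by
      rw [Finset.sum_comm]
      simp only [hst]
    _ = _ := by
      rw [Finset.smul_sum]
      refine Finset.sum_congr rfl fun b _ => ?_
      rw [h₂ b, slideForm_sum_smul_left, Finset.smul_sum]
      simp only [smul_smul]

/-- The weighted sum of the traces of `T` on the objects `D.V j`. -/
def traceSum : 𝟙_ C ⟶ A := ∑ j, D.dimScalar S j • traceElt S T (D.V j)

variable (hT : ∀ {V W : C} (f : V ⟶ W), f ≫ T W = T V ≫ f ▷ A)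

-- Each `V j ⊗ Wᘁ` is resolved into the `V l`. Exchanging bases turns the weight of `V j` into that
-- of `V l`, and the sum over `j` then recombines to the identity of `V l ⊗ W`.
include hT in
theorem sum_slideForm_rdual (hS : S.IsSpherical) (W : C) :
    ∑ j, D.dimScalar S j • slideForm S T (rdual W) (D.V j) (D.V j ⊗ rdual W) (𝟙 _) (𝟙 _) =
      (ρ_ (rdual W)).inv ≫ rdual W ◁ D.traceSum S T := by
  choose n P Q h using fun j => D.exists_dualBasis (D.V j ⊗ rdual W)
  choose m P' Q' h' using fun l => D.exists_dualBasis (D.V l ⊗ W)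
  calc
    _ = ∑ j, ∑ l, D.dimScalar S j • ∑ a,
        slideForm S T (rdual W) (D.V j) (D.V l) (P j l a) (Q j l a) := by
      refine Finset.sum_congr rfl fun j _ => ?_
      rw [← Finset.smul_sum]
      congr 1
      have e : ∀ l a, slideForm S T (rdual W) (D.V j) (D.V l) (P j l a) (Q j l a) =
          slideForm S T (rdual W) (D.V j) (D.V j ⊗ rdual W) (P j l a ≫ Q j l a) (𝟙 _) := by
        intro l a
        rw [slideForm_comm_right S T hT, Category.comp_id]
      simp only [e]
      refine (congr_arg (fun p => slideForm S T _ _ _ p (𝟙 _)) (h j)).trans ?_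
      simp only [slideForm_sum_left]
    _ = ∑ j, ∑ l, D.dimScalar S l • ∑ b, slideForm S T (rdual W) (D.V j) (D.V l)
        (bendOut S (Q' l j b)) (bendIn (P' l j b)) := by
      refine Finset.sum_congr rfl fun j _ => Finset.sum_congr rfl fun l _ => ?_
      exact D.slideForm_bend S T hS W j l (h j) (h' l)
    _ = ∑ l, D.dimScalar S l • ((ρ_ (rdual W)).inv ≫ rdual W ◁ traceElt S T (D.V l)) := by
      rw [Finset.sum_comm]
      refine Finset.sum_congr rfl fun l _ => ?_
      rw [← Finset.smul_sum]
      congr 1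
      rw [← slideForm_tensor]
      have e : ∀ j b, slideForm S T (rdual W) (D.V j) (D.V l)
          (bendOut S (Q' l j b)) (bendIn (P' l j b)) =
          slideForm S T (rdual W) (D.V l ⊗ W) (D.V l)
            ((α_ _ _ _).hom ≫ D.V l ◁ S.ev W ≫ (ρ_ (D.V l)).hom)
            (((ρ_ (D.V l)).inv ≫ D.V l ◁ η_ W (rdual W) ≫ (α_ _ _ _).inv) ≫
              (P' l j b ≫ Q' l j b) ▷ rdual W) := by
        intro j b
        rw [bendOut, slideForm_comm_left, bendIn]
        simp only [comp_whiskerRight, Category.assoc]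
      simp only [e]
      simp only [← slideForm_sum_right, ← Preadditive.comp_sum, ← sum_whiskerRight, ← h' l,
        MonoidalCategory.id_whiskerRight, Category.comp_id]
    _ = _ := by
      simp [traceSum, whiskerLeft_sum, Preadditive.comp_sum]

end FusionStructure


/-! ### The coaction of the center on the unit summand -/

section

variable {C : Type u} [Category.{v} C] [MonoidalCategory C] [RightRigidCategory C]
  (S : SovereignStructure C)

theorem partialTrace_conj {A : C} {T : ∀ V : C, V ⟶ V ⊗ A}
    (hT : ∀ {V W : C} (f : V ⟶ W), f ≫ T W = T V ≫ f ▷ A) (V : C) {N N' : C} (e : N ≅ N') :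
    S.partialTrace V (T (V ⊗ N) ≫ (α_ _ _ _).hom) =
      e.hom ≫ S.partialTrace V (T (V ⊗ N') ≫ (α_ _ _ _).hom) ≫ e.inv ▷ A := by
  rw [← S.partialTrace_whiskerLeft_comp, ← Category.assoc, ← Category.assoc, hT]
  congr 1
  simp only [Category.assoc, whisker_assoc, Iso.inv_hom_id_assoc]
  rw [← MonoidalCategory.whiskerLeft_comp, ← comp_whiskerRight, Iso.hom_inv_id]
  simp

end

section

variable {C : Type u} [Category.{v} C] [MonoidalCategory C]

theorem halfBraiding_coaction {M : C} (b : HalfBraiding M) {V A : C} (T : V ⟶ V ⊗ A) :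
    M ◁ T ≫ (α_ _ _ _).inv ≫ (b.β V).hom ▷ A =
      (b.β V).hom ≫ T ▷ M ≫ (α_ _ _ _).hom ≫ V ◁ (b.β A).inv ≫ (α_ _ _ _).inv := by
  have h := b.naturality T
  rw [b.monoidal] at h
  rw [← reassoc_of% h]
  simp

theorem halfBraiding_element {M : C} (b : HalfBraiding M) {A : C} (L : 𝟙_ C ⟶ A) :
    L ▷ M ≫ (b.β A).inv = (λ_ M).hom ≫ (ρ_ M).inv ≫ M ◁ L := by
  have h := b.naturality L
  rw [halfBraiding_unit] at h
  rw [Iso.comp_inv_eq]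
  simp only [Category.assoc, h]
  simp

end

theorem antiCoact_eq {B : Type u} [Category.{v} B] [MonoidalCategory B] [BraidedCategory B]
    [RightRigidCategory B] {A : B} (δ : ∀ X : B, X ⟶ X ⊗ A) (X : B) :
    antiCoact δ X = (λ_ X).inv ≫ η_ X (rdual X) ▷ X ≫ (α_ X (rdual X) X).hom ≫
      X ◁ δ (rdual X) ▷ X ≫ X ◁ (α_ (rdual X) A X).hom ≫ X ◁ rdual X ◁ (β_ A X).hom ≫
      X ◁ (α_ (rdual X) X A).inv ≫ X ◁ ε_ X (rdual X) ▷ A ≫ X ◁ (λ_ A).hom := by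
  dsimp only [antiCoact]
  monoidal

namespace FusionStructure

variable {k : Type*} [CommRing k] {C : Type u} [Category.{v} C] [Preadditive C] [Linear k C]
  [MonoidalCategory C] [MonoidalPreadditive C] [MonoidalLinear k C] [HasFiniteBiproducts C]
  [RigidCategory C] {I : Type w} [Fintype I] (D : FusionStructure k C I)

/-- The multiplication of the coend, as a morphism of `C`. -/
def coendMul : D.coendObj ⊗ D.coendObj ⟶ D.coendObj := D.isUniversalCoaction_coactC.mul.f

/-- The counit of the coend, as a morphism of `C`. -/
def coendCounit : D.coendObj ⟶ 𝟙_ C := D.isUniversalCoaction_coactC.counit.f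

/-- The antipode of the coend, as a morphism of `C`. -/
def coendAntipode : D.coendObj ⟶ D.coendObj := D.isUniversalCoaction_coactC.antipode.f

/-- The Hopf identities are transcribed to `C` because they have to be composed with morphisms not
known to be central, such as `freeUnit` and `freeCounit`. -/
theorem coactC_tensor_f (M N : Center C) :
    D.coact (tensorHalfBraiding M.2 N.2) = 𝟙 _ ⊗≫ D.coact M.2 ▷ N.1 ⊗≫
      M.1 ◁ D.coendObj ◁ D.coact N.2 ⊗≫
      M.1 ◁ (D.coendHalfBraiding.β N.1).hom ▷ D.coendObj ⊗≫ (M.1 ⊗ N.1) ◁ D.coendMul := by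
  have h := D.isUniversalCoaction_coactC.coact_mul M N
  rw [MonoidalCategory.tensorHom_def] at h
  have h := congr_arg Center.Hom.f h
  simp only [tensorμ, Center.comp_f, Center.whiskerLeft_f, Center.whiskerRight_f,
    Center.associator_inv_f, Center.associator_hom_f] at h
  refine Eq.trans (Eq.symm (h : (D.coact M.2 ▷ N.1 ≫ (M.1 ⊗ D.coendObj) ◁ D.coact N.2) ≫
    ((α_ M.1 D.coendObj (N.1 ⊗ D.coendObj)).hom ≫
    M.1 ◁ (α_ D.coendObj N.1 D.coendObj).inv ≫
    M.1 ◁ (D.coendHalfBraiding.β N.1).hom ▷ D.coendObj ≫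
    M.1 ◁ (α_ N.1 D.coendObj D.coendObj).hom ≫ (α_ M.1 N.1 (D.coendObj ⊗ D.coendObj)).inv) ≫
      (M.1 ⊗ N.1) ◁ D.coendMul = D.coact (tensorHalfBraiding M.2 N.2))) ?_
  monoidal

theorem coact_tensor {M N : C} (b : HalfBraiding M) (b' : HalfBraiding N) :
    D.coact (tensorHalfBraiding b b') = 𝟙 _ ⊗≫ D.coact b ▷ N ⊗≫ M ◁ D.coendObj ◁ D.coact b' ⊗≫
      M ◁ (D.coendHalfBraiding.β N).hom ▷ D.coendObj ⊗≫ (M ⊗ N) ◁ D.coendMul :=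
  D.coactC_tensor_f ⟨M, b⟩ ⟨N, b'⟩

theorem coactC_antipode_f (M : Center C) :
    D.coact M.2 ≫ M.1 ◁ D.coendAntipode = 𝟙 _ ⊗≫ η_ M.1 (rdual M.1) ▷ M.1 ⊗≫
      M.1 ◁ D.coact (dualHalfBraiding M.2 (rdual M.1)) ▷ M.1 ⊗≫
      M.1 ◁ rdual M.1 ◁ (D.coendHalfBraiding.β M.1).hom ⊗≫
      M.1 ◁ ε_ M.1 (rdual M.1) ▷ D.coendObj ⊗≫ 𝟙 _ := by
  have h := D.isUniversalCoaction_coactC.coact_antipode M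
  have e : antiCoact D.coactC M = (λ_ M).inv ≫ η_ M (rdual M) ▷ M ≫
      (α_ M (rdual M) M).hom ≫ M ◁ D.coactC (rdual M) ▷ M ≫ M ◁ (α_ (rdual M) D.coendC M).hom ≫
      M ◁ rdual M ◁ (β_ D.coendC M).hom ≫ M ◁ (α_ (rdual M) M D.coendC).inv ≫
      M ◁ ε_ M (rdual M) ▷ D.coendC ≫ M ◁ (λ_ D.coendC).hom := by
    exact antiCoact_eq D.coactC M
  rw [e] at h
  have h := congr_arg Center.Hom.f h
  simp only [Center.comp_f, Center.whiskerLeft_f, Center.whiskerRight_f,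
    Center.associator_inv_f, Center.associator_hom_f, Center.leftUnitor_hom_f,
    Center.leftUnitor_inv_f] at h
  refine Eq.trans (h : D.coact M.2 ≫ M.1 ◁ D.coendAntipode =
    (λ_ M.1).inv ≫ η_ M.1 (rdual M.1) ▷ M.1 ≫ (α_ M.1 (rdual M.1) M.1).hom ≫
    M.1 ◁ D.coact (dualHalfBraiding M.2 (rdual M.1)) ▷ M.1 ≫
    M.1 ◁ (α_ (rdual M.1) D.coendObj M.1).hom ≫
    M.1 ◁ rdual M.1 ◁ (D.coendHalfBraiding.β M.1).hom ≫
    M.1 ◁ (α_ (rdual M.1) M.1 D.coendObj).inv ≫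
    M.1 ◁ ε_ M.1 (rdual M.1) ▷ D.coendObj ≫ M.1 ◁ (λ_ D.coendObj).hom) ?_
  monoidal

theorem coact_antipode {M : C} (b : HalfBraiding M) :
    D.coact b ≫ M ◁ D.coendAntipode = 𝟙 _ ⊗≫ η_ M (rdual M) ▷ M ⊗≫
      M ◁ D.coact (dualHalfBraiding b (rdual M)) ▷ M ⊗≫
      M ◁ rdual M ◁ (D.coendHalfBraiding.β M).hom ⊗≫ M ◁ ε_ M (rdual M) ▷ D.coendObj ⊗≫ 𝟙 _ :=
  D.coactC_antipode_f ⟨M, b⟩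

theorem coactC_counit_f (M : Center C) : D.coact M.2 ≫ M.1 ◁ D.coendCounit = (ρ_ M.1).inv := by
  have h := congr_arg Center.Hom.f (D.isUniversalCoaction_coactC.coact_counit M)
  simp only [Center.comp_f, Center.whiskerLeft_f, Center.rightUnitor_inv_f] at h
  exact h

theorem coact_counit {M : C} (b : HalfBraiding M) :
    D.coact b ≫ M ◁ D.coendCounit = (ρ_ M).inv :=
  D.coactC_counit_f ⟨M, b⟩

theorem coendMul_antipode : D.coendMul ≫ D.coendAntipode =
    (D.coendAntipode ▷ D.coendObj ≫ D.coendObj ◁ D.coendAntipode) ≫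
      (D.coendHalfBraiding.β D.coendObj).hom ≫ D.coendMul := by
  have h := congr_arg Center.Hom.f D.isUniversalCoaction_coactC.mul_antipode
  rw [MonoidalCategory.tensorHom_def] at h
  exact h

theorem coact_hom_ext {X : C} {h h' : D.coendObj ⟶ X}
    (H : ∀ (M : C) (b : HalfBraiding M), D.coact b ≫ M ◁ h = D.coact b ≫ M ◁ h') : h = h' := by
  refine (D.coact_existsUnique (fun M b => D.coact b ≫ M ◁ h') fun {M N b b' f} hf => ?_).unique
    H fun _ _ => rfl
  rw [← Category.assoc, D.coact_naturality hf, Category.assoc, Category.assoc, ← whisker_exchange]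

/-- The component `V ⟶ V ⊗ A` of the coaction on the free object over `V` between the unit and the
counit of the free object. -/
def unitCoact (V : C) : V ⟶ V ⊗ D.coendObj := D.freeCoact V ≫ D.freeCounit V ▷ D.coendObj

theorem unitCoact_naturality {V W : C} (f : V ⟶ W) :
    f ≫ D.unitCoact W = D.unitCoact V ≫ f ▷ D.coendObj := by
  dsimp only [unitCoact]
  rw [← Category.assoc, freeCoact_naturality, Category.assoc, Category.assoc, ← comp_whiskerRight,
    freeCounit_naturality, comp_whiskerRight]

/-- Coactions are natural along the central morphism `freeLift b x`, so `M` with the pair `x`, `y`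
can replace the free object with its unit and counit. -/
theorem unitCoact_eq {V M : C} (b : HalfBraiding M) (x : V ⟶ M) (y : M ⟶ V)
    (h : D.freeLift b x ≫ y = D.freeCounit V) :
    D.unitCoact V = x ≫ D.coact b ≫ y ▷ D.coendObj := by
  dsimp only [unitCoact]
  rw [← freeUnit_coact, ← h, comp_whiskerRight, Category.assoc,
    ← reassoc_of% (D.coact_naturality (D.freeLift_central b x)),
    reassoc_of% (D.freeUnit_freeLift b x)]

/-- By universality of the free object this is an identity of natural families `V ⊗ Y ⟶ Y ⊗ V`. It
suffices to compare them at the unit and to check vanishing at the other `V i`. -/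
theorem freeLift_comp_eq_freeCounit {V M : C} (b : HalfBraiding M) (x : V ⟶ M) (y : M ⟶ V)
    (h : x ≫ y = 𝟙 V)
    (h' : ∀ i, i ≠ D.zero → x ▷ D.V i ≫ (b.β (D.V i)).hom ≫ D.V i ◁ y = 0) :
    D.freeLift b x ≫ y = D.freeCounit V := by
  let t : tensorLeft V ⟶ 𝟭 C ⋙ tensorRight V :=
    { app := fun Y => x ▷ Y ≫ (b.β Y).hom ≫ Y ◁ y
      naturality := fun Y Y' f => by
        dsimp
        have n := b.naturality f
        rw [whisker_exchange_assoc, reassoc_of% n, Category.assoc, Category.assoc,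
          ← whisker_exchange] }
  have ht : t = D.unitSwap V := by
    refine D.nat_ext_unit ?_ h' fun i hi => D.unitSwap_of_ne V hi
    rw [unitSwap_unit]
    dsimp [t]
    rw [halfBraiding_unit]
    calc
      _ = (ρ_ V).hom ≫ (x ≫ y) ≫ (λ_ V).inv := by monoidal
      _ = _ := by rw [h, Category.id_comp]
  refine D.freeMap_hom_ext fun Y => ?_
  rw [freeMap_freeCounit, ← ht, MonoidalCategory.whiskerLeft_comp, ← Category.assoc,
    freeMap_freeLift, Category.assoc]

/-- The natural family `V ⊗ Y ⟶ Y ⊗ V` supported on the unit object. -/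
def unitSwapMap (V Y : C) : V ⊗ Y ⟶ Y ⊗ V := (D.unitSwap V).app Y

theorem unitSwapMap_eq (V Y : C) : D.unitSwapMap V Y =
    D.freeUnit V ▷ Y ≫ ((D.freeHalfBraiding V).β Y).hom ≫ Y ◁ D.freeCounit V := by
  have h := D.freeMap_freeCounit V Y
  rw [freeMap_eq, Category.assoc] at h
  exact h.symm

theorem unitSwapMap_of_ne (V : C) {i : I} (h : i ≠ D.zero) : D.unitSwapMap V (D.V i) = 0 :=
  D.unitSwap_of_ne V h

/-- `F V ⊗ N` serves as a model for `V ⊗ N`, since the half-braiding of `N` does not interfere with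
the support condition. On this model the coaction is a product. -/
theorem unitCoact_tensor_right (V : C) {N : C} (b : HalfBraiding N) :
    D.unitCoact (V ⊗ N) = 𝟙 _ ⊗≫ D.unitCoact V ▷ N ⊗≫ V ◁ D.coendObj ◁ D.coact b ⊗≫
      V ◁ (D.coendHalfBraiding.β N).hom ▷ D.coendObj ⊗≫ (V ⊗ N) ◁ D.coendMul := by
  have key : ∀ Y, (D.freeUnit V ▷ N) ▷ Y ≫
      ((tensorHalfBraiding (D.freeHalfBraiding V) b).β Y).hom ≫ Y ◁ (D.freeCounit V ▷ N) =
      𝟙 _ ⊗≫ V ◁ (b.β Y).hom ⊗≫ D.unitSwapMap V Y ▷ N ⊗≫ 𝟙 _ := by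
    intro Y
    rw [tensorHalfBraiding_hom, unitSwapMap_eq]
    calc
      _ = 𝟙 _ ⊗≫ (D.freeUnit V ▷ (N ⊗ Y) ≫ D.freeObj V ◁ (b.β Y).hom) ⊗≫
        ((D.freeHalfBraiding V).β Y).hom ▷ N ⊗≫ Y ◁ D.freeCounit V ▷ N ⊗≫ 𝟙 _ := by monoidal
      _ = _ := by rw [← whisker_exchange]; monoidal
  rw [D.unitCoact_eq (tensorHalfBraiding (D.freeHalfBraiding V) b) (D.freeUnit V ▷ N)
    (D.freeCounit V ▷ N) (D.freeLift_comp_eq_freeCounit _ _ _ ?_ ?_), coact_tensor]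
  · rw [unitCoact, ← freeUnit_coact]
    calc
      _ = 𝟙 _ ⊗≫ D.freeUnit V ▷ N ⊗≫ D.coact (D.freeHalfBraiding V) ▷ N ⊗≫
        (D.freeObj V ◁ (𝟙 (D.coendObj ⊗ N) ⊗≫ D.coendObj ◁ D.coact b ⊗≫
          (D.coendHalfBraiding.β N).hom ▷ D.coendObj ⊗≫ N ◁ D.coendMul) ≫
          D.freeCounit V ▷ (N ⊗ D.coendObj)) ⊗≫ 𝟙 _ := by monoidal
      _ = _ := by rw [whisker_exchange]; monoidal
  · rw [← comp_whiskerRight, freeUnit_freeCounit, MonoidalCategory.id_whiskerRight]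
  · intro i hi
    rw [key, unitSwapMap_of_ne _ _ hi]
    simp [monoidalComp]

theorem unitCoact_tensor_left {N : C} (b : HalfBraiding N) (V : C) :
    D.unitCoact (N ⊗ V) = 𝟙 _ ⊗≫ D.coact b ▷ V ⊗≫ N ◁ D.coendObj ◁ D.unitCoact V ⊗≫
      N ◁ (D.coendHalfBraiding.β V).hom ▷ D.coendObj ⊗≫ (N ⊗ V) ◁ D.coendMul := by
  have key : ∀ Y, (N ◁ D.freeUnit V) ▷ Y ≫
      ((tensorHalfBraiding b (D.freeHalfBraiding V)).β Y).hom ≫ Y ◁ (N ◁ D.freeCounit V) =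
      𝟙 _ ⊗≫ N ◁ D.unitSwapMap V Y ⊗≫ (b.β Y).hom ▷ V ⊗≫ 𝟙 _ := by
    intro Y
    rw [tensorHalfBraiding_hom, unitSwapMap_eq]
    calc
      _ = 𝟙 _ ⊗≫ N ◁ D.freeUnit V ▷ Y ⊗≫ N ◁ ((D.freeHalfBraiding V).β Y).hom ⊗≫
        ((b.β Y).hom ▷ D.freeObj V ≫ (Y ⊗ N) ◁ D.freeCounit V) ⊗≫ 𝟙 _ := by monoidal
      _ = _ := by rw [← whisker_exchange]; monoidal
  rw [D.unitCoact_eq (tensorHalfBraiding b (D.freeHalfBraiding V)) (N ◁ D.freeUnit V)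
    (N ◁ D.freeCounit V) (D.freeLift_comp_eq_freeCounit _ _ _ ?_ ?_), coact_tensor]
  · rw [unitCoact, ← freeUnit_coact]
    have n₁ := D.coendHalfBraiding.naturality (D.freeCounit V)
    calc
      _ = 𝟙 _ ⊗≫ (N ◁ D.freeUnit V ≫ D.coact b ▷ D.freeObj V) ⊗≫
        N ◁ (D.coendObj ◁ D.coact (D.freeHalfBraiding V) ⊗≫
          (D.coendHalfBraiding.β (D.freeObj V)).hom ▷ D.coendObj ⊗≫
          (D.freeObj V ◁ D.coendMul ≫ D.freeCounit V ▷ D.coendObj)) ⊗≫ 𝟙 _ := by monoidal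
      _ = 𝟙 _ ⊗≫ D.coact b ▷ V ⊗≫ N ◁ D.coendObj ◁ D.freeUnit V ⊗≫
        N ◁ (D.coendObj ◁ D.coact (D.freeHalfBraiding V) ⊗≫
          ((D.coendHalfBraiding.β (D.freeObj V)).hom ≫
            D.freeCounit V ▷ D.coendObj) ▷ D.coendObj ⊗≫ V ◁ D.coendMul) ⊗≫ 𝟙 _ := by
        rw [whisker_exchange, whisker_exchange]; monoidal
      _ = _ := by rw [← n₁]; monoidal
  · rw [← MonoidalCategory.whiskerLeft_comp, freeUnit_freeCounit, MonoidalCategory.whiskerLeft_id]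
  · intro i hi
    rw [key, unitSwapMap_of_ne _ _ hi]
    simp [monoidalComp]

end FusionStructure


/-! ### The integral -/

namespace FusionStructure

variable {k : Type*} [CommRing k] {C : Type u} [Category.{v} C] [Preadditive C] [Linear k C]
  [MonoidalCategory C] [MonoidalPreadditive C] [MonoidalLinear k C] [HasFiniteBiproducts C]
  [RigidCategory C] {I : Type w} [Fintype I] (D : FusionStructure k C I) (S : SovereignStructure C)

/-- The trace of the coaction on `V`. -/
def coactTrace (V : C) : 𝟙_ C ⟶ D.coendObj := traceElt S D.unitCoact V

/-- The integral, as a weighted sum of traces. -/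
def traceIntegral : 𝟙_ C ⟶ D.coendObj := D.traceSum S D.unitCoact

theorem traceIntegral_eq :
    D.traceIntegral S = ∑ j, D.dimScalar S j • D.coactTrace S (D.V j) := rfl

theorem sum_partialTrace (hS : S.IsSpherical) (N : C) :
    ∑ j, D.dimScalar S j • S.partialTrace (D.V j) (D.unitCoact (D.V j ⊗ N) ≫ (α_ _ _ _).hom) =
      (ρ_ N).inv ≫ N ◁ D.traceIntegral S := by
  -- The slide formula holds for dual strands. With `W = Nᘁ` it concerns `Nᘁᘁ`, and `φ` brings it
  -- back to `N`.
  have h := D.sum_slideForm_rdual S D.unitCoact D.unitCoact_naturality hS (rdual N)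
  simp only [slideForm, Category.id_comp, MonoidalCategory.id_whiskerRight] at h
  have e := fun j => partialTrace_conj S D.unitCoact_naturality (D.V j) (S.φ N)
  simp only [e]
  calc
    _ = (S.φ N).hom ≫ (∑ j, D.dimScalar S j • S.partialTrace (D.V j)
        (D.unitCoact (D.V j ⊗ rdual (rdual N)) ≫ (α_ _ _ _).hom)) ≫
          (S.φ N).inv ▷ D.coendObj := by
      simp [Preadditive.sum_comp, Preadditive.comp_sum]
    _ = (ρ_ N).inv ≫ ((S.φ N).hom ▷ 𝟙_ C ≫ rdual (rdual N) ◁ D.traceIntegral S) ≫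
          (S.φ N).inv ▷ D.coendObj := by
      refine (congr_arg (fun t => _ ≫ t ≫ _) h).trans ?_
      change (S.φ N).hom ≫ ((ρ_ _).inv ≫ _ ◁ D.traceIntegral S) ≫ _ = _
      simp
    _ = _ := by
      rw [← whisker_exchange, Category.assoc, ← comp_whiskerRight, Iso.hom_inv_id]
      simp

theorem partialTrace_unitCoact (V : C) {N : C} (b : HalfBraiding N) :
    S.partialTrace V (D.unitCoact (V ⊗ N) ≫ (α_ _ _ _).hom) =
      (λ_ N).inv ≫ D.coactTrace S V ▷ N ≫ D.coendObj ◁ D.coact b ⊗≫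
        (D.coendHalfBraiding.β N).hom ▷ D.coendObj ⊗≫ N ◁ D.coendMul := by
  rw [D.unitCoact_tensor_right V b]
  dsimp only [coactTrace, traceElt, SovereignStructure.partialTrace]
  calc
    _ = 𝟙 _ ⊗≫ S.coev V ▷ N ⊗≫ rdual V ◁ D.unitCoact V ▷ N ⊗≫
      ((rdual V ⊗ V) ◁ (𝟙 (D.coendObj ⊗ N) ⊗≫ D.coendObj ◁ D.coact b ⊗≫
        (D.coendHalfBraiding.β N).hom ▷ D.coendObj ⊗≫ N ◁ D.coendMul) ≫
        ε_ V (rdual V) ▷ (N ⊗ D.coendObj)) ⊗≫ 𝟙 _ := by monoidal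
    _ = _ := by rw [whisker_exchange]; monoidal

/-- The half-braiding `b` exchanges `V ⊗ N` with `N ⊗ V`, so that `N` coacts first and the trace
over `V` multiplies from the right. -/
theorem partialTrace_unitCoact' (V : C) {N : C} (b : HalfBraiding N) :
    S.partialTrace V (D.unitCoact (V ⊗ N) ≫ (α_ _ _ _).hom) =
      D.coact b ≫ N ◁ ((ρ_ _).inv ≫ D.coendObj ◁ D.coactTrace S V ≫ D.coendMul) := by
  have hT : D.unitCoact (V ⊗ N) = (b.β V).inv ≫ D.unitCoact (N ⊗ V) ≫ (b.β V).hom ▷ D.coendObj := by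
    rw [Iso.eq_inv_comp, D.unitCoact_naturality]
  have h₁ := halfBraiding_coaction b (D.unitCoact V)
  have h₂ := halfBraiding_coaction D.coendHalfBraiding (D.unitCoact V)
  have h₃ := D.coact_coendBraid' b V
  have h₄ := halfBraiding_element b (D.coactTrace S V)
  have h₅ := halfBraiding_element D.coendHalfBraiding (D.coactTrace S V)
  have key : D.unitCoact (V ⊗ N) = 𝟙 _ ⊗≫ V ◁ D.coact b ⊗≫ D.unitCoact V ▷ (N ⊗ D.coendObj) ⊗≫
      V ◁ (b.β D.coendObj).inv ▷ D.coendObj ⊗≫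
      V ◁ N ◁ ((D.coendHalfBraiding.β D.coendObj).inv ≫ D.coendMul) ⊗≫ 𝟙 _ := by
    rw [hT, D.unitCoact_tensor_left b V, Iso.inv_comp_eq]
    calc
      _ = 𝟙 _ ⊗≫ D.coact b ▷ V ⊗≫ N ◁ (D.coendObj ◁ D.unitCoact V ≫ (α_ _ _ _).inv ≫
          (D.coendHalfBraiding.β V).hom ▷ D.coendObj) ⊗≫
          ((N ⊗ V) ◁ D.coendMul ≫ (b.β V).hom ▷ D.coendObj) ⊗≫ 𝟙 _ := by monoidal
      _ = 𝟙 _ ⊗≫ D.coact b ▷ V ⊗≫ N ◁ (D.coendHalfBraiding.β V).hom ⊗≫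
          N ◁ D.unitCoact V ▷ D.coendObj ⊗≫
          ((N ⊗ V) ◁ (D.coendHalfBraiding.β D.coendObj).inv ≫
          (b.β V).hom ▷ (D.coendObj ⊗ D.coendObj)) ⊗≫ (V ⊗ N) ◁ D.coendMul ⊗≫ 𝟙 _ := by
        rw [h₂, whisker_exchange]; monoidal
      _ = 𝟙 _ ⊗≫ D.coact b ▷ V ⊗≫ N ◁ (D.coendHalfBraiding.β V).hom ⊗≫
          (N ◁ D.unitCoact V ≫ (α_ _ _ _).inv ≫ (b.β V).hom ▷ D.coendObj) ▷ D.coendObj ⊗≫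
          (V ⊗ N) ◁ (D.coendHalfBraiding.β D.coendObj).inv ⊗≫
          (V ⊗ N) ◁ D.coendMul ⊗≫ 𝟙 _ := by
        rw [whisker_exchange]; monoidal
      _ = 𝟙 _ ⊗≫ (D.coact b ▷ V ≫ (α_ _ _ _).hom ≫ N ◁ D.coendBraid V ≫ (α_ _ _ _).inv ≫
          (b.β V).hom ▷ D.coendObj ≫ (α_ _ _ _).hom) ⊗≫ D.unitCoact V ▷ (N ⊗ D.coendObj) ⊗≫
          V ◁ (b.β D.coendObj).inv ▷ D.coendObj ⊗≫
          (V ⊗ N) ◁ (D.coendHalfBraiding.β D.coendObj).inv ⊗≫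
          (V ⊗ N) ◁ D.coendMul ⊗≫ 𝟙 _ := by
        rw [h₁]
        change 𝟙 _ ⊗≫ D.coact b ▷ V ⊗≫ N ◁ D.coendBraid V ⊗≫ _ = _
        monoidal
      _ = _ := by rw [h₃]; monoidal
  rw [key]
  dsimp only [SovereignStructure.partialTrace]
  calc
    _ = 𝟙 _ ⊗≫ (S.coev V ▷ N ≫ (rdual V ⊗ V) ◁ D.coact b) ⊗≫
        rdual V ◁ D.unitCoact V ▷ (N ⊗ D.coendObj) ⊗≫
      ((rdual V ⊗ V) ◁ (𝟙 (D.coendObj ⊗ N ⊗ D.coendObj) ⊗≫ (b.β D.coendObj).inv ▷ D.coendObj ⊗≫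
        N ◁ ((D.coendHalfBraiding.β D.coendObj).inv ≫ D.coendMul)) ≫
        ε_ V (rdual V) ▷ (N ⊗ D.coendObj)) ⊗≫ 𝟙 _ := by monoidal
    _ = 𝟙 _ ⊗≫ D.coact b ⊗≫ D.coactTrace S V ▷ (N ⊗ D.coendObj) ⊗≫
        (b.β D.coendObj).inv ▷ D.coendObj ⊗≫
        N ◁ ((D.coendHalfBraiding.β D.coendObj).inv ≫ D.coendMul) := by
      rw [← whisker_exchange, whisker_exchange (ε_ V (rdual V))]
      dsimp only [coactTrace, traceElt]
      monoidal
    _ = 𝟙 _ ⊗≫ D.coact b ⊗≫ (D.coactTrace S V ▷ N ≫ (b.β D.coendObj).inv) ▷ D.coendObj ⊗≫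
        N ◁ ((D.coendHalfBraiding.β D.coendObj).inv ≫ D.coendMul) := by monoidal
    _ = 𝟙 _ ⊗≫ D.coact b ⊗≫ N ◁ (D.coactTrace S V ▷ D.coendObj ≫
          (D.coendHalfBraiding.β D.coendObj).inv) ⊗≫ N ◁ D.coendMul := by
      rw [h₄]; monoidal
    _ = _ := by rw [h₅]; monoidal

/-- Not yet the left integral property: the crossing of Λ with `N` remains until Λ is known to be
central. -/
theorem traceIntegral_coact (hS : S.IsSpherical) {N : C} (b : HalfBraiding N) :
    (λ_ N).inv ≫ D.traceIntegral S ▷ N ≫ D.coendObj ◁ D.coact b ⊗≫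
        (D.coendHalfBraiding.β N).hom ▷ D.coendObj ⊗≫ N ◁ D.coendMul =
      (ρ_ N).inv ≫ N ◁ D.traceIntegral S := by
  rw [← D.sum_partialTrace S hS N]
  simp only [D.partialTrace_unitCoact S _ b, traceIntegral_eq]
  simp [monoidalComp, sum_whiskerRight, Preadditive.sum_comp, Preadditive.comp_sum]

/-- The integral is a right integral. -/
theorem traceIntegral_right (hS : S.IsSpherical) :
    (ρ_ _).inv ≫ D.coendObj ◁ D.traceIntegral S ≫ D.coendMul =
      D.coendCounit ≫ D.traceIntegral S := by
  refine D.coact_hom_ext fun N b => ?_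
  rw [MonoidalCategory.whiskerLeft_comp N D.coendCounit, ← Category.assoc (D.coact b) (N ◁ D.coendCounit),
    D.coact_counit, ← D.sum_partialTrace S hS N]
  simp only [D.partialTrace_unitCoact' S _ b, traceIntegral_eq]
  simp [whiskerLeft_sum, Preadditive.sum_comp, Preadditive.comp_sum]

end FusionStructure


/-! ### Invariance of the integral under the antipode -/

namespace FusionStructure

variable {k : Type*} [CommRing k] {C : Type u} [Category.{v} C] [Preadditive C] [Linear k C]
  [MonoidalCategory C] [MonoidalPreadditive C] [MonoidalLinear k C] [HasFiniteBiproducts C]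
  [RigidCategory C] {I : Type w} [Fintype I] (D : FusionStructure k C I) (S : SovereignStructure C)

-- By transposition, Hom(ᘁV_i, 𝟙) is Hom(𝟙, V_i), which vanishes.
include D in
theorem leftDual_hom_eq_zero {i : I} (hi : i ≠ D.zero) (f : (ᘁ(D.V i) : C) ⟶ 𝟙_ C) : f = 0 := by
  have h : η_ (ᘁ(D.V i) : C) (D.V i) ≫ f ▷ D.V i ≫ (λ_ _).hom = 0 := D.unit_hom_eq_zero hi _
  have h' : η_ (ᘁ(D.V i) : C) (D.V i) ≫ f ▷ D.V i = 0 := by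
    rw [← cancel_mono (λ_ (D.V i)).hom, Category.assoc, h, Limits.zero_comp]
  calc
    f = 𝟙 _ ⊗≫ (η_ (ᘁ(D.V i) : C) (D.V i) ▷ (ᘁ(D.V i) : C) ⊗≫
          (ᘁ(D.V i) : C) ◁ ε_ (ᘁ(D.V i) : C) (D.V i)) ⊗≫ f ⊗≫ 𝟙 _ := by
      rw [ExactPairing.evaluation_coevaluation'']; monoidal
    _ = 𝟙 _ ⊗≫ η_ (ᘁ(D.V i) : C) (D.V i) ▷ (ᘁ(D.V i) : C) ⊗≫
        ((ᘁ(D.V i) : C) ◁ ε_ (ᘁ(D.V i) : C) (D.V i) ≫ f ▷ 𝟙_ C) ⊗≫ 𝟙 _ := by monoidal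
    _ = (λ_ _).inv ≫ (η_ (ᘁ(D.V i) : C) (D.V i) ≫ f ▷ D.V i) ▷ (ᘁ(D.V i) : C) ≫
        ((α_ _ _ _).hom ≫ 𝟙_ C ◁ ε_ (ᘁ(D.V i) : C) (D.V i) ≫ (λ_ _).hom) := by
      rw [whisker_exchange]; monoidal
    _ = 0 := by
      rw [h', MonoidalPreadditive.zero_whiskerRight, Limits.zero_comp, Limits.comp_zero]

/-- The inverse half-braiding at `V i` is the transpose of the half-braiding at its left dual, so
the composite is a transpose of `unitSwapMap` there, which vanishes. -/
theorem freeUnit_inv_freeCounit {i : I} (hi : i ≠ D.zero) (V : C) :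
    D.V i ◁ D.freeUnit V ≫ ((D.freeHalfBraiding V).β (D.V i)).inv ≫ D.freeCounit V ▷ D.V i = 0 := by
  have h : D.unitSwapMap V (ᘁ(D.V i) : C) = 0 :=
    D.unitSwap_eq_zero V _ (D.leftDual_hom_eq_zero hi)
  rw [halfBraiding_inv_eq _ (ᘁ(D.V i) : C) (D.V i)]
  generalize D.V i = Y at *
  calc
    _ = 𝟙 _ ⊗≫ Y ◁ (D.freeUnit V ▷ 𝟙_ C ≫ D.freeObj V ◁ η_ (ᘁY : C) Y) ⊗≫
        Y ◁ ((D.freeHalfBraiding V).β (ᘁY : C)).hom ▷ Y ⊗≫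
        (ε_ (ᘁY : C) Y ▷ D.freeObj V ≫ 𝟙_ C ◁ D.freeCounit V) ▷ Y ⊗≫ 𝟙 _ := by monoidal
    _ = (ρ_ _).inv ≫ (Y ⊗ V) ◁ η_ (ᘁY : C) Y ≫ (α_ _ _ _).hom ≫ Y ◁ (α_ _ _ _).inv ≫
        Y ◁ (D.freeUnit V ▷ (ᘁY : C) ≫ ((D.freeHalfBraiding V).β (ᘁY : C)).hom ≫
          (ᘁY : C) ◁ D.freeCounit V) ▷ Y ≫ Y ◁ (α_ _ _ _).hom ≫ (α_ _ _ _).inv ≫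
        ε_ (ᘁY : C) Y ▷ (V ⊗ Y) ≫ (λ_ _).hom := by
      rw [← whisker_exchange (D.freeUnit V), ← whisker_exchange (ε_ (ᘁY : C) Y)]
      monoidal
    _ = 0 := by
      rw [← unitSwapMap_eq, h]
      simp

/-- The dual of the free object on `V` is a model for `Vᘁ`, with inclusion and projection the mates
of `freeCounit` and `freeUnit`. The dual half-braiding involves the inverse one, so the support
condition is the transpose of `freeUnit_inv_freeCounit`. -/
theorem unitCoact_rdual (V : C) : D.unitCoact (rdual V) =
    rightAdjointMate (D.freeCounit V) ≫
      D.coact (dualHalfBraiding (D.freeHalfBraiding V) (rdual (D.freeObj V))) ≫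
        rightAdjointMate (D.freeUnit V) ▷ D.coendObj := by
  refine D.unitCoact_eq _ _ _ (D.freeLift_comp_eq_freeCounit _ _ _ ?_ fun i hi => ?_)
  · rw [← comp_rightAdjointMate, freeUnit_freeCounit, rightAdjointMate_id]
  · have h := D.freeUnit_inv_freeCounit hi V
    have h₁ := coevaluation_comp_rightAdjointMate (D.freeUnit V)
    have h₂ := rightAdjointMate_comp_evaluation (D.freeCounit V)
    change rightAdjointMate (D.freeCounit V) ▷ D.V i ≫
      dualHalfBraidingHom (D.freeHalfBraiding V) (rdual (D.freeObj V)) (D.V i) ≫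
        D.V i ◁ rightAdjointMate (D.freeUnit V) = 0
    rw [dualHalfBraidingHom]
    generalize D.V i = Y at *
    generalize D.freeHalfBraiding V = b at *
    generalize D.freeUnit V = u at *
    generalize D.freeCounit V = e at *
    generalize D.freeObj V = F at *
    calc
      _ = 𝟙 _ ⊗≫ (rightAdjointMate e ▷ (Y ⊗ 𝟙_ C) ≫ rdual F ◁ (Y ◁ η_ F (rdual F) ⊗≫
            (b.β Y).inv ▷ rdual F)) ⊗≫
          (ε_ F (rdual F) ▷ (Y ⊗ rdual F) ≫ 𝟙_ C ◁ Y ◁ rightAdjointMate u) ⊗≫ 𝟙 _ := by monoidal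
      _ = 𝟙 _ ⊗≫ rdual V ◁ (Y ◁ η_ F (rdual F) ⊗≫
            (b.β Y).inv ▷ rdual F) ⊗≫
            (rightAdjointMate e ▷ (F ⊗ Y ⊗ rdual F) ≫ rdual F ◁ F ◁ Y ◁ rightAdjointMate u) ⊗≫
            ε_ F (rdual F) ▷ (Y ⊗ rdual V) ⊗≫ 𝟙 _ := by
        rw [← whisker_exchange (ε_ F (rdual F)), ← whisker_exchange (rightAdjointMate e)]; monoidal
      _ = 𝟙 _ ⊗≫ rdual V ◁ (Y ◁ η_ F (rdual F) ⊗≫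
            ((b.β Y).inv ▷ rdual F ≫ (F ⊗ Y) ◁ rightAdjointMate u)) ⊗≫
            (rightAdjointMate e ▷ F ≫ ε_ F (rdual F)) ▷ (Y ⊗ rdual V) ⊗≫ 𝟙 _ := by
        rw [← whisker_exchange (rightAdjointMate e)]; monoidal
      _ = 𝟙 _ ⊗≫ rdual V ◁ (Y ◁ (η_ F (rdual F) ≫ F ◁ rightAdjointMate u) ⊗≫
            (b.β Y).inv ▷ rdual V) ⊗≫
            (rightAdjointMate e ▷ F ≫ ε_ F (rdual F)) ▷ (Y ⊗ rdual V) ⊗≫ 𝟙 _ := by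
        rw [← whisker_exchange]; monoidal
      _ = (ρ_ _).inv ≫ (rdual V ⊗ Y) ◁ η_ V (rdual V) ≫ (α_ _ _ _).hom ≫
            rdual V ◁ (α_ _ _ _).inv ≫ rdual V ◁ (Y ◁ u ≫ (b.β Y).inv ≫ e ▷ Y) ▷ rdual V ≫
            rdual V ◁ (α_ _ _ _).hom ≫ (α_ _ _ _).inv ≫ ε_ V (rdual V) ▷ (Y ⊗ rdual V) ≫
            (λ_ _).hom := by
        rw [h₁, h₂]; monoidal
      _ = 0 := by rw [h]; simp

/-- The trace of the coaction on `V`, computed on the right of `V`. -/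
def crossTrace (V : C) : 𝟙_ C ⟶ D.coendObj :=
  𝟙 _ ⊗≫ η_ V (rdual V) ⊗≫ D.unitCoact V ▷ rdual V ⊗≫
    V ◁ (D.coendHalfBraiding.β (rdual V)).hom ⊗≫ S.ev V ▷ D.coendObj ⊗≫ 𝟙 _

/-- The antipode replaces the coaction on the free object by that of its dual, which
`unitCoact_rdual` recognises as `unitCoact` at `Vᘁ`. The loop now closes on the other side of the
strand. -/
theorem coactTrace_antipode (V : C) :
    D.coactTrace S V ≫ D.coendAntipode = D.crossTrace S (rdual V) := by
  have h := D.coact_antipode (D.freeHalfBraiding V)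
  have h₁ := coevaluation_comp_rightAdjointMate (D.freeUnit V)
  have h₁' := rightAdjointMate_comp_evaluation (D.freeUnit V)
  have h₂ := rightAdjointMate_comp_evaluation (D.freeCounit V)
  have h₃ := D.coendHalfBraiding.naturality (D.freeUnit V)
  have h₄ := D.coendHalfBraiding.naturality (S.φ V).hom
  have h₅ := S.whiskerLeft_ev_rdual V
  have h₆ := D.unitCoact_rdual V
  have hQ : D.unitCoact V ≫ V ◁ D.coendAntipode = D.freeUnit V ≫
      (D.coact (D.freeHalfBraiding V) ≫ D.freeObj V ◁ D.coendAntipode) ≫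
        D.freeCounit V ▷ D.coendObj := by
    rw [unitCoact, ← freeUnit_coact]
    simp only [Category.assoc, whisker_exchange]
  have h₇ : rdual V ◁ η_ (D.freeObj V) (rdual (D.freeObj V)) ⊗≫
      (rdual V ◁ D.freeCounit V ≫ ε_ V (rdual V)) ▷ rdual (D.freeObj V) =
      𝟙 _ ⊗≫ rightAdjointMate (D.freeCounit V) ⊗≫ 𝟙 _ := by
    rw [← h₂]
    calc
      _ = 𝟙 _ ⊗≫ (rdual V ◁ η_ (D.freeObj V) (rdual (D.freeObj V)) ≫
        rightAdjointMate (D.freeCounit V) ▷ (D.freeObj V ⊗ rdual (D.freeObj V))) ⊗≫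
        ε_ (D.freeObj V) (rdual (D.freeObj V)) ▷ rdual (D.freeObj V) := by monoidal
      _ = 𝟙 _ ⊗≫ rightAdjointMate (D.freeCounit V) ⊗≫
        (rdual (D.freeObj V) ◁ η_ (D.freeObj V) (rdual (D.freeObj V)) ⊗≫
        ε_ (D.freeObj V) (rdual (D.freeObj V)) ▷ rdual (D.freeObj V)) := by
        rw [whisker_exchange]; monoidal
      _ = _ := by rw [ExactPairing.coevaluation_evaluation'']; monoidal
  -- All the work except the passage from `V` to `Vᘁᘁ` by `φ`, which the end of the proof performs.
  have h₈ : D.coactTrace S V ≫ D.coendAntipode = S.coev V ⊗≫ D.unitCoact (rdual V) ▷ V ⊗≫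
      rdual V ◁ (D.coendHalfBraiding.β V).hom ⊗≫ ε_ V (rdual V) ▷ D.coendObj ⊗≫ 𝟙 _ := by
    dsimp only [coactTrace, traceElt]
    calc
      _ = S.coev V ⊗≫ rdual V ◁ D.unitCoact V ⊗≫
          (ε_ V (rdual V) ▷ D.coendObj ≫ 𝟙_ C ◁ D.coendAntipode) ⊗≫ 𝟙 _ := by monoidal
      _ = S.coev V ⊗≫ rdual V ◁ (D.unitCoact V ≫ V ◁ D.coendAntipode) ⊗≫
          ε_ V (rdual V) ▷ D.coendObj ⊗≫ 𝟙 _ := by rw [← whisker_exchange]; monoidal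
      _ = S.coev V ⊗≫ rdual V ◁ D.freeUnit V ⊗≫
          rdual V ◁ η_ (D.freeObj V) (rdual (D.freeObj V)) ▷ D.freeObj V ⊗≫
          ((rdual V ⊗ D.freeObj V) ◁ (𝟙 (rdual (D.freeObj V) ⊗ D.freeObj V) ⊗≫
            D.coact (dualHalfBraiding (D.freeHalfBraiding V) (rdual (D.freeObj V))) ▷ D.freeObj V ⊗≫
            rdual (D.freeObj V) ◁ (D.coendHalfBraiding.β (D.freeObj V)).hom ⊗≫
            ε_ (D.freeObj V) (rdual (D.freeObj V)) ▷ D.coendObj ⊗≫ 𝟙 D.coendObj) ≫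
          (rdual V ◁ D.freeCounit V ≫ ε_ V (rdual V)) ▷ D.coendObj) ⊗≫ 𝟙 _ := by
        rw [hQ, h]; monoidal
      _ = S.coev V ⊗≫ rdual V ◁ D.freeUnit V ⊗≫
          (rdual V ◁ η_ (D.freeObj V) (rdual (D.freeObj V)) ⊗≫
            (rdual V ◁ D.freeCounit V ≫ ε_ V (rdual V)) ▷ rdual (D.freeObj V)) ▷ D.freeObj V ⊗≫
            D.coact (dualHalfBraiding (D.freeHalfBraiding V) (rdual (D.freeObj V))) ▷ D.freeObj V ⊗≫
            rdual (D.freeObj V) ◁ (D.coendHalfBraiding.β (D.freeObj V)).hom ⊗≫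
            ε_ (D.freeObj V) (rdual (D.freeObj V)) ▷ D.coendObj ⊗≫ 𝟙 D.coendObj := by
        rw [whisker_exchange]; monoidal
      _ = S.coev V ⊗≫ (rdual V ◁ D.freeUnit V ≫ (rightAdjointMate (D.freeCounit V) ≫
            D.coact (dualHalfBraiding (D.freeHalfBraiding V) (rdual (D.freeObj V)))) ▷
              D.freeObj V) ⊗≫
            rdual (D.freeObj V) ◁ (D.coendHalfBraiding.β (D.freeObj V)).hom ⊗≫
            ε_ (D.freeObj V) (rdual (D.freeObj V)) ▷ D.coendObj ⊗≫ 𝟙 D.coendObj := by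
        rw [h₇]; monoidal
      _ = S.coev V ⊗≫ (rightAdjointMate (D.freeCounit V) ≫
            D.coact (dualHalfBraiding (D.freeHalfBraiding V) (rdual (D.freeObj V)))) ▷ V ⊗≫
            rdual (D.freeObj V) ◁ (D.coendObj ◁ D.freeUnit V ≫
              (D.coendHalfBraiding.β (D.freeObj V)).hom) ⊗≫
            ε_ (D.freeObj V) (rdual (D.freeObj V)) ▷ D.coendObj ⊗≫ 𝟙 D.coendObj := by
        rw [whisker_exchange]; monoidal
      _ = S.coev V ⊗≫ (rightAdjointMate (D.freeCounit V) ≫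
            D.coact (dualHalfBraiding (D.freeHalfBraiding V) (rdual (D.freeObj V)))) ▷ V ⊗≫
            rdual (D.freeObj V) ◁ (D.coendHalfBraiding.β V).hom ⊗≫
            (rdual (D.freeObj V) ◁ D.freeUnit V ≫
              ε_ (D.freeObj V) (rdual (D.freeObj V))) ▷ D.coendObj ⊗≫ 𝟙 D.coendObj := by
        rw [h₃]; monoidal
      _ = S.coev V ⊗≫ (rightAdjointMate (D.freeCounit V) ≫
            D.coact (dualHalfBraiding (D.freeHalfBraiding V) (rdual (D.freeObj V)))) ▷ V ⊗≫
            (rdual (D.freeObj V) ◁ (D.coendHalfBraiding.β V).hom ≫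
            rightAdjointMate (D.freeUnit V) ▷ (V ⊗ D.coendObj)) ⊗≫
              ε_ V (rdual V) ▷ D.coendObj ⊗≫ 𝟙 D.coendObj := by
        rw [← h₁']; monoidal
      _ = S.coev V ⊗≫ (rightAdjointMate (D.freeCounit V) ≫
            D.coact (dualHalfBraiding (D.freeHalfBraiding V) (rdual (D.freeObj V))) ≫
            rightAdjointMate (D.freeUnit V) ▷ D.coendObj) ▷ V ⊗≫
            rdual V ◁ (D.coendHalfBraiding.β V).hom ⊗≫
              ε_ V (rdual V) ▷ D.coendObj ⊗≫ 𝟙 D.coendObj := by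
        rw [whisker_exchange]; monoidal
      _ = _ := by rw [← h₆]
  have h₉ : S.coev V ≫ rdual V ◁ (S.φ V).hom = η_ (rdual V) (rdual (rdual V)) := by
    rw [SovereignStructure.coev, Category.assoc, ← MonoidalCategory.whiskerLeft_comp,
      Iso.inv_hom_id, MonoidalCategory.whiskerLeft_id, Category.comp_id]
  rw [h₈, crossTrace, ← h₅, ← h₉]
  calc
    _ = S.coev V ⊗≫ D.unitCoact (rdual V) ▷ V ⊗≫
      rdual V ◁ ((D.coendHalfBraiding.β V).hom ≫ (S.φ V).hom ▷ D.coendObj) ⊗≫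
        S.ev (rdual V) ▷ D.coendObj ⊗≫ 𝟙 _ := by monoidal
    _ = S.coev V ⊗≫ (D.unitCoact (rdual V) ▷ V ≫
      (rdual V ⊗ D.coendObj) ◁ (S.φ V).hom) ⊗≫
      rdual V ◁ (D.coendHalfBraiding.β (rdual (rdual V))).hom ⊗≫
        S.ev (rdual V) ▷ D.coendObj ⊗≫ 𝟙 _ := by rw [← h₄]; monoidal
    _ = _ := by rw [← whisker_exchange]; monoidal

end FusionStructure


/-! ### Left and right traces of the coaction on a scalar object -/

namespace FusionStructure

variable {k : Type*} [CommRing k] {C : Type u} [Category.{v} C] [Preadditive C] [Linear k C]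
  [MonoidalCategory C] [MonoidalPreadditive C] [MonoidalLinear k C] [HasFiniteBiproducts C]
  [RigidCategory C] {I : Type w} [Fintype I] (D : FusionStructure k C I) (S : SovereignStructure C)

/-- The unit of the free object, rotated around `V`. -/
def rotUnit (V : C) : V ⟶ D.freeObj V :=
  (ρ_ V).inv ≫ V ◁ (η_ V (rdual V) ≫ D.freeUnit V ▷ rdual V ≫
    ((D.freeHalfBraiding V).β (rdual V)).hom) ≫ (α_ _ _ _).inv ≫ S.ev V ▷ D.freeObj V ≫ (λ_ _).hom

/-- The counit of the free object, rotated around `V`. -/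
def rotCounit (V : C) : D.freeObj V ⟶ V :=
  (λ_ _).inv ≫ η_ V (rdual V) ▷ D.freeObj V ≫ (α_ _ _ _).hom ≫
    V ◁ (((D.freeHalfBraiding V).β (rdual V)).inv ≫ D.freeCounit V ▷ rdual V ≫ S.ev V) ≫ (ρ_ V).hom

/-- The half-braidings at `Vᘁ`, `Y` and `V` merge by monoidality into the one at `Vᘁ ⊗ Y ⊗ V`.
Between `freeUnit` and `freeCounit` this is `unitSwapMap`. -/
theorem rotUnit_rotCounit (V Y : C) :
    D.rotUnit S V ▷ Y ≫ ((D.freeHalfBraiding V).β Y).hom ≫ Y ◁ D.rotCounit S V =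
      𝟙 _ ⊗≫ V ◁ η_ V (rdual V) ▷ Y ⊗≫ (V ⊗ V ⊗ rdual V ⊗ Y) ◁ η_ V (rdual V) ⊗≫
        V ◁ D.unitSwapMap V (rdual V ⊗ Y ⊗ V) ▷ rdual V ⊗≫
        S.ev V ▷ (Y ⊗ V ⊗ V ⊗ rdual V) ⊗≫ (Y ⊗ V) ◁ S.ev V ⊗≫ 𝟙 _ := by
  have m₁ := (D.freeHalfBraiding V).monoidal (rdual V) (Y ⊗ V)
  have m₂ := (D.freeHalfBraiding V).monoidal Y V
  -- Beside the coevaluation, the inverse half-braiding at `Vᘁ` is the half-braiding at `V`.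
  have hη : η_ V (rdual V) ▷ D.freeObj V ≫ (α_ _ _ _).hom ≫
      V ◁ ((D.freeHalfBraiding V).β (rdual V)).inv = (λ_ _).hom ≫ (ρ_ _).inv ≫
        D.freeObj V ◁ η_ V (rdual V) ≫ (α_ _ _ _).inv ≫
          ((D.freeHalfBraiding V).β V).hom ▷ rdual V ≫ (α_ _ _ _).hom := by
    have n := (D.freeHalfBraiding V).naturality (η_ V (rdual V))
    rw [halfBraiding_unit, (D.freeHalfBraiding V).monoidal] at n
    rw [← cancel_mono (V ◁ ((D.freeHalfBraiding V).β (rdual V)).hom)]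
    simp only [Category.assoc]
    rw [← MonoidalCategory.whiskerLeft_comp, Iso.inv_hom_id]
    rw [← cancel_mono (α_ _ _ _).inv]
    simp only [Category.assoc, n]
    simp
  rw [unitSwapMap_eq, m₁, m₂]
  dsimp only [rotUnit, rotCounit]
  generalize D.freeHalfBraiding V = b at *
  generalize D.freeUnit V = u at *
  generalize D.freeCounit V = e at *
  generalize D.freeObj V = F at *
  calc
    _ = 𝟙 _ ⊗≫ V ◁ η_ V (rdual V) ▷ Y ⊗≫ V ◁ u ▷ (rdual V ⊗ Y) ⊗≫
        V ◁ (b.β (rdual V)).hom ▷ Y ⊗≫ S.ev V ▷ (F ⊗ Y) ⊗≫ (b.β Y).hom ⊗≫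
        Y ◁ (η_ V (rdual V) ▷ F ≫ (α_ _ _ _).hom ≫ V ◁ (b.β (rdual V)).inv) ⊗≫
        (Y ⊗ V) ◁ e ▷ rdual V ⊗≫ (Y ⊗ V) ◁ S.ev V ⊗≫ 𝟙 _ := by monoidal
    _ = 𝟙 _ ⊗≫ ((𝟙 (V ⊗ Y) ⊗≫ V ◁ η_ V (rdual V) ▷ Y ⊗≫ V ◁ u ▷ (rdual V ⊗ Y) ⊗≫
        V ◁ (b.β (rdual V)).hom ▷ Y ⊗≫ S.ev V ▷ (F ⊗ Y) ⊗≫ (b.β Y).hom) ▷ 𝟙_ C ≫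
        (Y ⊗ F) ◁ η_ V (rdual V)) ⊗≫ Y ◁ (b.β V).hom ▷ rdual V ⊗≫
        (Y ⊗ V) ◁ e ▷ rdual V ⊗≫ (Y ⊗ V) ◁ S.ev V ⊗≫ 𝟙 _ := by rw [hη]; monoidal
    _ = 𝟙 _ ⊗≫ ((V ⊗ Y) ◁ η_ V (rdual V) ≫
          (V ◁ ((λ_ Y).inv ≫ η_ V (rdual V) ▷ Y)) ▷ (V ⊗ rdual V)) ⊗≫
        V ◁ u ▷ (rdual V ⊗ Y ⊗ V ⊗ rdual V) ⊗≫
        V ◁ (b.β (rdual V)).hom ▷ (Y ⊗ V ⊗ rdual V) ⊗≫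
        (S.ev V ▷ (F ⊗ Y ⊗ V ⊗ rdual V) ≫ 𝟙_ C ◁ (𝟙 (F ⊗ Y ⊗ V ⊗ rdual V) ⊗≫
          (b.β Y).hom ▷ (V ⊗ rdual V) ⊗≫ Y ◁ (b.β V).hom ▷ rdual V ⊗≫
        (Y ⊗ V) ◁ e ▷ rdual V ⊗≫ 𝟙 (Y ⊗ V ⊗ V ⊗ rdual V))) ⊗≫ (Y ⊗ V) ◁ S.ev V ⊗≫ 𝟙 _ := by
      rw [← whisker_exchange]; monoidal
    _ = _ := by
      rw [whisker_exchange (V ◁ ((λ_ Y).inv ≫ η_ V (rdual V) ▷ Y)) (η_ V (rdual V)),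
        ← whisker_exchange (S.ev V)]
      monoidal

/-- A morphism to the unit object, rotated around `V`. -/
def rotHom {V Y : C} (p : rdual V ⊗ Y ⊗ V ⟶ 𝟙_ C) : Y ⟶ 𝟙_ C :=
  𝟙 _ ⊗≫ η_ V (rdual V) ▷ Y ⊗≫ (V ⊗ rdual V ⊗ Y) ◁ η_ V (rdual V) ⊗≫
    V ◁ p ▷ rdual V ⊗≫ S.ev V

/-- Every term factors through a morphism `Y ⟶ 𝟙_ C`, which vanishes for `Y = V i` with `i` not the
index of the unit. -/
theorem rotUnit_rotCounit_eq_sum (V Y : C) :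
    D.rotUnit S V ▷ Y ≫ ((D.freeHalfBraiding V).β Y).hom ≫ Y ◁ D.rotCounit S V =
      ∑ a, V ◁ rotHom S (D.unitP (rdual V ⊗ Y ⊗ V) a) ≫ V ◁ D.unitQ (rdual V ⊗ Y ⊗ V) a ≫
        (α_ _ _ _).inv ≫ S.ev V ▷ (Y ⊗ V) ≫ (λ_ _).hom := by
  rw [rotUnit_rotCounit, unitSwapMap, unitSwap_app]
  have e : ∀ a, V ◁ rotHom S (D.unitP (rdual V ⊗ Y ⊗ V) a) ≫ V ◁ D.unitQ (rdual V ⊗ Y ⊗ V) a ≫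
        (α_ _ _ _).inv ≫ S.ev V ▷ (Y ⊗ V) ≫ (λ_ _).hom = 
      𝟙 _ ⊗≫ V ◁ η_ V (rdual V) ▷ Y ⊗≫ (V ⊗ V ⊗ rdual V ⊗ Y) ◁ η_ V (rdual V) ⊗≫
        V ◁ (V ◁ D.unitP (rdual V ⊗ Y ⊗ V) a ≫ (ρ_ V).hom ≫ (λ_ V).inv ≫
          D.unitQ (rdual V ⊗ Y ⊗ V) a ▷ V) ▷ rdual V ⊗≫
        S.ev V ▷ (Y ⊗ V ⊗ V ⊗ rdual V) ⊗≫ (Y ⊗ V) ◁ S.ev V ⊗≫ 𝟙 _ := by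
    intro a
    generalize D.unitP (rdual V ⊗ Y ⊗ V) a = p
    generalize D.unitQ (rdual V ⊗ Y ⊗ V) a = q
    symm
    dsimp only [rotHom]
    calc
      _ = 𝟙 _ ⊗≫ V ◁ η_ V (rdual V) ▷ Y ⊗≫ (V ⊗ V ⊗ rdual V ⊗ Y) ◁ η_ V (rdual V) ⊗≫
        V ◁ V ◁ p ▷ rdual V ⊗≫
        ((𝟙 (V ⊗ 𝟙_ C) ⊗≫ V ◁ q ⊗≫ S.ev V ▷ (Y ⊗ V) ⊗≫ 𝟙 (Y ⊗ V)) ▷ (V ⊗ rdual V) ≫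
          (Y ⊗ V) ◁ S.ev V) ⊗≫ 𝟙 _ := by monoidal
      _ = _ := by rw [← whisker_exchange]; monoidal
  simp only [e]
  simp [monoidalComp, sum_whiskerRight, whiskerLeft_sum, Preadditive.sum_comp, Preadditive.comp_sum]

/-- For `Y = 𝟙_ C` every morphism involved is a multiple of the evaluation of `V`. Rotating it
yields the right dimension and pairing it with `S.coev V` the left one; these agree, and a zigzag
remains. -/
theorem rotUnit_rotCounit_self (hS : S.IsSpherical) (V : C)
    (hV : ∀ f : rdual V ⊗ V ⟶ 𝟙_ C, ∃ c : k, f = c • ε_ V (rdual V)) :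
    D.rotUnit S V ≫ D.rotCounit S V = 𝟙 V := by
  have h := D.rotUnit_rotCounit_eq_sum S V (𝟙_ C)
  rw [halfBraiding_unit] at h
  have hd : S.coev V ≫ ε_ V (rdual V) = η_ V (rdual V) ≫ S.ev V := by
    have := hS (𝟙 V)
    rw [S.leftTrace_eq, S.rightTrace_eq] at this
    simpa using this
  have hr : ∀ a, rotHom S (D.unitP (rdual V ⊗ 𝟙_ C ⊗ V) a) =
      (S.coev V ≫ rdual V ◁ (λ_ V).inv) ≫ D.unitP (rdual V ⊗ 𝟙_ C ⊗ V) a := by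
    intro a
    generalize D.unitP (rdual V ⊗ 𝟙_ C ⊗ V) a = p
    obtain ⟨c, hc⟩ := hV (rdual V ◁ (λ_ V).inv ≫ p)
    have hp : p = rdual V ◁ (λ_ V).hom ≫ (c • ε_ V (rdual V)) := by rw [← hc]; simp
    have e : rotHom S (rdual V ◁ (λ_ V).hom ≫ ε_ V (rdual V)) = η_ V (rdual V) ≫ S.ev V := by
      dsimp only [rotHom]
      calc
        _ = 𝟙 _ ⊗≫ (η_ V (rdual V) ▷ 𝟙_ C ≫ (V ⊗ rdual V) ◁ η_ V (rdual V)) ⊗≫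
          V ◁ ε_ V (rdual V) ▷ rdual V ⊗≫ S.ev V := by monoidal
        _ = 𝟙 _ ⊗≫ η_ V (rdual V) ⊗≫ (η_ V (rdual V) ▷ V ⊗≫
          V ◁ ε_ V (rdual V)) ▷ rdual V ⊗≫ S.ev V := by rw [← whisker_exchange]; monoidal
        _ = _ := by rw [ExactPairing.evaluation_coevaluation'']; monoidal
    have e' : rotHom S (rdual V ◁ (λ_ V).hom ≫ (c • ε_ V (rdual V))) =
        c • rotHom S (rdual V ◁ (λ_ V).hom ≫ ε_ V (rdual V)) := by
      simp [rotHom, monoidalComp]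
    rw [hp, e', e, ← hd]
    simp
  have hs := D.sum_unitP_unitQ (S.coev V ≫ rdual V ◁ (λ_ V).inv)
  have h' : D.rotUnit S V ≫ D.rotCounit S V = (ρ_ V).inv ≫ (D.rotUnit S V ▷ 𝟙_ C ≫
      ((ρ_ (D.freeObj V)).hom ≫ (λ_ (D.freeObj V)).inv) ≫ 𝟙_ C ◁ D.rotCounit S V) ≫ (λ_ V).hom := by
    monoidal
  rw [h', h]
  have e : ∀ a, V ◁ rotHom S (D.unitP (rdual V ⊗ 𝟙_ C ⊗ V) a) ≫ V ◁ D.unitQ (rdual V ⊗ 𝟙_ C ⊗ V) a ≫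
        (α_ _ _ _).inv ≫ S.ev V ▷ (𝟙_ C ⊗ V) ≫ (λ_ _).hom =
      V ◁ ((S.coev V ≫ rdual V ◁ (λ_ V).inv) ≫ D.unitP (rdual V ⊗ 𝟙_ C ⊗ V) a ≫
        D.unitQ (rdual V ⊗ 𝟙_ C ⊗ V) a) ≫
        (α_ _ _ _).inv ≫ S.ev V ▷ (𝟙_ C ⊗ V) ≫ (λ_ _).hom := by
    intro a
    rw [hr]
    simp only [MonoidalCategory.whiskerLeft_comp, Category.assoc]
  rw [Finset.sum_congr rfl fun a _ => e a, ← Preadditive.sum_comp, ← whiskerLeft_sum, hs]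
  calc
    _ = 𝟙 _ ⊗≫ (V ◁ S.coev V ⊗≫ S.ev V ▷ V) ⊗≫ 𝟙 _ := by monoidal
    _ = _ := by rw [S.coev_ev]; monoidal

/-- By `unitCoact_eq` the rotated pair computes `unitCoact V` too. In the trace the rotated pair
unwinds into half-braidings at `Vᘁ` conjugating the coaction, which is the half-braiding of the
coend in `crossTrace`. -/
theorem crossTrace_eq_coactTrace (hS : S.IsSpherical) (V : C)
    (hV : ∀ f : rdual V ⊗ V ⟶ 𝟙_ C, ∃ c : k, f = c • ε_ V (rdual V)) :
    D.crossTrace S V = D.coactTrace S V := by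
  have hl : D.freeLift (D.freeHalfBraiding V) (D.rotUnit S V) ≫ D.rotCounit S V =
      D.freeCounit V := by
    refine D.freeLift_comp_eq_freeCounit _ _ _ (D.rotUnit_rotCounit_self S hS V hV) fun i hi => ?_
    rw [rotUnit_rotCounit_eq_sum]
    refine Finset.sum_eq_zero fun a _ => ?_
    rw [D.hom_unit_eq_zero hi (rotHom S _)]
    simp
  have h := D.unitCoact_eq (D.freeHalfBraiding V) _ _ hl
  have hc := D.coact_coendBraid (D.freeHalfBraiding V) (rdual V)
  have hu : D.unitCoact V = D.freeUnit V ≫ D.coact (D.freeHalfBraiding V) ≫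
      D.freeCounit V ▷ D.coendObj := by
    rw [unitCoact, ← freeUnit_coact, Category.assoc]
  have h₁ : S.coev V ≫ rdual V ◁ D.rotUnit S V = η_ V (rdual V) ≫ D.freeUnit V ▷ rdual V ≫
      ((D.freeHalfBraiding V).β (rdual V)).hom := by
    dsimp only [rotUnit]
    calc
      _ = 𝟙 _ ⊗≫ (S.coev V ▷ 𝟙_ C ≫ (rdual V ⊗ V) ◁ (η_ V (rdual V) ≫ D.freeUnit V ▷ rdual V ≫
          ((D.freeHalfBraiding V).β (rdual V)).hom)) ⊗≫ rdual V ◁ S.ev V ▷ D.freeObj V ⊗≫ 𝟙 _ := by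
        monoidal
      _ = 𝟙 _ ⊗≫ (η_ V (rdual V) ≫ D.freeUnit V ▷ rdual V ≫
          ((D.freeHalfBraiding V).β (rdual V)).hom) ⊗≫ (S.coev V ▷ rdual V ⊗≫
            rdual V ◁ S.ev V) ▷ D.freeObj V ⊗≫ 𝟙 _ := by
        rw [← whisker_exchange]; monoidal
      _ = _ := by rw [S.ev_coev]; monoidal
  have h₂ : rdual V ◁ D.rotCounit S V ≫ ε_ V (rdual V) =
      ((D.freeHalfBraiding V).β (rdual V)).inv ≫ D.freeCounit V ▷ rdual V ≫ S.ev V := by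
    dsimp only [rotCounit]
    calc
      _ = 𝟙 _ ⊗≫ rdual V ◁ η_ V (rdual V) ▷ D.freeObj V ⊗≫ ((rdual V ⊗ V) ◁
          (((D.freeHalfBraiding V).β (rdual V)).inv ≫ D.freeCounit V ▷ rdual V ≫ S.ev V) ≫
          ε_ V (rdual V) ▷ 𝟙_ C) ⊗≫ 𝟙 _ := by monoidal
      _ = 𝟙 _ ⊗≫ (rdual V ◁ η_ V (rdual V) ⊗≫ ε_ V (rdual V) ▷ rdual V) ▷ D.freeObj V ⊗≫
          (((D.freeHalfBraiding V).β (rdual V)).inv ≫ D.freeCounit V ▷ rdual V ≫ S.ev V) ⊗≫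
          𝟙 _ := by rw [whisker_exchange]; monoidal
      _ = _ := by rw [ExactPairing.coevaluation_evaluation'']; monoidal
  calc
    _ = 𝟙 _ ⊗≫ η_ V (rdual V) ⊗≫ D.freeUnit V ▷ rdual V ⊗≫
        D.coact (D.freeHalfBraiding V) ▷ rdual V ⊗≫ (D.freeCounit V ▷ (D.coendObj ⊗ rdual V) ≫
        V ◁ (D.coendHalfBraiding.β (rdual V)).hom) ⊗≫ S.ev V ▷ D.coendObj ⊗≫ 𝟙 _ := by
      rw [crossTrace, hu]; monoidal
    _ = 𝟙 _ ⊗≫ η_ V (rdual V) ⊗≫ D.freeUnit V ▷ rdual V ⊗≫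
        (D.coact (D.freeHalfBraiding V) ▷ rdual V ≫ (α_ _ _ _).hom ≫
          D.freeObj V ◁ D.coendBraid (rdual V)) ⊗≫
        (D.freeCounit V ▷ rdual V ≫ S.ev V) ▷ D.coendObj ⊗≫ 𝟙 _ := by
      rw [← whisker_exchange]
      change 𝟙 _ ⊗≫ η_ V (rdual V) ⊗≫ D.freeUnit V ▷ rdual V ⊗≫
        D.coact (D.freeHalfBraiding V) ▷ rdual V ⊗≫ (D.freeObj V ◁ D.coendBraid (rdual V) ≫
          D.freeCounit V ▷ (rdual V ⊗ D.coendObj)) ⊗≫ S.ev V ▷ D.coendObj ⊗≫ 𝟙 _ = _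
      monoidal
    _ = 𝟙 _ ⊗≫ (S.coev V ≫ rdual V ◁ D.rotUnit S V) ⊗≫
        rdual V ◁ D.coact (D.freeHalfBraiding V) ⊗≫
        (rdual V ◁ D.rotCounit S V ≫ ε_ V (rdual V)) ▷ D.coendObj ⊗≫ 𝟙 _ := by
      rw [hc, h₁, h₂]; monoidal
    _ = _ := by
      rw [coactTrace, traceElt, h]; monoidal

end FusionStructure


/-! ### Duals of scalar objects -/

namespace FusionStructure

variable {k : Type*} [CommRing k] {C : Type u} [Category.{v} C] [Preadditive C] [Linear k C]
  [MonoidalCategory C] [MonoidalPreadditive C] [MonoidalLinear k C] [HasFiniteBiproducts C]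
  [RigidCategory C] {I : Type w} [Fintype I] (D : FusionStructure k C I) (S : SovereignStructure C)

omit [HasFiniteBiproducts C] in
theorem exists_smul_evaluation {V : C} (h : ∀ g : V ⟶ V, ∃ c : k, g = c • 𝟙 V)
    (f : rdual V ⊗ V ⟶ 𝟙_ C) : ∃ c : k, f = c • ε_ V (rdual V) := by
  obtain ⟨c, hc⟩ := h ((λ_ V).inv ≫ η_ V (rdual V) ▷ V ≫ (α_ _ _ _).hom ≫ V ◁ f ≫ (ρ_ V).hom)
  have e : f = rdual V ◁ ((λ_ V).inv ≫ η_ V (rdual V) ▷ V ≫ (α_ _ _ _).hom ≫ V ◁ f ≫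
      (ρ_ V).hom) ≫ ε_ V (rdual V) := by
    symm
    calc
      _ = 𝟙 _ ⊗≫ rdual V ◁ η_ V (rdual V) ▷ V ⊗≫ ((rdual V ⊗ V) ◁ f ≫ ε_ V (rdual V) ▷ 𝟙_ C) ⊗≫
          𝟙 _ := by monoidal
      _ = 𝟙 _ ⊗≫ (rdual V ◁ η_ V (rdual V) ⊗≫ ε_ V (rdual V) ▷ rdual V) ▷ V ⊗≫ f := by
        rw [whisker_exchange]; monoidal
      _ = _ := by rw [ExactPairing.coevaluation_evaluation'']; monoidal
  refine ⟨c, ?_⟩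
  rw [e, hc]
  simp

theorem whiskerRight_evaluation_injective {C : Type u} [Category.{v} C] [MonoidalCategory C]
    [RightRigidCategory C] {V X : C} {g g' : X ⟶ rdual V}
    (h : g ▷ V ≫ ε_ V (rdual V) = g' ▷ V ≫ ε_ V (rdual V)) : g = g' := by
  have e : ∀ g : X ⟶ rdual V, g = 𝟙 _ ⊗≫ X ◁ η_ V (rdual V) ⊗≫
      (g ▷ V ≫ ε_ V (rdual V)) ▷ rdual V ⊗≫ 𝟙 _ := by
    intro g
    symm
    calc
      _ = 𝟙 _ ⊗≫ (X ◁ η_ V (rdual V) ≫ g ▷ (V ⊗ rdual V)) ⊗≫ ε_ V (rdual V) ▷ rdual V ⊗≫ 𝟙 _ := by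
        monoidal
      _ = 𝟙 _ ⊗≫ g ⊗≫ (rdual V ◁ η_ V (rdual V) ⊗≫ ε_ V (rdual V) ▷ rdual V) ⊗≫ 𝟙 _ := by
        rw [whisker_exchange]; monoidal
      _ = _ := by rw [ExactPairing.coevaluation_evaluation'']; monoidal
  rw [e g, e g', h]

omit [HasFiniteBiproducts C] in
theorem exists_smul_id_rdual {V : C} (h : ∀ g : V ⟶ V, ∃ c : k, g = c • 𝟙 V)
    (g : rdual V ⟶ rdual V) : ∃ c : k, g = c • 𝟙 (rdual V) := by
  obtain ⟨c, hc⟩ := exists_smul_evaluation h (g ▷ V ≫ ε_ V (rdual V))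
  refine ⟨c, whiskerRight_evaluation_injective ?_⟩
  rw [hc]
  simp

include D in
theorem id_V_ne_zero [Nontrivial k] (j : I) : 𝟙 (D.V j) ≠ 0 := by
  intro h
  have : (1 : k) = 0 := (D.end_bijective j).1 (by simp [h])
  exact one_ne_zero this

-- The dual is nonzero, so it has a summand `V j'`. The corresponding idempotent is a scalar,
-- because End(V_jᘁ) consists of scalars, and the scalar is 1 since the summand splits off.
include D in
theorem exists_iso_rdual [Nontrivial k] (j : I) : ∃ j', Nonempty (rdual (D.V j) ≅ D.V j') := by
  obtain ⟨d⟩ := D.exists_decomposition (rdual (D.V j))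
  have hn : 0 < d.n := by
    by_contra h0
    have h1 : 𝟙 (rdual (D.V j)) = 0 := by
      rw [← d.sum_p_q]
      refine Finset.sum_eq_zero fun a _ => ?_
      exact absurd a.2 (by omega)
    refine D.id_V_ne_zero j ?_
    have e := ExactPairing.evaluation_coevaluation'' (D.V j) (rdual (D.V j))
    calc
      _ = 𝟙 _ ⊗≫ (η_ (D.V j) (rdual (D.V j)) ▷ D.V j ⊗≫
          D.V j ◁ ε_ (D.V j) (rdual (D.V j))) ⊗≫ 𝟙 _ := by rw [e]; monoidal
      _ = (λ_ _).inv ≫ η_ (D.V j) (rdual (D.V j)) ▷ D.V j ≫ (α_ _ _ _).hom ≫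
          D.V j ◁ (𝟙 (rdual (D.V j)) ▷ D.V j ≫ ε_ (D.V j) (rdual (D.V j))) ≫ (ρ_ _).hom := by
        monoidal
      _ = 0 := by rw [h1]; simp
  let a : Fin d.n := ⟨0, hn⟩
  obtain ⟨x, hx⟩ := exists_smul_id_rdual (fun g => D.exists_smul_id g) (d.p a ≫ d.q a)
  have h2 : (fun c : k => c • 𝟙 (D.V (d.s a))) x = (fun c : k => c • 𝟙 (D.V (d.s a))) 1 := by
    have h3 : d.q a ≫ (d.p a ≫ d.q a) ≫ d.p a = 𝟙 _ := by
      rw [Category.assoc, d.q_p_self, Category.comp_id, d.q_p_self]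
    rw [hx] at h3
    simpa [d.q_p_self] using h3
  have h4 : x = 1 := (D.end_bijective _).1 h2
  exact ⟨d.s a, ⟨{ hom := d.p a, inv := d.q a, hom_inv_id := by rw [hx, h4, one_smul], inv_hom_id := d.q_p_self a }⟩⟩

include D S in
theorem eq_of_iso_rdual [Nontrivial k] {i j : I} (e : rdual (D.V i) ≅ rdual (D.V j)) : i = j := by
  by_contra h
  refine D.id_V_ne_zero i ?_
  have h0 := D.hom_eq_zero i j h ((S.φ (D.V i)).hom ≫ rightAdjointMate e.inv ≫ (S.φ (D.V j)).inv)
  calc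
    𝟙 (D.V i) = ((S.φ (D.V i)).hom ≫ rightAdjointMate e.inv ≫ (S.φ (D.V j)).inv) ≫
        (S.φ (D.V j)).hom ≫ rightAdjointMate e.hom ≫ (S.φ (D.V i)).inv := by
      simp only [Category.assoc, Iso.inv_hom_id_assoc]
      rw [← comp_rightAdjointMate_assoc, Iso.hom_inv_id, rightAdjointMate_id, Category.id_comp,
        Iso.hom_inv_id]
    _ = 0 := by rw [h0, Limits.zero_comp]

theorem dim_eq_of_iso (hS : S.IsSpherical) {X Y : C} (e : X ≅ Y) : S.dim X = S.dim Y := by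
  rw [SovereignStructure.dim, SovereignStructure.dim, hS, hS, ← e.hom_inv_id, ← e.inv_hom_id,
    S.rightTrace_comm]

theorem dim_rdual (hS : S.IsSpherical) (X : C) : S.dim (rdual X) = S.dim X := by
  rw [SovereignStructure.dim, SovereignStructure.dim, hS (𝟙 X), S.leftTrace_eq, S.rightTrace_eq,
    S.coev_rdual, SovereignStructure.ev]
  simp

theorem coactTrace_eq_of_iso {X Y : C} (e : X ≅ Y) : D.coactTrace S X = D.coactTrace S Y := by
  have h : ∀ Z, D.coactTrace S Z = S.partialTrace Z ((ρ_ Z).hom ≫ D.unitCoact Z) := by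
    intro Z
    dsimp only [coactTrace, traceElt, SovereignStructure.partialTrace]
    monoidal
  have h₂ : D.unitCoact X = e.hom ≫ D.unitCoact Y ≫ e.inv ▷ D.coendObj := by
    rw [← Category.assoc, D.unitCoact_naturality e.hom, Category.assoc, ← comp_whiskerRight,
      Iso.hom_inv_id, MonoidalCategory.id_whiskerRight, Category.comp_id]
  have h₁ : (ρ_ X).hom ≫ D.unitCoact X =
      ((ρ_ X).hom ≫ e.hom ≫ D.unitCoact Y) ≫ e.inv ▷ D.coendObj := by
    rw [h₂]; simp
  rw [h, h, h₁, S.partialTrace_comm]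
  simp

/-- The integral is invariant under the antipode. -/
theorem traceIntegral_antipode (hS : S.IsSpherical) :
    D.traceIntegral S ≫ D.coendAntipode = D.traceIntegral S := by
  -- Over the zero ring the indices of dual objects are not determined, but all morphisms vanish.
  rcases subsingleton_or_nontrivial k with hk | hk
  · have h0 : ∀ f : 𝟙_ C ⟶ D.coendObj, f = 0 := fun f => by
      rw [← one_smul k f, Subsingleton.elim (1 : k) 0, zero_smul]
    rw [h0 (_ ≫ _), h0 (D.traceIntegral S)]
  · choose τ e using D.exists_iso_rdual
    -- Duality permutes the index set; reindexing the weighted sum along this permutation proves the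
    -- invariance.
    have hτ : Function.Injective τ := fun i j hij => by
      obtain ⟨e₁⟩ := e i
      obtain ⟨e₂⟩ := e j
      rw [← hij] at e₂
      exact D.eq_of_iso_rdual S (e₁ ≪≫ e₂.symm)
    have h₁ : ∀ j, D.coactTrace S (D.V j) ≫ D.coendAntipode = D.coactTrace S (D.V (τ j)) := by
      intro j
      obtain ⟨e₁⟩ := e j
      rw [D.coactTrace_antipode, D.crossTrace_eq_coactTrace S hS _
        (exists_smul_evaluation (exists_smul_id_rdual fun g => D.exists_smul_id g)),
        D.coactTrace_eq_of_iso S e₁]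
    have h₂ : ∀ j, D.dimScalar S j = D.dimScalar S (τ j) := by
      intro j
      obtain ⟨e₁⟩ := e j
      refine D.smul_id_unit_injective ?_
      rw [← dim_eq, ← dim_eq, ← dim_eq_of_iso S hS e₁, dim_rdual S hS]
    rw [traceIntegral_eq, Preadditive.sum_comp]
    refine Fintype.sum_bijective τ (Finite.injective_iff_bijective.1 hτ) _ _ fun j => ?_
    rw [Linear.smul_comp, h₁, h₂]

end FusionStructure


/-! ### Centrality of the integral -/

namespace FusionStructure

variable {k : Type*} [CommRing k] {C : Type u} [Category.{v} C] [Preadditive C] [Linear k C]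
  [MonoidalCategory C] [MonoidalPreadditive C] [MonoidalLinear k C] [HasFiniteBiproducts C]
  [RigidCategory C] {I : Type w} [Fintype I] (D : FusionStructure k C I) (S : SovereignStructure C)

/-- The comultiplication of the coend, as a morphism of `C`. -/
def coendComul : D.coendObj ⟶ D.coendObj ⊗ D.coendObj := D.isUniversalCoaction_coactC.comul.f

/-- The unit of the coend, as a morphism of `C`. -/
def coendOne : 𝟙_ C ⟶ D.coendObj := D.isUniversalCoaction_coactC.one.f

theorem coactC_comul_f (M : Center C) : D.coact M.2 ≫ M.1 ◁ D.coendComul =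
    D.coact M.2 ≫ D.coact M.2 ▷ D.coendObj ≫ (α_ _ _ _).hom := by
  have h := congr_arg Center.Hom.f (D.isUniversalCoaction_coactC.coact_comul M)
  simp only [Center.comp_f, Center.whiskerLeft_f, Center.whiskerRight_f,
    Center.associator_hom_f] at h
  exact h

theorem coact_comul {M : C} (b : HalfBraiding M) : D.coact b ≫ M ◁ D.coendComul =
    D.coact b ≫ D.coact b ▷ D.coendObj ≫ (α_ _ _ _).hom :=
  D.coactC_comul_f ⟨M, b⟩

theorem coendMul_assoc : D.coendMul ▷ D.coendObj ≫ D.coendMul =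
    (α_ _ _ _).hom ≫ D.coendObj ◁ D.coendMul ≫ D.coendMul :=
  congr_arg Center.Hom.f D.isUniversalCoaction_coactC.mul_assoc

theorem coendMul_one : D.coendObj ◁ D.coendOne ≫ D.coendMul = (ρ_ _).hom :=
  congr_arg Center.Hom.f D.isUniversalCoaction_coactC.mul_one

theorem coendAntipode_right : D.coendComul ≫ D.coendObj ◁ D.coendAntipode ≫ D.coendMul =
    D.coendCounit ≫ D.coendOne :=
  congr_arg Center.Hom.f D.isUniversalCoaction_coactC.antipode_right

/-- Apply the antipode to aΛ = ε(a)Λ, using that it is antimultiplicative and fixes Λ. The crossing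
is undone by naturality of the half-braiding of the coend along Λ, so centrality of Λ is not needed
here. -/
theorem antipode_traceIntegral_mul (hS : S.IsSpherical) :
    D.coendAntipode ≫ (λ_ _).inv ≫ D.traceIntegral S ▷ D.coendObj ≫ D.coendMul =
      D.coendCounit ≫ D.traceIntegral S := by
  have hr := D.traceIntegral_right S hS
  have ha := D.traceIntegral_antipode S hS
  have hm := D.coendMul_antipode
  have n := D.coendHalfBraiding.naturality (D.traceIntegral S)
  rw [halfBraiding_unit] at n
  symm
  calc
    _ = (D.coendCounit ≫ D.traceIntegral S) ≫ D.coendAntipode := by rw [Category.assoc, ha]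
    _ = (ρ_ _).inv ≫ D.coendObj ◁ D.traceIntegral S ≫ D.coendMul ≫ D.coendAntipode := by
      rw [← hr]; simp
    _ = (ρ_ _).inv ≫ (D.coendObj ◁ D.traceIntegral S ≫ D.coendAntipode ▷ D.coendObj) ≫
        D.coendObj ◁ D.coendAntipode ≫ (D.coendHalfBraiding.β D.coendObj).hom ≫ D.coendMul := by
      rw [hm]; simp
    _ = D.coendAntipode ≫ (ρ_ _).inv ≫ (D.coendObj ◁ (D.traceIntegral S ≫ D.coendAntipode) ≫
        (D.coendHalfBraiding.β D.coendObj).hom) ≫ D.coendMul := by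
      rw [whisker_exchange]; monoidal
    _ = _ := by
      rw [ha, n]; monoidal

theorem traceIntegral_braid_coact (hS : S.IsSpherical) {N : C} (b : HalfBraiding N) :
    D.coact b ≫ ((λ_ N).inv ≫ D.traceIntegral S ▷ N ≫ (D.coendHalfBraiding.β N).hom) ▷ D.coendObj ≫
      (α_ _ _ _).hom ≫ N ◁ D.coendMul = (ρ_ N).inv ≫ N ◁ D.traceIntegral S := by
  rw [← D.traceIntegral_coact S hS b]
  calc
    _ = 𝟙 _ ⊗≫ (𝟙_ C ◁ D.coact b ≫ D.traceIntegral S ▷ (N ⊗ D.coendObj)) ⊗≫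
      (D.coendHalfBraiding.β N).hom ▷ D.coendObj ⊗≫ N ◁ D.coendMul := by monoidal
    _ = _ := by rw [whisker_exchange]; monoidal

/-- Let `x` be Λ dragged across `N`; coacting, then applying `x` and multiplying, gives N ⊗ Λ.
Multiplying once more by the antipode of a further leg of the coaction gives `x` by the antipode
axiom on one reading, and N ⊗ Λ by Λ·S(a) = ε(a)Λ on the other. -/
theorem traceIntegral_braid (hS : S.IsSpherical) {N : C} (b : HalfBraiding N) :
    (λ_ N).inv ≫ D.traceIntegral S ▷ N ≫ (D.coendHalfBraiding.β N).hom =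
      (ρ_ N).inv ≫ N ◁ D.traceIntegral S := by
  have hx := D.traceIntegral_braid_coact S hS b
  have hl := D.antipode_traceIntegral_mul S hS
  have hc := D.coact_counit b
  set x := (λ_ N).inv ≫ D.traceIntegral S ▷ N ≫ (D.coendHalfBraiding.β N).hom
  symm
  calc
    _ = (D.coact b ≫ N ◁ D.coendCounit) ≫ N ◁ D.traceIntegral S := by rw [hc]
    _ = D.coact b ≫ N ◁ (D.coendAntipode ≫ (λ_ _).inv ≫ D.traceIntegral S ▷ D.coendObj ≫
        D.coendMul) := by rw [hl]; simp
    _ = 𝟙 _ ⊗≫ D.coact b ⊗≫ N ◁ (𝟙_ C ◁ D.coendAntipode ≫ D.traceIntegral S ▷ D.coendObj) ⊗≫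
        N ◁ D.coendMul := by monoidal
    _ = 𝟙 _ ⊗≫ D.coact b ⊗≫ ((ρ_ N).inv ≫ N ◁ D.traceIntegral S) ▷ D.coendObj ⊗≫
        N ◁ (D.coendObj ◁ D.coendAntipode ≫ D.coendMul) := by
      rw [whisker_exchange]; monoidal
    _ = 𝟙 _ ⊗≫ (D.coact b ≫ D.coact b ▷ D.coendObj ≫ (α_ _ _ _).hom) ⊗≫
        x ▷ D.coendObj ▷ D.coendObj ⊗≫
        N ◁ (D.coendMul ▷ D.coendObj ≫ D.coendObj ◁ D.coendAntipode) ⊗≫ N ◁ D.coendMul := by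
      rw [← hx]; monoidal
    _ = 𝟙 _ ⊗≫ D.coact b ⊗≫ N ◁ D.coendComul ⊗≫ x ▷ (D.coendObj ⊗ D.coendObj) ⊗≫
        N ◁ (D.coendObj ⊗ D.coendObj) ◁ D.coendAntipode ⊗≫
          N ◁ (D.coendMul ▷ D.coendObj ≫ D.coendMul) := by
      rw [← D.coact_comul, ← whisker_exchange]; monoidal
    _ = 𝟙 _ ⊗≫ D.coact b ⊗≫ N ◁ D.coendComul ⊗≫ (x ▷ (D.coendObj ⊗ D.coendObj) ≫
        (N ⊗ D.coendObj) ◁ (D.coendObj ◁ D.coendAntipode ≫ D.coendMul)) ⊗≫ N ◁ D.coendMul := by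
      rw [D.coendMul_assoc]; monoidal
    _ = 𝟙 _ ⊗≫ D.coact b ⊗≫ N ◁ (D.coendComul ≫ D.coendObj ◁ D.coendAntipode ≫ D.coendMul) ⊗≫
        x ▷ D.coendObj ⊗≫ N ◁ D.coendMul := by
      rw [← whisker_exchange]; monoidal
    _ = 𝟙 _ ⊗≫ (D.coact b ≫ N ◁ D.coendCounit) ⊗≫ (N ◁ D.coendOne ≫ x ▷ D.coendObj) ⊗≫
        N ◁ D.coendMul := by
      rw [D.coendAntipode_right]; monoidal
    _ = 𝟙 _ ⊗≫ x ⊗≫ N ◁ (D.coendObj ◁ D.coendOne ≫ D.coendMul) := by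
      rw [hc, whisker_exchange]; monoidal
    _ = _ := by rw [D.coendMul_one]; monoidal

/-- The integral is a morphism of the center. -/
theorem traceIntegral_central (hS : S.IsSpherical) (Y : C) :
    D.traceIntegral S ▷ Y ≫ (D.coendHalfBraiding.β Y).hom =
      ((λ_ Y).hom ≫ (ρ_ Y).inv) ≫ Y ◁ D.traceIntegral S := by
  -- `Y` is a retract in `C` of its free object, which carries a half-braiding. The identity
  -- descends by naturality of the half-braiding of the coend.
  have h := D.traceIntegral_braid S hS (D.freeHalfBraiding Y)
  have n := D.coendHalfBraiding.naturality (D.freeUnit Y)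
  have e := D.freeUnit_freeCounit Y
  rw [Iso.inv_comp_eq] at h
  calc
    _ = D.traceIntegral S ▷ Y ≫ (D.coendHalfBraiding.β Y).hom ≫
        (D.freeUnit Y ≫ D.freeCounit Y) ▷ D.coendObj := by rw [e]; simp
    _ = (D.traceIntegral S ▷ Y ≫ D.coendObj ◁ D.freeUnit Y) ≫
        (D.coendHalfBraiding.β (D.freeObj Y)).hom ≫ D.freeCounit Y ▷ D.coendObj := by
      rw [comp_whiskerRight, ← reassoc_of% n]; simp
    _ = (λ_ Y).hom ≫ D.freeUnit Y ≫ (ρ_ (D.freeObj Y)).inv ≫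
        (D.freeObj Y ◁ D.traceIntegral S ≫ D.freeCounit Y ▷ D.coendObj) := by
      rw [← whisker_exchange, Category.assoc, reassoc_of% h]; simp
    _ = (λ_ Y).hom ≫ (D.freeUnit Y ≫ D.freeCounit Y) ≫ (ρ_ Y).inv ≫ Y ◁ D.traceIntegral S := by
      rw [whisker_exchange]; monoidal
    _ = _ := by rw [e]; monoidal

/-- The integral is a left integral. -/
theorem traceIntegral_left (hS : S.IsSpherical) :
    (λ_ _).inv ≫ D.traceIntegral S ▷ D.coendObj ≫ D.coendMul =
      D.coendCounit ≫ D.traceIntegral S := by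
  refine D.coact_hom_ext fun N b => ?_
  have hx := D.traceIntegral_braid_coact S hS b
  -- Centrality removes the crossing left over in `traceIntegral_coact`.
  rw [D.traceIntegral_braid S hS b] at hx
  rw [MonoidalCategory.whiskerLeft_comp N D.coendCounit, ← Category.assoc (D.coact b),
    D.coact_counit, ← hx]
  monoidal

end FusionStructure


/-! ### The explicit form of the integral -/

theorem dualTripleIso_ev {C : Type u} [Category.{v} C] [MonoidalCategory C] [RightRigidCategory C]
    (X Y Z : C) : ε_ (X ⊗ Y ⊗ Z) (rdual (X ⊗ Y ⊗ Z)) =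
      (dualTripleIso X Y Z).hom ▷ (X ⊗ Y ⊗ Z) ⊗≫ rdual Z ◁ rdual Y ◁ ε_ X (rdual X) ▷ (Y ⊗ Z) ⊗≫
        rdual Z ◁ ε_ Y (rdual Y) ▷ Z ⊗≫ ε_ Z (rdual Z) := by
  rw [rightDualTensorIso_ev X (Y ⊗ Z), rightDualTensorIso_ev Y Z]
  have e : (dualTripleIso X Y Z).hom = (rightDualTensorIso X (Y ⊗ Z)).hom ≫
      (rightDualTensorIso Y Z).hom ▷ rdual X ≫ (α_ _ _ _).hom := rfl
  rw [e]
  calc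
    _ = (rightDualTensorIso X (Y ⊗ Z)).hom ▷ (X ⊗ Y ⊗ Z) ⊗≫
        (rdual (Y ⊗ Z) ◁ ε_ X (rdual X) ≫ (rightDualTensorIso Y Z).hom ▷ 𝟙_ C) ▷ (Y ⊗ Z) ⊗≫
        rdual Z ◁ ε_ Y (rdual Y) ▷ Z ⊗≫ ε_ Z (rdual Z) := by monoidal
    _ = _ := by rw [whisker_exchange]; monoidal

namespace FusionStructure

variable {k : Type*} [CommRing k] {C : Type u} [Category.{v} C] [Preadditive C] [Linear k C]
  [MonoidalCategory C] [MonoidalPreadditive C] [MonoidalLinear k C] [HasFiniteBiproducts C]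
  [RigidCategory C] {I : Type w} [Fintype I] (D : FusionStructure k C I) (S : SovereignStructure C)

/-- The dual of the isomorphism `V₀ ⟶ 𝟙_ C`. -/
def unitInvMate : 𝟙_ C ⟶ rdual (D.V D.zero) :=
  @rightAdjointMate C _ _ (D.V D.zero) (𝟙_ C) _ hasRightDualUnit D.unitIso.inv

/-- The dual of the isomorphism `𝟙_ C ⟶ V₀`. -/
def unitHomMate : rdual (D.V D.zero) ⟶ 𝟙_ C :=
  @rightAdjointMate C _ _ (𝟙_ C) (D.V D.zero) hasRightDualUnit _ D.unitIso.hom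

/-- The double dual of the isomorphism `𝟙_ C ⟶ V₀`. -/
def unitHomMateMate : 𝟙_ C ⟶ rdual (rdual (D.V D.zero)) :=
  @rightAdjointMate C _ _ (rdual (D.V D.zero)) (𝟙_ C) _ hasRightDualUnit D.unitHomMate

theorem integral_eq : D.integral S = ∑ j : I, S.dim (D.V j) ≫ S.coev (D.V j) ≫ (λ_ _).inv ≫
    (𝟙_ C) ◁ rdual (D.V j) ◁ (λ_ (D.V j)).inv ≫
    (D.unitInvMate ⊗ₘ (rdual (D.V j) ◁ (D.unitHomMateMate ▷ D.V j))) ≫ D.summandι D.zero j := rfl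

theorem unitInvMate_ev : D.unitInvMate ▷ D.V D.zero ≫ ε_ _ (rdual (D.V D.zero)) =
    (λ_ _).hom ≫ D.unitIso.inv := by
  refine (@rightAdjointMate_comp_evaluation C _ _ (D.V D.zero) (𝟙_ C) _ hasRightDualUnit
    D.unitIso.inv).trans ?_
  change 𝟙_ C ◁ D.unitIso.inv ≫ (ρ_ (𝟙_ C)).hom = _
  rw [← unitors_equal]; simp

theorem unitHomMate_eq : D.unitHomMate =
    (ρ_ _).inv ≫ rdual (D.V D.zero) ◁ D.unitIso.hom ≫ ε_ _ (rdual (D.V D.zero)) := by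
  have h := @rightAdjointMate_comp_evaluation C _ _ (𝟙_ C) (D.V D.zero) hasRightDualUnit _
    D.unitIso.hom
  rw [Iso.eq_inv_comp]
  refine Eq.trans ?_ h
  change _ = D.unitHomMate ▷ 𝟙_ C ≫ (ρ_ (𝟙_ C)).hom
  simp

theorem unitHomMateMate_ev : D.unitHomMateMate ▷ rdual (D.V D.zero) ≫
    ε_ _ (rdual (rdual (D.V D.zero))) = (λ_ _).hom ≫ D.unitHomMate := by
  refine (@rightAdjointMate_comp_evaluation C _ _ (rdual (D.V D.zero)) (𝟙_ C) _ hasRightDualUnit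
    D.unitHomMate).trans ?_
  change 𝟙_ C ◁ D.unitHomMate ≫ (ρ_ (𝟙_ C)).hom = _
  rw [← unitors_equal]; simp

theorem freeι_freeCounit_of_ne (V : C) {i : I} (h : i ≠ D.zero) :
    D.freeι V i ≫ D.freeCounit V = 0 := by
  have h' := D.freeMap_freeCounit V (D.V i)
  rw [freeMap_V_comp, D.unitSwap_of_ne V h] at h'
  have := congr_arg (tensorLeftHomEquiv (V ⊗ D.V i) (D.V i) (rdual (D.V i)) V).symm h'
  rw [Equiv.symm_apply_apply] at this
  rw [this]
  simp [tensorLeftHomEquiv]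

theorem freeι_freeCounit_zero (V : C) : D.freeι V D.zero ≫ D.freeCounit V =
    D.unitHomMate ▷ (V ⊗ D.V D.zero) ≫ (λ_ _).hom ≫ V ◁ D.unitIso.inv ≫ (ρ_ V).hom := by
  have h' := D.freeMap_freeCounit V (D.V D.zero)
  have h2 : (D.unitSwap V).app (D.V D.zero) =
      V ◁ D.unitIso.inv ≫ (ρ_ V).hom ≫ (λ_ V).inv ≫ D.unitIso.hom ▷ V := by
    simp [unitSwap]
  rw [freeMap_V_comp, h2] at h'
  have h3 := congr_arg (tensorLeftHomEquiv (V ⊗ D.V D.zero) (D.V D.zero)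
    (rdual (D.V D.zero)) V).symm h'
  rw [Equiv.symm_apply_apply] at h3
  rw [h3, unitHomMate_eq]
  dsimp [tensorLeftHomEquiv]
  calc
    _ = 𝟙 _ ⊗≫ (rdual (D.V D.zero) ◁ V ◁ D.unitIso.inv ⊗≫
        (rdual (D.V D.zero) ◁ D.unitIso.hom ≫ ε_ _ (rdual (D.V D.zero))) ▷ V) ⊗≫ 𝟙 _ := by monoidal
    _ = 𝟙 _ ⊗≫ (rdual (D.V D.zero) ◁ V ◁ D.unitIso.inv ≫
        ((ρ_ _).inv ≫ rdual (D.V D.zero) ◁ D.unitIso.hom ≫ ε_ _ (rdual (D.V D.zero))) ▷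
          (V ⊗ 𝟙_ C)) ⊗≫ 𝟙 _ := by monoidal
    _ = _ := by rw [whisker_exchange]; monoidal

/-- Morphisms into a dual are detected by evaluation, against which both sides reduce to `unitIso`
and evaluations. This matches the embedding of `V_jᘁ ⊗ V_j` into the summand `(0, j)` used in
`integral`. -/
theorem rightAdjointMate_freeCounit (V : C) :
    rightAdjointMate (D.freeι V D.zero ≫ D.freeCounit V) ≫
      (dualTripleIso (rdual (D.V D.zero)) V (D.V D.zero)).hom =
    (λ_ (rdual V)).inv ≫ D.unitInvMate ▷ rdual V ≫ (ρ_ _).inv ≫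
      (rdual (D.V D.zero) ⊗ rdual V) ◁ D.unitHomMateMate ≫ (α_ _ _ _).hom := by
  rw [← Iso.eq_comp_inv]
  apply whiskerRight_evaluation_injective
  rw [rightAdjointMate_comp_evaluation, freeι_freeCounit_zero, dualTripleIso_ev]
  have h₁ := D.unitInvMate_ev
  have h₂ := D.unitHomMateMate_ev
  symm
  calc
    _ = 𝟙 _ ⊗≫ D.unitInvMate ▷ rdual V ▷ (rdual (D.V D.zero) ⊗ V ⊗ D.V D.zero) ⊗≫
        (rdual (D.V D.zero) ⊗ rdual V) ◁ D.unitHomMateMate ▷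
          (rdual (D.V D.zero) ⊗ V ⊗ D.V D.zero) ⊗≫
        ((dualTripleIso (rdual (D.V D.zero)) V (D.V D.zero)).inv ≫
          (dualTripleIso (rdual (D.V D.zero)) V (D.V D.zero)).hom) ▷
          (rdual (D.V D.zero) ⊗ V ⊗ D.V D.zero) ⊗≫
        rdual (D.V D.zero) ◁ rdual V ◁ ε_ (rdual (D.V D.zero)) (rdual (rdual (D.V D.zero))) ▷ (V ⊗ D.V D.zero) ⊗≫
        rdual (D.V D.zero) ◁ ε_ V (rdual V) ▷ D.V D.zero ⊗≫ ε_ (D.V D.zero) (rdual (D.V D.zero)) := by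
      monoidal
    _ = 𝟙 _ ⊗≫ D.unitInvMate ▷ (rdual V ⊗ rdual (D.V D.zero) ⊗ V ⊗ D.V D.zero) ⊗≫
        (rdual (D.V D.zero) ⊗ rdual V) ◁ (D.unitHomMateMate ▷ rdual (D.V D.zero) ≫
          ε_ (rdual (D.V D.zero)) (rdual (rdual (D.V D.zero)))) ▷ (V ⊗ D.V D.zero) ⊗≫
        rdual (D.V D.zero) ◁ ε_ V (rdual V) ▷ D.V D.zero ⊗≫ ε_ (D.V D.zero) (rdual (D.V D.zero)) := by
      rw [Iso.inv_hom_id]; monoidal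
    _ = 𝟙 _ ⊗≫ (D.unitInvMate ▷ ((rdual V ⊗ rdual (D.V D.zero)) ⊗ V ⊗ D.V D.zero) ≫
        rdual (D.V D.zero) ◁ ((rdual V ◁ D.unitHomMate) ▷ (V ⊗ D.V D.zero) ⊗≫
          ε_ V (rdual V) ▷ D.V D.zero ⊗≫ 𝟙 (D.V D.zero))) ⊗≫ ε_ (D.V D.zero) (rdual (D.V D.zero)) := by
      rw [h₂]; monoidal
    _ = 𝟙 _ ⊗≫ (rdual V ◁ D.unitHomMate) ▷ (V ⊗ D.V D.zero) ⊗≫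
          ε_ V (rdual V) ▷ D.V D.zero ⊗≫ (D.unitInvMate ▷ D.V D.zero ≫
            ε_ (D.V D.zero) (rdual (D.V D.zero))) := by
      rw [← whisker_exchange]; monoidal
    _ = 𝟙 _ ⊗≫ (rdual V ◁ D.unitHomMate) ▷ (V ⊗ D.V D.zero) ⊗≫
          (ε_ V (rdual V) ▷ D.V D.zero ≫ 𝟙_ C ◁ D.unitIso.inv) ⊗≫ 𝟙 _ := by
      rw [h₁]; monoidal
    _ = _ := by rw [← whisker_exchange]; monoidal

/-- `freeCounit` kills every summand of the free object except that of index zero, so only the term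
`(0, j)` of the coaction survives. -/
theorem coactTrace_V (j : I) : D.coactTrace S (D.V j) = S.coev (D.V j) ≫
    (rightAdjointMate (D.freeι (D.V j) D.zero ≫ D.freeCounit (D.V j))) ▷ D.V j ≫
      D.coendIn D.zero j := by
  have h : D.unitCoact (D.V j) =
      tensorLeftHomEquiv (D.V j) _ (rdual (rdual (D.V D.zero) ⊗ D.V j ⊗ D.V D.zero)) _
        (D.coendIn D.zero j) ≫ (D.freeι (D.V j) D.zero ≫ D.freeCounit (D.V j)) ▷ D.coendObj := by
    rw [unitCoact, freeCoact_V, Preadditive.sum_comp, Finset.sum_eq_single D.zero]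
    · simp
    · intro i _ hi
      rw [Category.assoc, ← comp_whiskerRight, D.freeι_freeCounit_of_ne _ hi]
      simp
    · simp
  rw [← tensorLeftHomEquiv_symm_mate, ← h]
  simp [coactTrace, traceElt, tensorLeftHomEquiv]

/-- The integral in terms of the summands of the coend. -/
theorem traceIntegral_eq_integral : D.traceIntegral S = D.integral S := by
  rw [integral_eq, traceIntegral_eq]
  refine Finset.sum_congr rfl fun j _ => ?_
  have h := D.rightAdjointMate_freeCounit (D.V j)
  rw [dim_eq, Linear.smul_comp, Category.id_comp, coactTrace_V, coendIn, summandIso]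
  congr 2
  simp only [Iso.trans_hom, whiskerRightIso_hom, whiskerLeftIso_hom, Category.assoc]
  rw [← comp_whiskerRight_assoc, h, MonoidalCategory.tensorHom_def]
  monoidal

end FusionStructure

end
end SphericalFusion

/-! ### The coend of the center, its Hopf structure and its integral -/

theorem mainTheorem2 {k : Type*} [CommRing k] {C : Type u} [Category.{v} C] [Preadditive C]
    [Linear k C] [MonoidalCategory C] [MonoidalPreadditive C] [MonoidalLinear k C]
    [HasFiniteBiproducts C] [RigidCategory C] {I : Type w} [Fintype I]
    (D : SphericalFusion.FusionStructure k C I) (S : SphericalFusion.SovereignStructure C)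
    (hS : S.IsSpherical) :
    ∃ (β : HalfBraiding D.coendObj) (i : ∀ M : Center C, SphericalFusion.rdual M ⊗ M ⟶ D.coendCenter β)
      (hi : ∀ ⦃M N : Center C⦄ (f : M ⟶ N),
        rightAdjointMate f ▷ M ≫ i M = SphericalFusion.rdual N ◁ f ≫ i N),
      (∀ (M : Center C) (d : SphericalFusion.Decomposition D.V M.1),
        (i M).f = D.coendι M d) ∧
      Nonempty (IsColimit (Cowedge.mk (F := SphericalFusion.dualTensor (Center C))
        (D.coendCenter β) i hi)) ∧
      ∃ H : HopfObj (D.coendCenter β), SphericalFusion.IsCoendHopf i H ∧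
        ∃ Λ : 𝟙_ (Center C) ⟶ D.coendCenter β,
          Λ.f = D.integral S ∧ SphericalFusion.IsInvariantIntegral H Λ := by
  have hδ := D.isUniversalCoaction_coactC
  refine ⟨D.coendHalfBraiding, SphericalFusion.coendFam D.coactC,
    fun M N f => SphericalFusion.coendFam_dinatural D.coactC_naturality f,
    D.coendFam_coactC, hδ.nonempty_isColimit _, hδ.hopfObj, hδ.isCoendHopf, ?_⟩
  refine ⟨⟨D.traceIntegral S, fun Y => ?_⟩, D.traceIntegral_eq_integral S, ?_, ?_, ?_⟩
  · rw [Center.tensorUnit_β]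
    exact D.traceIntegral_central S hS Y
  · refine Center.ext _ _ ?_
    exact (Iso.inv_comp_eq _).1 (D.traceIntegral_left S hS)
  · refine Center.ext _ _ ?_
    exact (Iso.inv_comp_eq _).1 (D.traceIntegral_right S hS)
  · exact Center.ext _ _ (D.traceIntegral_antipode S hS)
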